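/- **Setting.** The length $k$ of the instance $x\in\{0,1\}^k$ is the security parameter; negligible means $o(k^{-c})$ for every $c$. Efficient classical algorithms are polynomial-size Boolean circuit families (taking uniform coins), and polynomial-size quantum machines are families of quantum circuits with polynomially many gates and ancillas. *Commitments.* A secure dual-mode commitment scheme $(\mathcal G_B,\mathcal G_H,\mathrm{Commit})$ consists of efficient algorithms such that: (i) under $pk\leftarrow\mathcal G_H(1^k)$ it is statistically hiding: for all polynomially bounded message lengths and all messages $m_0,m_1$ of that length (which may depend on $pk$), the expected statistical distance of $\mathrm{Commit}_{pk}(m_0)$ and $\mathrm{Commit}_{pk}(m_1)$ is negligible; (ii) for $(pk,sk)\leftarrow\mathcal G_B(1^k)$, except with negligible probability over the key pair, an efficient algorithm given $sk$ extracts $m$ from $\mathrm{Commit}_{pk}(m;r)$ for all $m$ (of the given polynomially bounded length) and all $r$; (iii) no family of polynomial-size quantum circuits distinguishes the public keys of $\mathcal G_H$ and $\mathcal G_B$ with more than negligible advantage. *Multiparty protocol.* Let $R$ be an NP relation with language $L$. For each $k$ let $\pi$ be a synchronous $n$-party protocol ($n=n(k)$) with private channels and broadcast, with public input $(x,CRS)$,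 $CRS=(pk,c,pk')$, and private inputs $w_1,\dots,w_n$, which computes whether $w_1\oplus\dots\oplus w_n$ proves the claim "$x\in L$ (by an $R$-witness) or $c=\mathrm{Commit}_{pk}(1;r)$ (by the coins $r$)". Let $t=t(k)<n$ and assume that $\pi$ is perfectly correct, perfectly $t$-private (the views of any at most $t$ parties in an honest execution can be simulated perfectly from their inputs and the output), and perfectly $t$-robust (if no inputs prove the claim, no honest party ever accepts, whatever at most $t$ actively corrupted parties do); that honest executions can be emulated by polynomial-size circuits; that $c_1n\le t\le c_2n$ for all large $k$, with constants $0<c_1$, $c_2<1$; and that $\log k=o(n(k))$. *Proof system.* The reference string is $CRS=(pkB,\ c=\mathrm{Commit}_{pkB}(0),\ pkB')$, with both keys generated independently by $\mathcal G_B(1^k)$. (1) The prover, given an $R$-witness for $x$, shares the corresponding witness of the claim additively among $n$ virtual parties, emulates $\pi$, and sends commitments under $pkB'$ to the views of all parties. (2) The verifier sends a uniformly random set $e$ of $\lfloor t/2\rfloor$ parties. (3) The prover opens the commitments in $e$ (padded to fixed length). The verifier accepts iff the openings are correct, every opened view has output *accept*, and the opened views are pairwise consistent. **Theorem.** Under these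 assumptions the proof system is * *complete*: if $x\in L$ and the prover uses any $R$-witness, the verifier accepts with probability $1$; * *sound*: there is a negligible $\varepsilon$ such that for all $x\notin L$ every unbounded quantum prover (which sees $x$ and the CRS and exchanges classical messages with the verifier) makes the verifier accept with probability at most $\varepsilon(|x|)$; * *computationally superposition zero-knowledge*: there is a polynomial-size quantum simulator $S$ such that for every polynomial-size quantum verifier $V^*$ there is a negligible $\varepsilon$ with $|p_{\rm real}(x,w)-p_{\rm sim}(x)|\le\varepsilon(|x|)$ for all $x\in L$ and all $R$-witnesses $w$ of $x$. Here $V^*$ receives $x$, the CRS and the prover's first message, then sends a query $\sum_{e,y}\alpha_{e,y}|e\rangle|y\rangle$ (possibly entangled with its memory), gets it back with $|e\rangle|y\rangle$ replaced by $|e\rangle|y\oplus z(e)\rangle$, where $z(e)$ is the honest response to $e$ (the zero string if $e$ is not a valid challenge), and outputs a bit; $p_{\rm real}$ is the probability of output $1$ in the real execution. In the simulation $S$, given only $x$ and without rewinding $V^*$, provides a classical CRS and first message and then answers the query; $p_{\rm sim}$ is the probability of output $1$ there. -/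

import Mathlib

open Filter Topology

noncomputable section

/-! ## Bit strings, asymptotics, finite averages -/

/-- Bit strings whose positions are indexed by `ι`; `Bits (Fin ℓ)` is `{0,1}^ℓ`. -/
abbrev Bits (ι : Type) : Type := ι → Bool

/-- A function of the security parameter is negligible if it vanishes faster than `k ^ (-c)` for
every `c`. -/
def Negligible (ε : ℕ → ℝ) : Prop :=
  Asymptotics.SuperpolynomialDecay atTop (fun k : ℕ => (k : ℝ)) ε

/-- The expectation of `f` at a uniformly random point of a finite type. -/
def uavg {α : Type} [Fintype α] (f : α → ℝ) : ℝ := (∑ a, f a) / Fintype.card α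

/-- The expectation of `f` at a uniformly random element of a finite set. -/
def favg {α : Type} (S : Finset α) (f : α → ℝ) : ℝ := (∑ a ∈ S, f a) / S.card

open Classical in
/-- The indicator of a proposition, as a real number. -/
def indic (p : Prop) : ℝ := if p then 1 else 0

/-- The statistical (total variation) distance of two distributions on a finite type. -/
def statDist {α : Type} [Fintype α] (p q : PMF α) : ℝ :=
  (∑ a, |(p a).toReal - (q a).toReal|) / 2

/-! ## Classical circuits -/

/-- A Boolean circuit over the basis `{NAND}`. The wires are the inputs and the gates; gate number
`g` applies NAND to two wires (a reference to a gate that has not been computed yet reads the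
constant `0`). Each output is one of the wires. -/
structure BoolCircuit (ι κ : Type) where
  gates : List ((ι ⊕ ℕ) × (ι ⊕ ℕ))
  out : κ → ι ⊕ ℕ

namespace BoolCircuit

/-- The value of a wire, given the input and the list of gate values computed so far. -/
def wire {ι : Type} (x : Bits ι) (vals : List Bool) : ι ⊕ ℕ → Bool
  | Sum.inl i => x i
  | Sum.inr g => vals.getD g false

/-- The list of the values of all gates. -/
def gateVals {ι : Type} (gs : List ((ι ⊕ ℕ) × (ι ⊕ ℕ))) (x : Bits ι) : List Bool :=
  gs.foldl (fun vals g => vals ++ [!(wire x vals g.1 && wire x vals g.2)]) []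

/-- The function computed by the circuit. -/
def eval {ι κ : Type} (C : BoolCircuit ι κ) (x : Bits ι) : Bits κ :=
  fun o => wire x (gateVals C.gates x) (C.out o)

/-- The size of a circuit: inputs, gates and outputs are all counted. -/
def size {ι κ : Type} [Fintype ι] [Fintype κ] (C : BoolCircuit ι κ) : ℕ :=
  Fintype.card ι + C.gates.length + Fintype.card κ

end BoolCircuit

/-- The family `f` of functions is computed by a family of polynomial-size Boolean circuits. -/
def PolySizeComputable {ι κ : ℕ → Type} [∀ k, Fintype (ι k)] [∀ k, Fintype (κ k)]
    (f : ∀ k, Bits (ι k) → Bits (κ k)) : Prop :=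
  ∃ p : Polynomial ℕ, ∀ k, ∃ C : BoolCircuit (ι k) (κ k),
    C.size ≤ p.eval k ∧ ∀ x, C.eval x = f k x

/-! ## Quantum circuits -/

/-- (Not necessarily normalised) pure states of a register of qubits indexed by `ι`. -/
abbrev QState (ι : Type) : Type := Bits ι → ℂ

open Classical in
/-- The computational basis state `|b⟩`. -/
def ket {ι : Type} (b : Bits ι) : QState ι := fun b' => if b' = b then 1 else 0

/-- Elementary gates on the qubits indexed by `ι`: an arbitrary one-qubit unitary on qubit `i`, or
the Toffoli gate with controls `i`, `j` and target `l` (for `i = j` this is a CNOT gate). -/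
inductive QGate (ι : Type) where
  | single (i : ι) (U : Matrix.unitaryGroup Bool ℂ)
  | toffoli (i j l : ι) (hi : i ≠ l) (hj : j ≠ l)

open Classical in
/-- The unitary transformation performed by a gate. -/
def QGate.apply {ι : Type} : QGate ι → QState ι → QState ι
  | .single i U, ψ => fun b => ∑ c : Bool, U.1 (b i) c * ψ (Function.update b i c)
  | .toffoli i j l _ _, ψ => fun b => ψ (Function.update b l (xor (b l) (b i && b j)))

/-- The same gate, acting on the wires of a larger register. -/
def QGate.map {ι κ : Type} (f : ι ↪ κ) : QGate ι → QGate κ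
  | .single i U => .single (f i) U
  | .toffoli i j l hi hj => .toffoli (f i) (f j) (f l)
      (fun h => hi (f.injective h)) (fun h => hj (f.injective h))

/-- A quantum circuit is a list of gates, performed from left to right; its length is its size. -/
abbrev QCircuit (ι : Type) : Type := List (QGate ι)

def QCircuit.run {ι : Type} (C : QCircuit ι) (ψ : QState ι) : QState ι :=
  C.foldl (fun φ g => g.apply φ) ψ

/-- The same circuit, acting on the wires of a larger register. -/
def QCircuit.embed {ι κ : Type} (f : ι ↪ κ) (C : QCircuit ι) : QCircuit κ :=
  List.map (QGate.map f) C

open Classical in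
/-- The probability that measuring qubit `o` of `ψ` gives `1`. -/
def probOne {ι : Type} [Fintype ι] (o : ι) (ψ : QState ι) : ℝ :=
  ∑ b : Bits ι, if b o = true then ‖ψ b‖ ^ 2 else 0

/-- A quantum distinguisher for bit strings indexed by `ι`: a circuit on the input register and
`anc + 1` ancillas initialised to `|0⟩`. Its output is a measurement of ancilla number `0`. -/
structure QDistinguisher (ι : Type) where
  anc : ℕ
  circ : QCircuit (ι ⊕ Fin (anc + 1))

namespace QDistinguisher

def size {ι : Type} (D : QDistinguisher ι) : ℕ := D.anc + D.circ.length

/-- The probability that the distinguisher outputs `1` on input `s`. -/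
def prob {ι : Type} [Fintype ι] (D : QDistinguisher ι) (s : Bits ι) : ℝ :=
  probOne (Sum.inr 0) (D.circ.run (ket (Sum.elim s fun _ => false)))

end QDistinguisher

/-! ## NP relations -/

/-- An NP relation: decided by a polynomial-time Turing machine, with witnesses for an instance `x`
of length exactly `witLen |x|`, a polynomial in the length of `x`. -/
structure NPRelation where
  rel : List Bool → List Bool → Bool
  witLen : Polynomial ℕ
  polyTime : Nonempty (Turing.TM2ComputableInPolyTime
    (fun p : List Bool × List Bool =>
      (p.1.map Sum.inl ++ p.2.map Sum.inr : List (Bool ⊕ Bool)))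
    Computability.encodeBool (fun p : List Bool × List Bool => rel p.1 p.2))

namespace NPRelation

/-- The NP language defined by the relation. -/
def language (R : NPRelation) : Language Bool :=
  {x | ∃ w : List Bool, w.length = R.witLen.eval x.length ∧ R.rel x w = true}

/-- `w` is a witness for `x`, for strings of the right lengths. -/
def holds (R : NPRelation) {k : ℕ} (x : Bits (Fin k)) (w : Bits (Fin (R.witLen.eval k))) : Bool :=
  R.rel (List.ofFn x) (List.ofFn w)

end NPRelation

/-! ## Dual-mode commitment schemes -/

/-- The algorithms of a keyed commitment scheme with two key generators. All of them are
deterministic functions of their input and of uniformly random coins. `commit k ℓ pk m r` commits to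
the message `m ∈ {0,1}^ℓ`; a commitment is opened by sending `(m, r)`. -/
structure CommitmentScheme where
  pkLen : ℕ → ℕ
  skLen : ℕ → ℕ
  /-- number of coins of the generator `genB` -/
  coinB : ℕ → ℕ
  /-- number of coins of the generator `genH` -/
  coinH : ℕ → ℕ
  /-- number of coins used to commit to an `ℓ`-bit message -/
  rLen : ℕ → ℕ → ℕ
  /-- length of a commitment to an `ℓ`-bit message -/
  cLen : ℕ → ℕ → ℕ
  /-- generator of a public key together with a secret key -/
  genB : ∀ k, Bits (Fin (coinB k)) → Bits (Fin (pkLen k)) × Bits (Fin (skLen k))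
  /-- generator of a public key -/
  genH : ∀ k, Bits (Fin (coinH k)) → Bits (Fin (pkLen k))
  commit : ∀ k ℓ, Bits (Fin (pkLen k)) → Bits (Fin ℓ) → Bits (Fin (rLen k ℓ)) →
    Bits (Fin (cLen k ℓ))
  extract : ∀ k ℓ, Bits (Fin (skLen k)) → Bits (Fin (cLen k ℓ)) → Bits (Fin ℓ)

/-- A message length that is polynomially bounded in the security parameter. -/
def PolyBounded (ℓ : ℕ → ℕ) : Prop := ∃ p : Polynomial ℕ, ∀ k, ℓ k ≤ p.eval k

namespace CommitmentScheme

variable (C : CommitmentScheme)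

/-- The distribution of a commitment to `m` under the key `pk`. -/
def commitDist (k ℓ : ℕ) (pk : Bits (Fin (C.pkLen k))) (m : Bits (Fin ℓ)) :
    PMF (Bits (Fin (C.cLen k ℓ))) :=
  (PMF.uniformOfFintype (Bits (Fin (C.rLen k ℓ)))).map (C.commit k ℓ pk m)

/-- Key generation, committing and extraction are efficient. -/
structure Efficient : Prop where
  genB : PolySizeComputable (ι := fun k => Fin (C.coinB k))
    (κ := fun k => Fin (C.pkLen k) ⊕ Fin (C.skLen k))
    (fun k s => Sum.elim (C.genB k s).1 (C.genB k s).2)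
  genH : PolySizeComputable (ι := fun k => Fin (C.coinH k)) (κ := fun k => Fin (C.pkLen k)) C.genH
  commit : ∀ ℓ : ℕ → ℕ, PolyBounded ℓ → PolySizeComputable
    (ι := fun k => Fin (C.pkLen k) ⊕ (Fin (ℓ k) ⊕ Fin (C.rLen k (ℓ k))))
    (κ := fun k => Fin (C.cLen k (ℓ k)))
    (fun k b => C.commit k (ℓ k) (fun i => b (.inl i)) (fun i => b (.inr (.inl i)))
      (fun i => b (.inr (.inr i))))
  extract : ∀ ℓ : ℕ → ℕ, PolyBounded ℓ → PolySizeComputable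
    (ι := fun k => Fin (C.skLen k) ⊕ Fin (C.cLen k (ℓ k))) (κ := fun k => Fin (ℓ k))
    (fun k b => C.extract k (ℓ k) (fun i => b (.inl i)) (fun i => b (.inr i)))

/-- Unconditional (statistical) hiding under keys from `genH`: commitments to any two messages of
the same length, even if chosen by an unbounded adversary who knows the key, are statistically
close. -/
def Hiding : Prop :=
  ∀ ℓ : ℕ → ℕ, PolyBounded ℓ → ∀ m₀ m₁ : ∀ k, Bits (Fin (C.pkLen k)) → Bits (Fin (ℓ k)),
    Negligible fun k => uavg fun s : Bits (Fin (C.coinH k)) =>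
      statDist (C.commitDist k (ℓ k) (C.genH k s) (m₀ k (C.genH k s)))
        (C.commitDist k (ℓ k) (C.genH k s) (m₁ k (C.genH k s)))

/-- Unconditional binding under keys from `genB`, by extraction: except with negligible
probability over the key pair, the secret key extracts the message from every commitment. -/
def Extractable : Prop :=
  ∀ ℓ : ℕ → ℕ, PolyBounded ℓ →
    Negligible fun k => uavg fun s : Bits (Fin (C.coinB k)) =>
      indic (∃ m r, C.extract k (ℓ k) (C.genB k s).2
        (C.commit k (ℓ k) (C.genB k s).1 m r) ≠ m)

/-- No family of polynomial-size quantum circuits distinguishes the two kinds of public keys. -/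
def KeysIndistinguishable : Prop :=
  ∀ D : ∀ k, QDistinguisher (Fin (C.pkLen k)), PolyBounded (fun k => (D k).size) →
    Negligible fun k =>
      (uavg fun s : Bits (Fin (C.coinH k)) => (D k).prob (C.genH k s)) -
      (uavg fun s : Bits (Fin (C.coinB k)) => (D k).prob (C.genB k s).1)

/-- Secure dual-mode commitment schemes. -/
structure SecureDualMode : Prop where
  isEfficient : C.Efficient
  isHiding : C.Hiding
  isExtractable : C.Extractable
  keysIndistinguishable : C.KeysIndistinguishable

end CommitmentScheme

/-! ## Multiparty protocols -/

/-- A synchronous multiparty protocol with secure point-to-point channels and a broadcast channel.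
The public input is a string of type `Bits P`, and the private input of each party a string of type
`Bits W`. In each round every party sends one message to every other party and broadcasts one
message; these depend on the party's input, its random tape and the messages that it received in
the earlier rounds. The destination `none` is the broadcast channel. In an inbox, `true` marks
messages that were broadcast and `false` messages from the private channel. -/
structure MPCProtocol (P W : Type) where
  /-- number of parties -/
  n : ℕ
  rounds : ℕ
  /-- length of the random tape of a party -/
  tapeLen : ℕ
  /-- length of a message -/
  msgLen : ℕ
  next : Bits P → ∀ (i : Fin n) (r : Fin rounds), Bits W → Bits (Fin tapeLen) →
    (Fin r → {j : Fin n // j ≠ i} → Bool → Bits (Fin msgLen)) →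
    Option {j : Fin n // j ≠ i} → Bits (Fin msgLen)
  /-- output of a party: public input, index, private input, random tape, messages received -/
  out : Bits P → ∀ i : Fin n, Bits W → Bits (Fin tapeLen) →
    (Fin rounds → {j : Fin n // j ≠ i} → Bool → Bits (Fin msgLen)) → Bool

namespace MPCProtocol

variable {P W : Type} (π : MPCProtocol P W)

/-- The positions of the bits of a view of party `i`: the bits of its input, its random tape, and
all messages that it received. -/
abbrev ViewIdx (i : Fin π.n) : Type :=
  W ⊕ (Fin π.tapeLen ⊕ (Fin π.rounds × {j : Fin π.n // j ≠ i} × Bool × Fin π.msgLen))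

/-- A view of party `i`. -/
abbrev View (i : Fin π.n) : Type := Bits (π.ViewIdx i)

namespace View

variable {π} {i : Fin π.n}

def input (v : π.View i) : Bits W := fun b => v (.inl b)

def tape (v : π.View i) : Bits (Fin π.tapeLen) := fun b => v (.inr (.inl b))

def inbox (v : π.View i) (r : Fin π.rounds) (j : {j : Fin π.n // j ≠ i}) (bc : Bool) :
    Bits (Fin π.msgLen) :=
  fun b => v (.inr (.inr (r, j, bc, b)))

def mk (a : Bits W) (ρ : Bits (Fin π.tapeLen))
    (m : Fin π.rounds → {j : Fin π.n // j ≠ i} → Bool → Bits (Fin π.msgLen)) : π.View i :=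
  Sum.elim a (Sum.elim ρ fun q => m q.1 q.2.1 q.2.2.1 q.2.2.2)

/-- The messages that party `i` sends according to the protocol, given its view. -/
def sends (v : π.View i) (pub : Bits P) (r : Fin π.rounds) (d : Option {j : Fin π.n // j ≠ i}) :
    Bits (Fin π.msgLen) :=
  π.next pub i r v.input v.tape (fun s => v.inbox (s.castLE r.2.le)) d

/-- The output of party `i`, given its view. -/
def output (v : π.View i) (pub : Bits P) : Bool := π.out pub i v.input v.tape v.inbox

end View

/-- All messages sent in an execution, by round, sender and destination. -/
abbrev Messages : Type :=
  Fin π.rounds → ∀ i : Fin π.n, Option {j : Fin π.n // j ≠ i} → Bits (Fin π.msgLen)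

variable {π} in
/-- The messages received by party `i`, if `M` is sent. -/
def Messages.receivedBy (M : π.Messages) (i : Fin π.n) (r : Fin π.rounds)
    (j : {j : Fin π.n // j ≠ i}) (bc : Bool) : Bits (Fin π.msgLen) :=
  M r j.1 (if bc then none else some ⟨i, j.2.symm⟩)

/-- The messages of the honest execution with inputs `ins` and random tapes `ρ`, round by round. -/
def honestMsg (pub : Bits P) (ins : Fin π.n → Bits W) (ρ : Fin π.n → Bits (Fin π.tapeLen))
    (r : ℕ) (hr : r < π.rounds) (i : Fin π.n) (d : Option {j : Fin π.n // j ≠ i}) :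
    Bits (Fin π.msgLen) :=
  π.next pub i ⟨r, hr⟩ (ins i) (ρ i)
    (fun s j bc => honestMsg pub ins ρ s.1 (s.2.trans hr) j.1
      (if bc then none else some ⟨i, j.2.symm⟩)) d
termination_by r
decreasing_by exact s.2

/-- The view of party `i` in the honest execution with inputs `ins` and random tapes `ρ`. -/
def honestView (pub : Bits P) (ins : Fin π.n → Bits W) (ρ : Fin π.n → Bits (Fin π.tapeLen))
    (i : Fin π.n) : π.View i :=
  View.mk (ins i) (ρ i)
    (Messages.receivedBy (fun r j d => π.honestMsg pub ins ρ r.1 r.2 j d) i)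

/-- In an execution in which the messages `M` are sent, party `i` follows the protocol and has
view `v`. -/
def Follows (pub : Bits P) (M : π.Messages) (i : Fin π.n) (v : π.View i) : Prop :=
  v.inbox = M.receivedBy i ∧ ∀ r, M r i = v.sends pub r

/-- Perfect correctness: in every honest execution, every party outputs the value of `F`. -/
def Correct (F : Bits P → (Fin π.n → Bits W) → Bool) : Prop :=
  ∀ pub ins ρ i, (π.honestView pub ins ρ i).output pub = F pub ins

/-- Perfect `t`-privacy: in an honest execution, the joint distribution of the views of any at most
`t` parties can be simulated perfectly from their inputs and the value of `F`. -/
def Private [Fintype W] (F : Bits P → (Fin π.n → Bits W) → Bool) (t : ℕ) : Prop :=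
  ∀ (pub : Bits P) (T : Finset (Fin π.n)), T.card ≤ t →
    ∃ Sim : ({i // i ∈ T} → Bits W) → Bool → PMF (∀ i : {i // i ∈ T}, π.View i.1),
      ∀ ins : Fin π.n → Bits W,
        (PMF.uniformOfFintype (Fin π.n → Bits (Fin π.tapeLen))).map
            (fun ρ (i : {i // i ∈ T}) => π.honestView pub ins ρ i.1) =
          Sim (fun i => ins i.1) (F pub ins)

/-- Perfect `t`-robustness (security against active corruption of `t` parties): if no inputs make
`F` accept, then no party outside a corrupted set `T` of at most `t` parties ever accepts, whatever
the inputs and tapes of the honest parties and whatever messages the corrupted parties send. -/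
def Robust (F : Bits P → (Fin π.n → Bits W) → Bool) (t : ℕ) : Prop :=
  ∀ pub : Bits P, (∀ ins, F pub ins = false) →
    ∀ T : Finset (Fin π.n), T.card ≤ t → ∀ (M : π.Messages) (v : ∀ i, π.View i),
      (∀ i, i ∉ T → π.Follows pub M i (v i)) → ∀ i, i ∉ T → (v i).output pub = false

/-- `π` securely computes `F` (with the same public output for all parties), with threshold `t`. -/
structure Secure [Fintype W] (F : Bits P → (Fin π.n → Bits W) → Bool) (t : ℕ) : Prop where
  correct : π.Correct F
  isPrivate : π.Private F t
  robust : π.Robust F t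

/-- Half of consistency of views of `i` and `j`: what `j` received from `i` is what `i` sends. -/
def Delivers (pub : Bits P) {i j : Fin π.n} (h : i ≠ j) (vi : π.View i) (vj : π.View j) : Prop :=
  ∀ r, vj.inbox r ⟨i, h⟩ false = vi.sends pub r (some ⟨j, h.symm⟩) ∧
    vj.inbox r ⟨i, h⟩ true = vi.sends pub r none

/-- Views of two parties are consistent: each received exactly what the other one sends according
to the protocol, and both received the same broadcasts from all other parties. -/
def Consistent (pub : Bits P) {i j : Fin π.n} (h : i ≠ j) (vi : π.View i) (vj : π.View j) : Prop :=
  π.Delivers pub h vi vj ∧ π.Delivers pub h.symm vj vi ∧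
    ∀ r l (hi : l ≠ i) (hj : l ≠ j), vi.inbox r ⟨l, hi⟩ true = vj.inbox r ⟨l, hj⟩ true

/-- The length of a view. -/
def viewLen [Fintype W] : ℕ :=
  Fintype.card W + (π.tapeLen + π.rounds * ((π.n - 1) * (2 * π.msgLen)))

theorem card_viewIdx [Fintype W] (i : Fin π.n) : Fintype.card (π.ViewIdx i) = π.viewLen := by
  have h : Fintype.card {j : Fin π.n // j ≠ i} = π.n - 1 := by
    simp [Fintype.card_subtype_compl]
  simp only [ViewIdx, viewLen, Fintype.card_sum, Fintype.card_prod, Fintype.card_fin,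
    Fintype.card_bool, h]

/-- The bits of a view, written as a string of length `viewLen` in some fixed order. -/
def viewEquiv [Fintype W] (i : Fin π.n) : π.ViewIdx i ≃ Fin π.viewLen :=
  Fintype.equivFinOfCardEq (π.card_viewIdx i)

def encodeView [Fintype W] {i : Fin π.n} (v : π.View i) : Bits (Fin π.viewLen) :=
  fun b => v ((π.viewEquiv i).symm b)

def decodeView [Fintype W] (i : Fin π.n) (s : Bits (Fin π.viewLen)) : π.View i :=
  fun b => s (π.viewEquiv i b)

end MPCProtocol

/-- A family of protocols is efficient if its honest executions can be emulated by polynomial-size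
circuits: all views are computed from the public input, the private inputs and the random tapes. -/
def MPCEfficient {P W : ℕ → Type} [∀ k, Fintype (P k)] [∀ k, Fintype (W k)]
    (π : ∀ k, MPCProtocol (P k) (W k)) : Prop :=
  PolySizeComputable
    (ι := fun k => P k ⊕ ((Fin (π k).n × W k) ⊕ (Fin (π k).n × Fin (π k).tapeLen)))
    (κ := fun k => Σ i : Fin (π k).n, (π k).ViewIdx i)
    (fun k b q => (π k).honestView (fun a => b (.inl a)) (fun i a => b (.inr (.inl (i, a))))
      (fun i a => b (.inr (.inr (i, a)))) q.1 q.2)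

/-- The sum modulo `2` of `n` strings. -/
def xorAll {n : ℕ} {W : Type} (ins : Fin n → Bits W) : Bits W :=
  fun b => decide (Odd (Finset.univ.filter fun i => ins i b = true).card)

/-- Additive secret sharing of `w` among `n` parties, with coins `s`: all shares but the last are
uniformly random, and the last share makes the sum of the shares equal to `w`. -/
def additiveShares {n : ℕ} {W : Type} (w : Bits W) (s : Fin n → Bits W) : Fin n → Bits W :=
  fun i b => if i.1 + 1 = n then
    xor (w b) (decide (Odd (Finset.univ.filter fun j : Fin n => j.1 + 1 ≠ n ∧ s j b = true).card))
  else s i b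

/-! ## Three-move public-coin proof systems in the common reference string model -/

/-- A three-move public-coin protocol for instances `x ∈ {0,1}^k`. The honest verifier's challenge
is uniformly random in `challenges`. -/
structure CRSProof where
  /-- bit positions of the prover's witness -/
  Wit : ℕ → Type
  /-- bit positions of the coins of the generation of the reference string -/
  CrsCoin : ℕ → Type
  /-- bit positions of the reference string -/
  Crs : ℕ → Type
  /-- bit positions of the prover's coins -/
  Coin : ℕ → Type
  /-- bit positions of the first message -/
  Msg : ℕ → Type
  /-- bit positions of the challenge -/
  Chal : ℕ → Type
  /-- bit positions of the response -/
  Resp : ℕ → Type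
  finCrsCoin : ∀ k, Fintype (CrsCoin k)
  finCrs : ∀ k, Fintype (Crs k)
  finCoin : ∀ k, Fintype (Coin k)
  finMsg : ∀ k, Fintype (Msg k)
  finChal : ∀ k, Fintype (Chal k)
  finResp : ∀ k, Fintype (Resp k)
  crsGen : ∀ k, Bits (CrsCoin k) → Bits (Crs k)
  first : ∀ k, Bits (Fin k) → Bits (Crs k) → Bits (Wit k) → Bits (Coin k) → Bits (Msg k)
  respond : ∀ k, Bits (Fin k) → Bits (Crs k) → Bits (Wit k) → Bits (Coin k) → Bits (Chal k) →
    Bits (Resp k)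
  challenges : ∀ k, Finset (Bits (Chal k))
  accepts : ∀ k, Bits (Fin k) → Bits (Crs k) → Bits (Msg k) → Bits (Chal k) → Bits (Resp k) → Prop

attribute [instance] CRSProof.finCrsCoin CRSProof.finCrs CRSProof.finCoin CRSProof.finMsg
  CRSProof.finChal CRSProof.finResp

open Classical in
/-- An unbounded quantum prover, after it has seen the instance and the reference string. Its memory
consists of a work space of arbitrary finite dimension `dim`, and of registers for its two messages.
It prepares `state`; the register of the first message is measured (it is sent to a classical
verifier); when it receives the challenge `e`, it applies the unitary `move e` to all of its memory,
and the register of the second message is measured. -/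
structure QProver (A E Z : Type) [Fintype A] [Fintype Z] where
  dim : ℕ
  state : Fin dim × Bits A × Bits Z → ℂ
  normalized : ∑ s, ‖state s‖ ^ 2 = 1
  move : Bits E → Matrix.unitaryGroup (Fin dim × Bits A × Bits Z) ℂ

open Classical in
/-- The probability that the first message is `a`, and the second one `z`, if the challenge
is `e`. -/
def QProver.prob {A E Z : Type} [Fintype A] [Fintype Z] (Q : QProver A E Z)
    (a : Bits A) (e : Bits E) (z : Bits Z) : ℝ :=
  ∑ s : Fin Q.dim × Bits A, ‖((Q.move e).1.mulVec
    fun s' => if s'.2.1 = a then Q.state s' else 0) (s.1, s.2, z)‖ ^ 2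

/-- The registers of a superposition verifier: `C` for its classical input, the query registers `E`
(challenge) and `Z` (response), and `anc + 1` ancillas. -/
abbrev VReg (C E Z : Type) (anc : ℕ) : Type := C ⊕ ((E ⊕ Z) ⊕ Fin (anc + 1))

/-- A superposition verifier: a circuit that prepares the query, and a circuit that is applied after
the query has been answered. Its output is a measurement of ancilla number `0`. -/
structure QVerifier (C E Z : Type) where
  anc : ℕ
  query : QCircuit (VReg C E Z anc)
  finish : QCircuit (VReg C E Z anc)

namespace QVerifier

variable {C E Z : Type}

def size (V : QVerifier C E Z) : ℕ := V.anc + V.query.length + V.finish.length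

/-- The content of the verifier's registers in the beginning, on classical input `c`. -/
def initBits (V : QVerifier C E Z) (c : Bits C) : Bits (VReg C E Z V.anc) :=
  Sum.elim c fun _ => false

/-- The verifier's output qubit. -/
def outQubit (V : QVerifier C E Z) : VReg C E Z V.anc := .inr (.inr 0)

end QVerifier

/-- Running the function `f` in superposition on the query registers:
`|e⟩|y⟩ ↦ |e⟩|y + f(e)⟩`, and identity on all other registers. -/
def runInSuperposition {C E Z : Type} {anc : ℕ} (f : Bits E → Bits Z)
    (ψ : QState (VReg C E Z anc)) : QState (VReg C E Z anc) :=
  fun b => ψ (Sum.elim (fun c => b (.inl c)) (Sum.elim (Sum.elim (fun e => b (.inr (.inl (.inl e))))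
    (fun z => xor (b (.inr (.inl (.inr z)))) (f (fun e => b (.inr (.inl (.inl e)))) z)))
    (fun a => b (.inr (.inr a)))))

/-- The registers of a simulator: the instance, the message that it sends to the verifier (reference
string and first message), and ancillas. -/
abbrev SReg (X M : Type) (anc : ℕ) : Type := X ⊕ (M ⊕ Fin anc)

/-- A simulator (without rewinding): the circuit `start` prepares the message for the verifier, and
the circuit `answer` answers the query of the verifier, acting on the simulator's registers
and on the query registers. -/
structure QSimulator (X M E Z : Type) where
  anc : ℕ
  start : QCircuit (SReg X M anc)
  answer : QCircuit (SReg X M anc ⊕ (E ⊕ Z))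

namespace QSimulator

variable {X M E Z : Type}

def size (S : QSimulator X M E Z) : ℕ := S.anc + S.start.length + S.answer.length

/-- The position of the registers on which `answer` acts, among the registers of simulator and
verifier. -/
def answerEmb (X M E Z : Type) (s v : ℕ) :
    SReg X M s ⊕ (E ⊕ Z) ↪ SReg X M s ⊕ VReg (X ⊕ M) E Z v :=
  Function.Embedding.sumMap (Function.Embedding.refl _)
    (Function.Embedding.inl.trans Function.Embedding.inr)

open Classical in
/-- The probability that the verifier outputs `1` when it interacts with the simulator on input `x`.
The message of the simulator is classical: its register is measured, the result is `m` with the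
unnormalised state obtained by projection, and the verifier receives `(x, m)`. -/
def prob [Fintype X] [Fintype M] [Fintype E] [Fintype Z] (S : QSimulator X M E Z)
    (V : QVerifier (X ⊕ M) E Z) (x : Bits X) : ℝ :=
  ∑ m : Bits M,
    let started : QState (SReg X M S.anc) := S.start.run (ket (Sum.elim x fun _ => false))
    let sent : QState (SReg X M S.anc ⊕ VReg (X ⊕ M) E Z V.anc) := fun b =>
      if (fun q => b (.inl (.inr (.inl q)))) = m ∧ (fun q => b (.inr q)) = V.initBits (Sum.elim x m)
      then started (fun q => b (.inl q)) else 0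
    let queried := (V.query.embed Function.Embedding.inr).run sent
    let answered := (S.answer.embed (answerEmb X M E Z S.anc V.anc)).run queried
    probOne (.inr V.outQubit) ((V.finish.embed Function.Embedding.inr).run answered)

end QSimulator

namespace CRSProof

variable (Sys : CRSProof)

open Classical in
/-- The probability that the honest verifier accepts the honest prover. -/
def honestProb (k : ℕ) (x : Bits (Fin k)) (w : Bits (Sys.Wit k)) : ℝ :=
  uavg fun s : Bits (Sys.CrsCoin k) => uavg fun ρ : Bits (Sys.Coin k) =>
    favg (Sys.challenges k) fun e =>
      let crs := Sys.crsGen k s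
      indic (Sys.accepts k x crs (Sys.first k x crs w ρ) e (Sys.respond k x crs w ρ e))

open Classical in
/-- The probability that the honest verifier accepts a prover (which sees the reference string). -/
def cheatProb (k : ℕ) (x : Bits (Fin k))
    (Pr : Bits (Sys.Crs k) → QProver (Sys.Msg k) (Sys.Chal k) (Sys.Resp k)) : ℝ :=
  uavg fun s : Bits (Sys.CrsCoin k) => favg (Sys.challenges k) fun e =>
    let crs := Sys.crsGen k s
    ∑ a : Bits (Sys.Msg k), ∑ z : Bits (Sys.Resp k),
      indic (Sys.accepts k x crs a e z) * (Pr crs).prob a e z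

/-- The classical input of the verifier: instance, reference string, first message. -/
abbrev VInput (k : ℕ) : Type := Fin k ⊕ (Sys.Crs k ⊕ Sys.Msg k)

open Classical in
/-- The probability that the superposition verifier `V` outputs `1` in the real protocol. -/
def realProb (k : ℕ) (V : QVerifier (Sys.VInput k) (Sys.Chal k) (Sys.Resp k))
    (x : Bits (Fin k)) (w : Bits (Sys.Wit k)) : ℝ :=
  uavg fun s : Bits (Sys.CrsCoin k) => uavg fun ρ : Bits (Sys.Coin k) =>
    let crs := Sys.crsGen k s
    let queried := V.query.run
      (ket (V.initBits (Sum.elim x (Sum.elim crs (Sys.first k x crs w ρ)))))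
    probOne V.outQubit (V.finish.run (runInSuperposition (Sys.respond k x crs w ρ) queried))

/-- Completeness, for the prover's witness relation `wit`. -/
def Complete (wit : ∀ k, Bits (Fin k) → Bits (Sys.Wit k) → Prop) : Prop :=
  ∀ k x w, wit k x w → Sys.honestProb k x w = 1

/-- Soundness against unbounded quantum provers. -/
def Sound (L : Language Bool) : Prop :=
  ∃ ε : ℕ → ℝ, Negligible ε ∧ ∀ (k : ℕ) (x : Bits (Fin k)), List.ofFn x ∉ L →
    ∀ Pr, Sys.cheatProb k x Pr ≤ ε k

/-- Computational superposition zero-knowledge: one polynomial-size simulator works for all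
polynomial-size superposition verifiers. -/
def SuperpositionZK (wit : ∀ k, Bits (Fin k) → Bits (Sys.Wit k) → Prop) : Prop :=
  ∃ S : ∀ k, QSimulator (Fin k) (Sys.Crs k ⊕ Sys.Msg k) (Sys.Chal k) (Sys.Resp k),
    PolyBounded (fun k => (S k).size) ∧
    ∀ V : ∀ k, QVerifier (Sys.VInput k) (Sys.Chal k) (Sys.Resp k), PolyBounded (fun k => (V k).size) →
      ∃ ε : ℕ → ℝ, Negligible ε ∧ ∀ k x w, wit k x w →
        |Sys.realProb k (V k) x w - (S k).prob (V k) x| ≤ ε k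

end CRSProof

/-! ## The protocol -/

namespace SuperpositionProof

variable (R : NPRelation) (C : CommitmentScheme)

/-- Bit positions of the reference string `(pkB, c, pkB')`. -/
abbrev CrsIdx (k : ℕ) : Type := Fin (C.pkLen k) ⊕ (Fin (C.cLen k 1) ⊕ Fin (C.pkLen k))

/-- Bit positions of a public input `(x, CRS)` of the multiparty protocol. -/
abbrev PubIdx (k : ℕ) : Type := Fin k ⊕ CrsIdx C k

/-- Bit positions of a witness of the statement `x ∈ L or c contains 1`: a bit that selects one of
the two alternatives, a witness for `x ∈ L`, and coins that open `c` to `1`. -/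
abbrev WitIdx (k : ℕ) : Type := Unit ⊕ (Fin (R.witLen.eval k) ⊕ Fin (C.rLen k 1))

variable {R C}

/-- The statement proved by the multiparty protocol: depending on the selector bit of `w`, either
`w` contains coins that open `c` to `1` under the key `pkB`, or `w` contains a witness
for `x ∈ L`. -/
def claim {k : ℕ} (pub : Bits (PubIdx C k)) (w : Bits (WitIdx R C k)) : Bool :=
  if w (.inl ()) then
    decide (C.commit k 1 (fun i => pub (.inr (.inl i))) (fun _ => true)
      (fun i => w (.inr (.inr i))) = fun i => pub (.inr (.inr (.inl i))))
  else R.holds (fun i => pub (.inl i)) (fun i => w (.inr (.inl i)))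

variable (R C) in
/-- The function computed by `n` parties: does the sum of the inputs prove the claim? -/
def functionality (k n : ℕ) (pub : Bits (PubIdx C k)) (ins : Fin n → Bits (WitIdx R C k)) : Bool :=
  claim pub (xorAll ins)

/-- The reference string is `(pkB, Commit_pkB(0), pkB')`. -/
def genCrs (k : ℕ) (s : Bits (Fin (C.coinB k) ⊕ (Fin (C.rLen k 1) ⊕ Fin (C.coinB k)))) :
    Bits (CrsIdx C k) :=
  let pk := (C.genB k fun i => s (.inl i)).1
  Sum.elim pk (Sum.elim (C.commit k 1 pk (fun _ => false) fun i => s (.inr (.inl i)))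
    (C.genB k fun i => s (.inr (.inr i))).1)

/-- The honest prover's witness for the claim, from its witness for `x ∈ L`. -/
def liftWitness {k : ℕ} (w : Bits (Fin (R.witLen.eval k))) : Bits (WitIdx R C k) :=
  Sum.elim (fun _ => false) (Sum.elim w fun _ => false)

/-- The second public key in the reference string. -/
def key {k : ℕ} (crs : Bits (CrsIdx C k)) : Bits (Fin (C.pkLen k)) := fun i => crs (.inr (.inr i))

section

variable {k : ℕ} (π : MPCProtocol (PubIdx C k) (WitIdx R C k))

/-- Bit positions of the prover's coins: coins for sharing the witness, the random tapes of the
virtual parties, and the coins of the commitments to their views. -/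
abbrev CoinIdx : Type :=
  (Fin π.n × WitIdx R C k) ⊕ ((Fin π.n × Fin π.tapeLen) ⊕
    (Fin π.n × Fin (C.rLen k π.viewLen)))

/-- The view of virtual party `i` in the prover's emulation of the protocol, as a string. -/
def emulatedView (x : Bits (Fin k)) (crs : Bits (CrsIdx C k)) (w : Bits (Fin (R.witLen.eval k)))
    (ρ : Bits (CoinIdx π)) (i : Fin π.n) : Bits (Fin π.viewLen) :=
  π.encodeView (π.honestView (Sum.elim x crs)
    (additiveShares (liftWitness w) fun j b => ρ (.inl (j, b)))
    (fun j b => ρ (.inr (.inl (j, b)))) i)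

/-- The prover's first message: commitments to all views. -/
def proverFirst (x : Bits (Fin k)) (crs : Bits (CrsIdx C k)) (w : Bits (Fin (R.witLen.eval k)))
    (ρ : Bits (CoinIdx π)) : Bits (Fin π.n × Fin (C.cLen k π.viewLen)) :=
  fun q => C.commit k π.viewLen (key crs) (emulatedView π x crs w ρ q.1)
    (fun b => ρ (.inr (.inr (q.1, b)))) q.2

/-- The challenges: subsets of the parties of size `t / 2`, given as indicator strings. -/
def challengeSets (n t : ℕ) : Finset (Bits (Fin n)) :=
  Finset.univ.filter fun e => (Finset.univ.filter fun i => e i = true).card = t / 2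

/-- The prover's response: the openings `(view, coins)` of the commitments in `e`, padded by zeros
at the other positions. To a string that is not a challenge, the prover responds by zeros. -/
def proverRespond (t : ℕ) (x : Bits (Fin k)) (crs : Bits (CrsIdx C k))
    (w : Bits (Fin (R.witLen.eval k))) (ρ : Bits (CoinIdx π)) (e : Bits (Fin π.n)) :
    Bits (Fin π.n × (Fin π.viewLen ⊕ Fin (C.rLen k π.viewLen))) :=
  fun q => if e ∈ challengeSets π.n t ∧ e q.1 = true then
      Sum.elim (emulatedView π x crs w ρ q.1) (fun b => ρ (.inr (.inr (q.1, b)))) q.2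
    else false

/-- The view of party `i` that is opened in the response `z`. -/
def openedView (z : Bits (Fin π.n × (Fin π.viewLen ⊕ Fin (C.rLen k π.viewLen)))) (i : Fin π.n) :
    π.View i :=
  π.decodeView i fun b => z (i, .inl b)

/-- The verifier checks that the commitments in `e` are opened correctly, that the output is
`accept` in each opened view, and that the opened views are pairwise consistent. -/
def verifierAccepts (x : Bits (Fin k)) (crs : Bits (CrsIdx C k))
    (a : Bits (Fin π.n × Fin (C.cLen k π.viewLen))) (e : Bits (Fin π.n))
    (z : Bits (Fin π.n × (Fin π.viewLen ⊕ Fin (C.rLen k π.viewLen)))) : Prop :=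
  (∀ i, e i = true → (C.commit k π.viewLen (key crs) (fun b => z (i, .inl b))
      (fun b => z (i, .inr b)) = fun b => a (i, b))) ∧
  (∀ i, e i = true → (openedView π z i).output (Sum.elim x crs) = true) ∧
  ∀ i j (h : i ≠ j), e i = true → e j = true →
    π.Consistent (Sum.elim x crs) h (openedView π z i) (openedView π z j)

end

/-- The superposition-secure zero-knowledge proof for the language of `R`. -/
def proofSystem (π : ∀ k, MPCProtocol (PubIdx C k) (WitIdx R C k)) (t : ℕ → ℕ) : CRSProof where
  Wit k := Fin (R.witLen.eval k)
  CrsCoin k := Fin (C.coinB k) ⊕ (Fin (C.rLen k 1) ⊕ Fin (C.coinB k))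
  Crs k := CrsIdx C k
  Coin k := CoinIdx (π k)
  Msg k := Fin (π k).n × Fin (C.cLen k (π k).viewLen)
  Chal k := Fin (π k).n
  Resp k := Fin (π k).n × (Fin (π k).viewLen ⊕ Fin (C.rLen k (π k).viewLen))
  finCrsCoin _ := inferInstance
  finCrs _ := inferInstance
  finCoin _ := inferInstance
  finMsg _ := inferInstance
  finChal _ := inferInstance
  finResp _ := inferInstance
  crsGen k := genCrs k
  first k := proverFirst (π k)
  respond k := proverRespond (π k) (t k)
  challenges k := challengeSets (π k).n (t k)
  accepts k := verifierAccepts (π k)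

end SuperpositionProof

end

/-! ## Averages -/

section Averages

variable {α β : Type} [Fintype α] [Fintype β]

/-! Completeness. The additive shares sum to the witness, so perfect correctness makes every virtual
party accept, and views from one honest execution are consistent.

Soundness. Outside a negligible event both key pairs extract correctly. Then `c` has no opening to
`1`, so for `x ∉ L` no inputs prove the claim (`functionality_eq_false`), and the first message
fixes one view per party before the challenge is drawn (`convincing_of_verifierAccepts`). Join two
parties if their views conflict, take a maximum matching, and let `T` be the set of its endpoints.
If `T` has at most `t` elements, the views outside `T` occur in an execution in which only `T` is
corrupted; by robustness they all reject, so a successful challenge lies inside `T`. Otherwise the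
challenge must miss more than `t / 2` disjoint edges. Comparing a random set of fixed size with
independent coin flips, at the cost of a factor `n + 1`, shows that both events have probability
exponentially small in `n` (`favg_convincing_le`, `exists_challenge_error_le`), hence negligible
since `log k = o(n)`. A quantum prover gains nothing: its first message is measured, and the law of
this message cannot depend on the challenge (`QProver.favg_accept_le`).

Zero-knowledge. The simulator commits to `1` in the reference string and runs the honest prover with
the coins of this commitment as witness. It knows all openings, so it can answer any superposition
of challenges without rewinding. Real and simulated games are joined by hybrids
(`exists_negligible_hybridGame`): make both keys hiding, change the committed bit from `0` to `1`,
change the witness, make both keys extractable again.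

The change of witness (`abs_uavg_claimGame_sub_le`) is the core. The output probability is quadratic
in the answered state, so it is a sum of terms indexed by pairs of challenges
(`gameProb_eq_sum_pairTerm`), each involving the openings of at most `2⌊t/2⌋ ≤ t` parties. There are
exponentially many terms, so they have to agree exactly. For this, the commitments are first
replaced, once for the whole game, by commitments to a fixed string with coins resampled from the
correct conditional law; this costs `n` statistical distances (`abs_uavg_commit_sub_resample_le`)
and need not be efficient. Afterwards each term depends on at most `t` views, whose joint law is the
same for both witnesses by secret sharing and perfect privacy.

The remaining work turns polynomial-size Boolean circuits into reversible quantum circuits that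
clean up their ancillas (`HasProgram.exists_oracle`). From these come the simulator, with Hadamard
gates as coins (`exists_game_simulator`), and the key distinguishers that play the verifier's game
(`exists_game_distinguisher`). -/

theorem uavg_congr {f g : α → ℝ} (h : ∀ a, f a = g a) : uavg f = uavg g := by
  rw [funext h]

theorem uavg_const [Nonempty α] (c : ℝ) : uavg (fun _ : α => c) = c := by
  simp [uavg]

theorem uavg_mono {f g : α → ℝ} (h : ∀ a, f a ≤ g a) : uavg f ≤ uavg g := by
  unfold uavg
  gcongr with a
  exact h a

theorem uavg_add (f g : α → ℝ) : uavg (fun a => f a + g a) = uavg f + uavg g := by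
  simp [uavg, Finset.sum_add_distrib, add_div]

theorem uavg_sub (f g : α → ℝ) : uavg (fun a => f a - g a) = uavg f - uavg g := by
  simp [uavg, Finset.sum_sub_distrib, sub_div]

theorem uavg_const_mul (c : ℝ) (f : α → ℝ) : uavg (fun a => c * f a) = c * uavg f := by
  unfold uavg
  rw [← Finset.mul_sum, mul_div_assoc]

theorem uavg_nonneg {f : α → ℝ} (h : ∀ a, 0 ≤ f a) : 0 ≤ uavg f :=
  div_nonneg (Finset.sum_nonneg fun a _ => h a) (Nat.cast_nonneg _)

theorem uavg_equiv (e : α ≃ β) (f : β → ℝ) : uavg (fun a => f (e a)) = uavg f := by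
  unfold uavg
  rw [Equiv.sum_comp e f, Fintype.card_congr e]

theorem uavg_comm (f : α → β → ℝ) :
    (uavg fun a => uavg fun b => f a b) = uavg fun b => uavg fun a => f a b := by
  unfold uavg
  simp only [← Finset.sum_div]
  rw [Finset.sum_comm, div_right_comm]

theorem uavg_prod (f : α × β → ℝ) : uavg f = uavg fun a => uavg fun b => f (a, b) := by
  unfold uavg
  simp only [← Finset.sum_div]
  rw [Fintype.sum_prod_type, Fintype.card_prod, Nat.cast_mul, div_div, mul_comm]

theorem uavg_sum {J : Type} [Fintype J] (f : J → α → ℝ) :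
    (uavg fun a => ∑ j, f j a) = ∑ j, uavg (f j) := by
  unfold uavg
  rw [Finset.sum_comm, Finset.sum_div]

/-- The `Fintype` instance of `Bits ι` depends on the decidable equality chosen for `ι`, which is
classical in some definitions and concrete in others. -/
theorem uavg_inst {α : Type} (i j : Fintype α) (f : α → ℝ) : @uavg α i f = @uavg α j f := by
  rw [Subsingleton.elim i j]

theorem abs_uavg_le (f : α → ℝ) : |uavg f| ≤ uavg fun a => |f a| := by
  unfold uavg
  rw [abs_div, Nat.abs_cast]
  gcongr
  exact Finset.abs_sum_le_sum_abs _ _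

theorem uavg_le_of_forall_le [Nonempty α] {f : α → ℝ} {c : ℝ} (h : ∀ a, f a ≤ c) : uavg f ≤ c :=
  (uavg_mono h).trans_eq (uavg_const c)

theorem abs_uavg_sub_le {f g h : α → ℝ} (H : ∀ a, |f a - g a| ≤ h a) :
    |uavg f - uavg g| ≤ uavg h := by
  rw [← uavg_sub]
  exact (abs_uavg_le _).trans (uavg_mono H)

theorem uavg_involutive {σ : α → α} (hσ : Function.Involutive σ) (f : α → ℝ) :
    uavg (fun a => f (σ a)) = uavg f :=
  uavg_equiv hσ.toPerm f

theorem indic_of_true {p : Prop} (h : p) : indic p = 1 := by simp [indic, h]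

theorem indic_of_false {p : Prop} (h : ¬p) : indic p = 0 := by simp [indic, h]

theorem indic_nonneg (p : Prop) : 0 ≤ indic p := by
  unfold indic; split_ifs <;> norm_num

theorem indic_le_one (p : Prop) : indic p ≤ 1 := by
  unfold indic; split_ifs <;> norm_num

theorem indic_mono {p q : Prop} (h : p → q) : indic p ≤ indic q := by
  by_cases hp : p
  · rw [indic_of_true hp, indic_of_true (h hp)]
  · rw [indic_of_false hp]; exact indic_nonneg q

theorem favg_mono {α : Type} {S : Finset α} {f g : α → ℝ} (h : ∀ a ∈ S, f a ≤ g a) :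
    favg S f ≤ favg S g := by
  unfold favg
  gcongr with a ha
  exact h a ha

theorem favg_le_of_forall_le {α : Type} {S : Finset α} {f : α → ℝ} {c : ℝ} (hc : 0 ≤ c)
    (h : ∀ a ∈ S, f a ≤ c) : favg S f ≤ c := by
  refine div_le_of_le_mul₀ (Nat.cast_nonneg _) hc ?_
  calc ∑ a ∈ S, f a ≤ ∑ _a ∈ S, c := Finset.sum_le_sum h
    _ = c * S.card := by rw [Finset.sum_const, nsmul_eq_mul, mul_comm]

theorem favg_eq_of_forall_eq {α : Type} {S : Finset α} (hS : S.Nonempty) {f : α → ℝ} {c : ℝ}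
    (h : ∀ a ∈ S, f a = c) : favg S f = c := by
  unfold favg
  rw [Finset.sum_congr rfl h, Finset.sum_const, nsmul_eq_mul]
  have : (S.card : ℝ) ≠ 0 := by exact_mod_cast hS.card_pos.ne'
  field_simp

end Averages

/-- An average over strings indexed by a disjoint union. -/
theorem uavg_bits_sum {ι κ : Type} [Fintype (Bits (ι ⊕ κ))] [Fintype (Bits ι)] [Fintype (Bits κ)]
    (f : Bits (ι ⊕ κ) → ℝ) :
    uavg f = uavg fun a : Bits ι => uavg fun b : Bits κ => f (Sum.elim a b) := by
  rw [← uavg_prod fun p : Bits ι × Bits κ => f (Sum.elim p.1 p.2),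
    ← uavg_equiv (Equiv.sumArrowEquivProdArrow ι κ Bool).symm]
  rfl

/-- An average over strings indexed by pairs. -/
theorem uavg_bits_curry {ι κ : Type} [Fintype (Bits (ι × κ))] [Fintype (ι → Bits κ)]
    (f : (ι → Bits κ) → ℝ) :
    (uavg fun b : Bits (ι × κ) => f fun i j => b (i, j)) = uavg f :=
  uavg_equiv (Equiv.curry ι κ Bool) f

/-! ## Statistical distance -/

section StatDist

variable {α β : Type} [Fintype α] [Nonempty α] [Fintype β]

theorem toReal_map_uniform {β : Type} [DecidableEq β] (g : α → β) (b : β) :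
    (((PMF.uniformOfFintype α).map g) b).toReal = uavg fun a => if g a = b then 1 else 0 := by
  classical
  rw [PMF.map_apply, tsum_fintype, ENNReal.toReal_sum]
  · unfold uavg
    rw [Finset.sum_div]
    refine Finset.sum_congr rfl fun a _ => ?_
    by_cases h : g a = b
    · subst h; simp
    · simp [h, Ne.symm h]
  · intro a _
    split_ifs <;> simp

theorem sum_map_uniform_mul (g : α → β) (f : β → ℝ) :
    ∑ b, (((PMF.uniformOfFintype α).map g) b).toReal * f b = uavg fun a => f (g a) := by
  classical
  simp only [toReal_map_uniform, uavg, div_mul_eq_mul_div, Finset.sum_mul, ← Finset.sum_div]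
  rw [Finset.sum_comm]
  simp

/-- A test bounded by `1` sees at most the `ℓ¹` distance, which is twice `statDist`. -/
theorem abs_uavg_comp_sub_le (g g' : α → β) {f : β → ℝ} (hf : ∀ b, |f b| ≤ 1) :
    |(uavg fun a => f (g a)) - uavg fun a => f (g' a)| ≤
      2 * statDist ((PMF.uniformOfFintype α).map g) ((PMF.uniformOfFintype α).map g') := by
  rw [← sum_map_uniform_mul, ← sum_map_uniform_mul, ← Finset.sum_sub_distrib, statDist,
    mul_div_cancel₀ _ two_ne_zero]
  refine (Finset.abs_sum_le_sum_abs _ _).trans (Finset.sum_le_sum fun b _ => ?_)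
  rw [← sub_mul, abs_mul]
  exact mul_le_of_le_one_right (abs_nonneg _) (hf b)

end StatDist

/-- The `ℓ¹` distance of two product distributions is at most the sum of the distances of the
factors. -/
theorem sum_abs_prod_sub_prod_le {n : ℕ} {X : Type} [Fintype X] (p q : Fin n → X → ℝ)
    (hp : ∀ i x, 0 ≤ p i x) (hq : ∀ i x, 0 ≤ q i x) (hp1 : ∀ i, ∑ x, p i x = 1)
    (hq1 : ∀ i, ∑ x, q i x = 1) :
    ∑ x : Fin n → X, |∏ i, p i (x i) - ∏ i, q i (x i)| ≤ ∑ i, ∑ x, |p i x - q i x| := by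
  classical
  induction n with
  | zero => simp
  | succ n ih =>
    rw [← (Fin.consEquiv fun _ => X).sum_comp, Fintype.sum_prod_type, Fin.sum_univ_succ]
    simp only [Fin.prod_univ_succ, Fin.consEquiv_apply, Fin.cons_zero, Fin.cons_succ]
    have hP : ∑ y : Fin n → X, ∏ i, p i.succ (y i) = 1 := by
      rw [← Fintype.prod_sum]; simp [hp1]
    -- Exchange the first factor while the others are still `p`, then the others behind `q 0`; the
    -- factors left over have total mass one.
    calc ∑ x, ∑ y : Fin n → X,
          |p 0 x * ∏ i, p i.succ (y i) - q 0 x * ∏ i, q i.succ (y i)|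
        ≤ ∑ x, ∑ y : Fin n → X, (|p 0 x - q 0 x| * ∏ i, p i.succ (y i) +
            q 0 x * |∏ i, p i.succ (y i) - ∏ i, q i.succ (y i)|) := by
          refine Finset.sum_le_sum fun x _ => Finset.sum_le_sum fun y _ => ?_
          have h0 : 0 ≤ ∏ i, p i.succ (y i) := Finset.prod_nonneg fun i _ => hp _ _
          have e : p 0 x * ∏ i, p i.succ (y i) - q 0 x * ∏ i, q i.succ (y i) =
              (p 0 x - q 0 x) * ∏ i, p i.succ (y i) +
              q 0 x * (∏ i, p i.succ (y i) - ∏ i, q i.succ (y i)) := by ring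
          rw [e]
          refine (abs_add_le _ _).trans ?_
          rw [abs_mul, abs_mul, abs_of_nonneg h0, abs_of_nonneg (hq 0 x)]
      _ = (∑ x, |p 0 x - q 0 x|) +
            ∑ y : Fin n → X, |∏ i, p i.succ (y i) - ∏ i, q i.succ (y i)| := by
          simp only [Finset.sum_add_distrib, ← Finset.mul_sum, hP, mul_one, ← Finset.sum_mul,
            hq1, one_mul]
      _ ≤ _ := by
          gcongr
          exact ih (fun i => p i.succ) (fun i => q i.succ) (fun i => hp _) (fun i => hq _)
            (fun i => hp1 _) (fun i => hq1 _)

/-! ## Negligible and polynomially bounded functions -/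

theorem Negligible.add {f g : ℕ → ℝ} (hf : Negligible f) (hg : Negligible g) :
    Negligible fun k => f k + g k :=
  Asymptotics.SuperpolynomialDecay.add hf hg

theorem Negligible.const_mul {f : ℕ → ℝ} (hf : Negligible f) (c : ℝ) :
    Negligible fun k => c * f k :=
  Asymptotics.SuperpolynomialDecay.const_mul hf c

theorem Negligible.of_abs_le {f g : ℕ → ℝ} (hg : Negligible g) (h : ∀ k, |f k| ≤ |g k|) :
    Negligible f :=
  Asymptotics.SuperpolynomialDecay.trans_abs_le hg h

theorem Negligible.of_eventually_abs_le {f g : ℕ → ℝ} (hg : Negligible g)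
    (h : ∀ᶠ k in atTop, |f k| ≤ |g k|) : Negligible f :=
  Asymptotics.SuperpolynomialDecay.trans_eventually_abs_le hg h

theorem Negligible.abs {f : ℕ → ℝ} (hf : Negligible f) : Negligible fun k => |f k| :=
  hf.of_abs_le fun _ => (abs_abs _).le

theorem Negligible.polyBounded_mul {f : ℕ → ℝ} {n : ℕ → ℕ} (hf : Negligible f)
    (hn : PolyBounded n) : Negligible fun k => (n k : ℝ) * f k := by
  obtain ⟨p, hp⟩ := hn
  have h : Negligible fun k : ℕ => (p.map (Nat.castRingHom ℝ)).eval (k : ℝ) * f k :=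
    Asymptotics.SuperpolynomialDecay.polynomial_mul hf _
  refine h.of_abs_le fun k => ?_
  rw [abs_mul, abs_mul, Polynomial.eval_natCast_map, Nat.coe_castRingHom, Nat.abs_cast,
    Nat.abs_cast]
  gcongr
  exact hp k

theorem PolyBounded.mono {f g : ℕ → ℕ} (hg : PolyBounded g) (h : ∀ k, f k ≤ g k) :
    PolyBounded f := by
  obtain ⟨p, hp⟩ := hg
  exact ⟨p, fun k => (h k).trans (hp k)⟩

theorem PolyBounded.add {f g : ℕ → ℕ} (hf : PolyBounded f) (hg : PolyBounded g) :
    PolyBounded fun k => f k + g k := by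
  obtain ⟨p, hp⟩ := hf
  obtain ⟨q, hq⟩ := hg
  exact ⟨p + q, fun k => by simpa using add_le_add (hp k) (hq k)⟩

theorem PolyBounded.mul {f g : ℕ → ℕ} (hf : PolyBounded f) (hg : PolyBounded g) :
    PolyBounded fun k => f k * g k := by
  obtain ⟨p, hp⟩ := hf
  obtain ⟨q, hq⟩ := hg
  exact ⟨p * q, fun k => by simpa using Nat.mul_le_mul (hp k) (hq k)⟩

theorem polyBounded_const (c : ℕ) : PolyBounded fun _ => c :=
  ⟨Polynomial.C c, fun k => by simp⟩

theorem polyBounded_eval (p : Polynomial ℕ) : PolyBounded fun k => p.eval k :=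
  ⟨p, fun _ => le_rfl⟩

/-! ## Completeness -/

/-- Only the last party's share is not a coin, so it is counted separately. It contains the parity
of the other shares, which therefore cancels in `xorAll_additiveShares`. -/
theorem card_filter_additiveShares {n : ℕ} {W : Type} (hn : 0 < n) (w : Bits W)
    (s : Fin n → Bits W) (b : W) :
    (Finset.univ.filter fun i => additiveShares w s i b = true).card =
      (Finset.univ.filter fun j : Fin n => j.1 + 1 ≠ n ∧ s j b = true).card +
        if xor (w b) (decide (Odd (Finset.univ.filter fun j : Fin n =>
          j.1 + 1 ≠ n ∧ s j b = true).card)) = true then 1 else 0 := by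
  set c := Finset.univ.filter fun j : Fin n => j.1 + 1 ≠ n ∧ s j b = true with hc
  let last : Fin n := ⟨n - 1, by omega⟩
  have hl : ∀ j : Fin n, j.1 + 1 = n ↔ j = last := fun j => by
    rw [Fin.ext_iff]; simp only [last]; omega
  have hlast : last ∉ c := by simp [hc, (hl last).2 rfl]
  split_ifs with h
  · rw [← Finset.card_insert_of_notMem hlast]
    congr 1
    ext i
    by_cases hi : i = last
    · subst hi
      simpa [additiveShares, (hl last).2 rfl] using h
    · simp [hc, additiveShares, hi, hl]
  · rw [add_zero]
    congr 1
    ext i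
    by_cases hi : i = last
    · subst hi
      simpa [additiveShares, (hl last).2 rfl, hc] using h
    · simp [hc, additiveShares, hi, hl]

theorem xorAll_additiveShares {n : ℕ} {W : Type} (hn : 0 < n) (w : Bits W)
    (s : Fin n → Bits W) : xorAll (additiveShares w s) = w := by
  funext b
  unfold xorAll
  rw [card_filter_additiveShares hn]
  by_cases hc : Odd (Finset.univ.filter fun j : Fin n => j.1 + 1 ≠ n ∧ s j b = true).card <;>
    cases w b <;> simp [hc, Nat.odd_add_one]

namespace MPCProtocol

variable {P W : Type} (π : MPCProtocol P W)

theorem decodeView_encodeView [Fintype W] {i : Fin π.n} (v : π.View i) :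
    π.decodeView i (π.encodeView v) = v := by
  funext b
  simp [decodeView, encodeView]

/-- `honestMsg` recurses over the rounds while `sends` reads a finished view; one unfolding of the
recursion identifies them. -/
theorem honestView_sends (pub : Bits P) (ins : Fin π.n → Bits W)
    (ρ : Fin π.n → Bits (Fin π.tapeLen)) (i : Fin π.n) (r : Fin π.rounds)
    (d : Option {j : Fin π.n // j ≠ i}) :
    (π.honestView pub ins ρ i).sends pub r d = π.honestMsg pub ins ρ r.1 r.2 i d := by
  rw [honestMsg]
  rfl

theorem consistent_honestView (pub : Bits P) (ins : Fin π.n → Bits W)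
    (ρ : Fin π.n → Bits (Fin π.tapeLen)) {i j : Fin π.n} (h : i ≠ j) :
    π.Consistent pub h (π.honestView pub ins ρ i) (π.honestView pub ins ρ j) := by
  refine ⟨fun r => ?_, fun r => ?_, fun r l hi hj => rfl⟩ <;>
    rw [honestView_sends, honestView_sends] <;> exact ⟨rfl, rfl⟩

end MPCProtocol

namespace SuperpositionProof

variable {R : NPRelation} {C : CommitmentScheme}

theorem claim_liftWitness {k : ℕ} {x : Bits (Fin k)} (crs : Bits (CrsIdx C k))
    {w : Bits (Fin (R.witLen.eval k))} (hw : R.holds x w = true) :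
    claim (R := R) (Sum.elim x crs) (liftWitness w) = true := by
  simpa [claim, liftWitness] using hw

/-- Needed for completeness, because `favg` over the empty set is `0`. -/
theorem challengeSets_nonempty {n t : ℕ} (h : t < n) : (challengeSets n t).Nonempty := by
  obtain ⟨S, -, hS⟩ := Finset.exists_subset_card_eq
    (s := (Finset.univ : Finset (Fin n))) (n := t / 2) (by rw [Finset.card_fin]; omega)
  refine ⟨fun i => decide (i ∈ S), ?_⟩
  simp [challengeSets, hS]

theorem verifierAccepts_honest {k : ℕ} (π : MPCProtocol (PubIdx C k) (WitIdx R C k)) (t : ℕ)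
    (hcor : π.Correct (functionality R C k π.n)) (ht : t < π.n) {x : Bits (Fin k)}
    (crs : Bits (CrsIdx C k)) {w : Bits (Fin (R.witLen.eval k))} (hw : R.holds x w = true)
    (ρ : Bits (CoinIdx π)) {e : Bits (Fin π.n)} (he : e ∈ challengeSets π.n t) :
    verifierAccepts π x crs (proverFirst π x crs w ρ) e (proverRespond π t x crs w ρ e) := by
  have hopen : ∀ i, e i = true → openedView π (proverRespond π t x crs w ρ e) i =
      π.honestView (Sum.elim x crs)
        (additiveShares (liftWitness w) fun j b => ρ (.inl (j, b)))
        (fun j b => ρ (.inr (.inl (j, b)))) i := by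
    intro i hi
    rw [← π.decodeView_encodeView (π.honestView _ _ _ i)]
    unfold openedView
    congr 1
    funext b
    simp [proverRespond, he, hi, emulatedView]
  refine ⟨fun i hi => ?_, fun i hi => ?_, fun i j h hi hj => ?_⟩
  · funext b
    simp [proverRespond, he, hi, proverFirst]
  · rw [hopen i hi, hcor, functionality, xorAll_additiveShares (by omega)]
    exact claim_liftWitness crs hw
  · rw [hopen i hi, hopen j hj]
    exact π.consistent_honestView _ _ _ h

theorem proofSystem_complete (π : ∀ k, MPCProtocol (PubIdx C k) (WitIdx R C k)) (t : ℕ → ℕ)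
    (hcor : ∀ k, (π k).Correct (functionality R C k (π k).n)) (ht : ∀ k, t k < (π k).n) :
    (proofSystem π t).Complete fun _ x w => R.holds x w = true := by
  intro k x w hw
  have h : ∀ s ρ, favg ((proofSystem π t).challenges k) (fun e =>
      indic ((proofSystem π t).accepts k x ((proofSystem π t).crsGen k s)
        ((proofSystem π t).first k x ((proofSystem π t).crsGen k s) w ρ) e
        ((proofSystem π t).respond k x ((proofSystem π t).crsGen k s) w ρ e))) = 1 := fun s ρ =>
    favg_eq_of_forall_eq (challengeSets_nonempty (ht k)) fun e he =>
      indic_of_true (verifierAccepts_honest (π k) (t k) (hcor k) (ht k) _ hw ρ he)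
  unfold CRSProof.honestProb
  simp only [h, uavg_const]

end SuperpositionProof

/-! ## Random subsets of a fixed size -/

/-- The central term of the binomial distribution with mean `s` is the largest one. -/
theorem one_le_succ_mul_binomial_mode {n s : ℕ} (hs : 0 < s) (hsn : s < n) :
    1 ≤ ((n : ℝ) + 1) * (n.choose s * ((s / n : ℝ) ^ s * (1 - s / n : ℝ) ^ (n - s))) := by
  have hn : (0 : ℝ) < n := by exact_mod_cast hs.trans hsn
  set p : ℝ := s / n with hp
  have hp1 : 1 - p = (n - s : ℝ) / n := by rw [hp]; field_simp
  have hs0 : (0 : ℝ) < s := by exact_mod_cast hs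
  have hns : (0 : ℝ) < n - s := by rw [sub_pos]; exact_mod_cast hsn
  have hp0 : 0 < p := by positivity
  have hq0 : 0 < 1 - p := by rw [hp1]; positivity
  let a : ℕ → ℝ := fun j => n.choose j * (p ^ j * (1 - p) ^ (n - j))
  have ha0 : ∀ j, 0 ≤ a j := fun j => by positivity
  -- The ratio of consecutive binomial terms, cleared of denominators by means of `p : (1 - p) = s :
  -- (n - s)`.
  have hrec : ∀ j, j < n → a (j + 1) * ((j + 1) * (n - s)) = a j * ((n - j) * s) := by
    intro j hj
    have h1 : (n.choose (j + 1) : ℝ) * (j + 1) = n.choose j * (n - j) := by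
      have := Nat.choose_succ_right_eq n j
      have h2 : ((n - j : ℕ) : ℝ) = n - j := by rw [Nat.cast_sub hj.le]
      rw [← h2]
      exact_mod_cast this
    have h3 : n - j = (n - (j + 1)) + 1 := by omega
    have h4 : p * (n - s) = (1 - p) * s := by rw [hp1, hp]; field_simp
    simp only [a]
    rw [h3, pow_succ, pow_succ]
    linear_combination (p ^ j * p * (1 - p) ^ (n - (j + 1)) * (n - s)) * h1 +
      (n.choose j * (n - j) * p ^ j * (1 - p) ^ (n - (j + 1))) * h4
  -- By `hrec` the terms increase up to index `s`, and by the same comparison (`hdown`) they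
  -- decrease afterwards.
  have hup : ∀ d, d ≤ s → a (s - d) ≤ a s := by
    intro d
    induction d with
    | zero => simp
    | succ d ih =>
      intro hd
      refine le_trans ?_ (ih (by omega))
      have hr := hrec (s - (d + 1)) (by omega)
      have e : s - (d + 1) + 1 = s - d := by omega
      rw [e] at hr
      set j := s - (d + 1) with hj
      have hjs : (j : ℝ) + 1 ≤ s := by exact_mod_cast (by omega : j + 1 ≤ s)
      have hX : 0 < ((n : ℝ) - j) * s := mul_pos (by linarith) hs0
      refine le_of_mul_le_mul_right ?_ hX
      rw [← hr]
      refine mul_le_mul_of_nonneg_left ?_ (ha0 _)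
      nlinarith
  have hdown : ∀ d, s + d ≤ n → a (s + d) ≤ a s := by
    intro d
    induction d with
    | zero => simp
    | succ d ih =>
      intro hd
      refine le_trans ?_ (ih (by omega))
      have hr := hrec (s + d) (by omega)
      have hY : 0 < (((s + d : ℕ) : ℝ) + 1) * (n - s) := by positivity
      refine le_of_mul_le_mul_right ?_ hY
      rw [← add_assoc, hr]
      refine mul_le_mul_of_nonneg_left ?_ (ha0 _)
      push_cast
      have : (0 : ℝ) ≤ d := Nat.cast_nonneg d
      nlinarith
  have hmax : ∀ j ∈ Finset.range (n + 1), a j ≤ a s := by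
    intro j hj
    rw [Finset.mem_range] at hj
    rcases le_total j s with h | h
    · have := hup (s - j) (by omega)
      rwa [Nat.sub_sub_self h] at this
    · have := hdown (j - s) (by omega)
      rwa [Nat.add_sub_cancel' h] at this
  -- By the binomial theorem, `n + 1` terms sum to one, so the largest is at least `1 / (n + 1)`.
  have hsum : ∑ j ∈ Finset.range (n + 1), a j = 1 := by
    have := add_pow p (1 - p) n
    rw [add_sub_cancel, one_pow] at this
    rw [this]
    exact Finset.sum_congr rfl fun j _ => by simp only [a]; ring
  calc (1 : ℝ) = ∑ j ∈ Finset.range (n + 1), a j := hsum.symm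
    _ ≤ ∑ _j ∈ Finset.range (n + 1), a s := Finset.sum_le_sum hmax
    _ = _ := by simp [a]

/-- The probability of the subset `e`, if every point is included independently with
probability `p`. -/
noncomputable def bernoulliWeight {n : ℕ} (p : ℝ) (e : Bits (Fin n)) : ℝ :=
  ∏ i, if e i = true then p else 1 - p

theorem bernoulliWeight_eq {n : ℕ} (p : ℝ) (e : Bits (Fin n)) :
    bernoulliWeight p e = p ^ (Finset.univ.filter fun i => e i = true).card *
      (1 - p) ^ (n - (Finset.univ.filter fun i => e i = true).card) := by
  unfold bernoulliWeight
  rw [Finset.prod_ite, Finset.prod_const, Finset.prod_const, Finset.filter_not,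
    ← Finset.compl_eq_univ_sdiff, Finset.card_compl, Fintype.card_fin]

/-- Independence of the coordinates: expand the product of the two-term sums. This is what makes
independent inclusion easier to handle than a set of fixed size. -/
theorem sum_bernoulliWeight_mul_prod {n : ℕ} (p : ℝ) (f : Fin n → Bool → ℝ) :
    ∑ e : Bits (Fin n), bernoulliWeight p e * ∏ i, f i (e i) =
      ∏ i, (p * f i true + (1 - p) * f i false) := by
  have h := Fintype.prod_sum fun (i : Fin n) (b : Bool) => (if b = true then p else 1 - p) * f i b
  simp only [Fintype.sum_bool, if_true] at h
  simp only [Bool.false_eq_true, if_false] at h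
  rw [h]
  exact Finset.sum_congr rfl fun e _ => by rw [bernoulliWeight, ← Finset.prod_mul_distrib]

open SuperpositionProof in
theorem card_challengeSets (n t : ℕ) : (challengeSets n t).card = n.choose (t / 2) := by
  have h : (challengeSets n t).card = (Finset.powersetCard (t / 2)
      (Finset.univ : Finset (Fin n))).card := by
    refine Finset.card_nbij' (fun e => Finset.univ.filter fun i => e i = true)
      (fun S i => decide (i ∈ S)) ?_ ?_ ?_ ?_
    · intro e he
      simpa [challengeSets, Finset.mem_powersetCard] using he
    · intro S hS
      simpa [challengeSets, Finset.mem_powersetCard] using hS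
    · intro e _
      funext i
      simp
    · intro S _
      ext i
      simp
  rw [h, Finset.card_powersetCard, Finset.card_fin]

open SuperpositionProof in
/-- A uniformly random set of size `t / 2` is compared with a set whose points are chosen
independently. -/
theorem favg_challengeSets_le {n t : ℕ} (hs : 0 < t / 2) (hsn : t / 2 < n)
    (f : Bits (Fin n) → ℝ) (hf : ∀ e, 0 ≤ f e) :
    favg (challengeSets n t) f ≤
      (n + 1) * ∑ e, bernoulliWeight (((t / 2 : ℕ) : ℝ) / n) e * f e := by
  set s := t / 2 with hs'
  set p : ℝ := (s : ℝ) / n with hp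
  have hn : (0 : ℝ) < n := by exact_mod_cast hs.trans hsn
  have hp0 : 0 ≤ p := by positivity
  have hp1 : 0 ≤ 1 - p := by
    rw [sub_nonneg, hp, div_le_one hn]; exact_mod_cast hsn.le
  have hmode := one_le_succ_mul_binomial_mode hs hsn
  rw [← hp] at hmode
  set w := p ^ s * (1 - p) ^ (n - s) with hw
  have hw0 : 0 ≤ w := by positivity
  have hC : (0 : ℝ) < n.choose s := by exact_mod_cast Nat.choose_pos hsn.le
  unfold favg
  rw [card_challengeSets, ← hs', div_le_iff₀ hC]
  -- All sets of size `s` have the same Bernoulli weight `w`, so the uniform law is the Bernoulli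
  -- law conditioned on the size; the condition has probability `n.choose s * w ≥ 1 / (n + 1)` by
  -- `hmode`.
  have h1 : (∑ e ∈ challengeSets n t, f e) * w ≤ ∑ e, bernoulliWeight p e * f e := by
    rw [Finset.sum_mul]
    calc ∑ e ∈ challengeSets n t, f e * w
        = ∑ e ∈ challengeSets n t, bernoulliWeight p e * f e := by
          refine Finset.sum_congr rfl fun e he => ?_
          have he' : (Finset.univ.filter fun i => e i = true).card = s := by
            simpa [challengeSets] using he
          rw [bernoulliWeight_eq, he', ← hw, mul_comm]
      _ ≤ _ := by
          refine Finset.sum_le_sum_of_subset_of_nonneg (Finset.subset_univ _) fun e _ _ => ?_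
          rw [bernoulliWeight_eq]
          have := hf e
          positivity
  have hF : 0 ≤ ∑ e ∈ challengeSets n t, f e := Finset.sum_nonneg fun e _ => hf e
  calc ∑ e ∈ challengeSets n t, f e
      ≤ (∑ e ∈ challengeSets n t, f e) * (((n : ℝ) + 1) * (n.choose s * w)) :=
        le_mul_of_one_le_right hF hmode
    _ = (n + 1) * ((∑ e ∈ challengeSets n t, f e) * w) * n.choose s := by ring
    _ ≤ _ := by gcongr

/-- The probability that a random set is contained in `T`. -/
theorem sum_bernoulliWeight_subset {n : ℕ} (p : ℝ) (T : Finset (Fin n)) :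
    ∑ e : Bits (Fin n), bernoulliWeight p e * indic (∀ i, e i = true → i ∈ T) =
      (1 - p) ^ (n - T.card) := by
  have h := sum_bernoulliWeight_mul_prod p fun (i : Fin n) b => indic (b = true → i ∈ T)
  have h2 : ∀ e : Bits (Fin n), ∏ i, indic (e i = true → i ∈ T) =
      indic (∀ i, e i = true → i ∈ T) := by
    intro e
    by_cases H : ∀ i, e i = true → i ∈ T
    · rw [indic_of_true H]
      exact Finset.prod_eq_one fun i _ => indic_of_true (H i)
    · rw [indic_of_false H]
      push Not at H
      obtain ⟨i, hi⟩ := H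
      exact Finset.prod_eq_zero (Finset.mem_univ i) (indic_of_false (by tauto))
  refine (Finset.sum_congr rfl fun e _ => by rw [h2]).trans (h.trans ?_)
  have h3 : ∀ i : Fin n, p * indic ((true : Bool) = true → i ∈ T) +
      (1 - p) * indic ((false : Bool) = true → i ∈ T) = if i ∈ T then 1 else 1 - p := by
    intro i
    by_cases hi : i ∈ T <;> simp [indic, hi]
  rw [Finset.prod_congr rfl fun i _ => h3 i, Finset.prod_ite, Finset.prod_const_one, one_mul,
    Finset.prod_const, Finset.filter_not, Finset.filter_mem_eq_inter, Finset.univ_inter,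
    ← Finset.compl_eq_univ_sdiff, Finset.card_compl, Fintype.card_fin]

/-! ### Matchings -/

/-- A set of pairs such that no point occurs twice. -/
def IsMatchingSet {α : Type} (M : Finset (α × α)) : Prop :=
  (∀ q ∈ M, q.1 ≠ q.2) ∧ ∀ q ∈ M, ∀ q' ∈ M, q ≠ q' →
    q.1 ≠ q'.1 ∧ q.1 ≠ q'.2 ∧ q.2 ≠ q'.1 ∧ q.2 ≠ q'.2

/-- The probability that a random set contains no edge of a matching. -/
theorem sum_bernoulliWeight_matching {n : ℕ} (p : ℝ) {M : Finset (Fin n × Fin n)}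
    (hM : IsMatchingSet M) :
    ∑ e : Bits (Fin n), bernoulliWeight p e *
      indic (∀ q ∈ M, ¬(e q.1 = true ∧ e q.2 = true)) = (1 - p ^ 2) ^ M.card := by
  -- Inclusion–exclusion turns the event into products over single coordinates. A subset `L` of the
  -- matching involves `2 |L|` distinct points, so it contributes `(-p ^ 2) ^ |L|`, and the sum over
  -- `L` folds back into a power.
  have h1 : ∀ e : Bits (Fin n), indic (∀ q ∈ M, ¬(e q.1 = true ∧ e q.2 = true)) =
      ∑ L ∈ M.powerset, ∏ q ∈ L, -(indic (e q.1 = true) * indic (e q.2 = true)) := by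
    intro e
    rw [← Finset.prod_one_add]
    by_cases H : ∀ q ∈ M, ¬(e q.1 = true ∧ e q.2 = true)
    · rw [indic_of_true H]
      refine (Finset.prod_eq_one fun q hq => ?_).symm
      have := H q hq
      by_cases h : e q.1 = true
      · rw [indic_of_false (p := e q.2 = true) (by tauto)]; simp
      · rw [indic_of_false h]; simp
    · rw [indic_of_false H]
      push Not at H
      obtain ⟨q, hq, h1, h2⟩ := H
      refine (Finset.prod_eq_zero hq ?_).symm
      rw [indic_of_true h1, indic_of_true h2]; ring
  have h2 : ∀ L ∈ M.powerset, ∑ e : Bits (Fin n), bernoulliWeight p e *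
      ∏ q ∈ L, -(indic (e q.1 = true) * indic (e q.2 = true)) = ∏ _q ∈ L, -p ^ 2 := by
    intro L hL
    rw [Finset.mem_powerset] at hL
    let S : Finset (Fin n) := L.biUnion fun q => {q.1, q.2}
    have hdisj : Set.PairwiseDisjoint (L : Set (Fin n × Fin n))
        (fun q => ({q.1, q.2} : Finset (Fin n))) := by
      intro q hq q' hq' hne
      have := hM.2 q (hL hq) q' (hL hq') hne
      simp only [Function.onFun, Finset.disjoint_left, Finset.mem_insert, Finset.mem_singleton]
      rintro a (rfl | rfl) (h | h) <;> tauto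
    have h3 : ∀ g : Fin n → ℝ, ∏ q ∈ L, (g q.1 * g q.2) = ∏ i, if i ∈ S then g i else 1 := by
      intro g
      rw [Finset.prod_ite_mem, Finset.univ_inter, Finset.prod_biUnion hdisj]
      refine Finset.prod_congr rfl fun q hq => ?_
      rw [Finset.prod_pair (hM.1 q (hL hq))]
    have h4 : ∀ e : Bits (Fin n), ∏ q ∈ L, -(indic (e q.1 = true) * indic (e q.2 = true)) =
        (-1) ^ L.card * ∏ i, if i ∈ S then indic (e i = true) else 1 := by
      intro e
      rw [← h3 fun i => indic (e i = true), Finset.prod_neg]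
    have h5 := sum_bernoulliWeight_mul_prod p
      fun (i : Fin n) b => if i ∈ S then indic (b = true) else 1
    simp only [h4, mul_left_comm _ ((-1 : ℝ) ^ L.card), ← Finset.mul_sum]
    rw [h5]
    have h6 : ∀ i : Fin n, (p * (if i ∈ S then indic ((true : Bool) = true) else 1) +
        (1 - p) * if i ∈ S then indic ((false : Bool) = true) else 1) =
        if i ∈ S then p else 1 := by
      intro i
      by_cases hi : i ∈ S <;> simp [indic, hi]
    rw [Finset.prod_congr rfl fun i _ => h6 i, ← h3 fun _ => p, ← Finset.prod_neg]
    simp [pow_two]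
  simp only [h1, Finset.mul_sum]
  rw [Finset.sum_comm, Finset.sum_congr rfl h2, ← Finset.prod_one_add, Finset.prod_const,
    ← sub_eq_add_neg]

/-- A maximal matching: either it is large, or few points meet all edges. -/
theorem exists_maximal_matching {α : Type} [Fintype α] [DecidableEq α] (r : α → α → Prop) :
    ∃ M : Finset (α × α), IsMatchingSet M ∧ (∀ q ∈ M, r q.1 q.2) ∧
      ∃ T : Finset α, T.card ≤ 2 * M.card ∧ ∀ i j, i ∉ T → j ∉ T → i ≠ j → ¬ r i j := by
  classical
  obtain ⟨M, hM, hmax⟩ := Finset.exists_max_image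
    (Finset.univ.filter fun M : Finset (α × α) => IsMatchingSet M ∧ ∀ q ∈ M, r q.1 q.2)
    Finset.card ⟨∅, by simp [IsMatchingSet]⟩
  rw [Finset.mem_filter] at hM
  refine ⟨M, hM.2.1, hM.2.2, M.image Prod.fst ∪ M.image Prod.snd, ?_, ?_⟩
  · rw [two_mul]
    exact (Finset.card_union_le _ _).trans (add_le_add Finset.card_image_le Finset.card_image_le)
  · intro i j hi hj hij hr
    have hi1 : ∀ q ∈ M, i ≠ q.1 ∧ i ≠ q.2 := fun q hq =>
      ⟨fun h => hi (Finset.mem_union_left _ (h ▸ Finset.mem_image_of_mem _ hq)),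
        fun h => hi (Finset.mem_union_right _ (h ▸ Finset.mem_image_of_mem _ hq))⟩
    have hj1 : ∀ q ∈ M, j ≠ q.1 ∧ j ≠ q.2 := fun q hq =>
      ⟨fun h => hj (Finset.mem_union_left _ (h ▸ Finset.mem_image_of_mem _ hq)),
        fun h => hj (Finset.mem_union_right _ (h ▸ Finset.mem_image_of_mem _ hq))⟩
    have hnot : (i, j) ∉ M := fun h => (hi1 _ h).1 rfl
    have := hmax (insert (i, j) M) ?_
    · rw [Finset.card_insert_of_notMem hnot] at this
      omega
    · rw [Finset.mem_filter]
      refine ⟨Finset.mem_univ _, ⟨?_, ?_⟩, ?_⟩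
      · intro q hq
        rcases Finset.mem_insert.1 hq with rfl | hq
        · exact hij
        · exact hM.2.1.1 q hq
      · intro q hq q' hq' hne
        rcases Finset.mem_insert.1 hq with rfl | hq <;>
          rcases Finset.mem_insert.1 hq' with rfl | hq'
        · exact absurd rfl hne
        · exact ⟨(hi1 _ hq').1, (hi1 _ hq').2, (hj1 _ hq').1, (hj1 _ hq').2⟩
        · exact ⟨(hi1 _ hq).1.symm, (hj1 _ hq).1.symm, (hi1 _ hq).2.symm, (hj1 _ hq).2.symm⟩
        · exact hM.2.1.2 q hq q' hq' hne
      · intro q hq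
        rcases Finset.mem_insert.1 hq with rfl | hq
        · exact hr
        · exact hM.2.2 q hq

/-! ## Robustness and random challenges -/

namespace MPCProtocol

variable {P W : Type} (π : MPCProtocol P W)

/-- Pairwise consistent views of the parties outside `T` occur in an execution in which these
parties are honest. -/
theorem exists_messages_of_consistent (pub : Bits P) (T : Finset (Fin π.n)) (v : ∀ i, π.View i)
    (hv : ∀ i j (h : i ≠ j), i ∉ T → j ∉ T → π.Consistent pub h (v i) (v j)) :
    ∃ M : π.Messages, ∀ i, i ∉ T → π.Follows pub M i (v i) := by
  classical
  -- Parties outside `T` send what their views prescribe. Private messages of a corrupted party are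
  -- read from the receiver's inbox, and its broadcasts from the inbox of any honest party:
  -- consistency makes that choice irrelevant. The zero default occurs only if nobody outside `T`
  -- could receive the broadcast.
  let M : π.Messages := fun r i d =>
    if i ∉ T then (v i).sends pub r d
    else match d with
      | some j => (v j.1).inbox r ⟨i, j.2.symm⟩ false
      | none => if h : ∃ j, j ∉ T ∧ j ≠ i then
          (v h.choose).inbox r ⟨i, h.choose_spec.2.symm⟩ true else fun _ => false
  refine ⟨M, fun i hi => ⟨?_, fun r => ?_⟩⟩
  · funext r j bc
    obtain ⟨j, hj⟩ := j
    by_cases hjT : j ∈ T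
    · cases bc with
      | false => simp [Messages.receivedBy, M, hjT]
      | true =>
        have h : ∃ l, l ∉ T ∧ l ≠ j := ⟨i, hi, hj.symm⟩
        have e : M r j none = (v h.choose).inbox r ⟨j, h.choose_spec.2.symm⟩ true := by
          simp [M, hjT, h]
        simp only [Messages.receivedBy, if_true]
        rw [e]
        -- If the chosen receiver is `i` itself, consistency says nothing, and the two sides differ
        -- only in the proof that `j` is another party.
        by_cases hc : h.choose = i
        · have : ∀ l (_ : l = i) (hl : j ≠ l),
              (v i).inbox r ⟨j, hj⟩ true = (v l).inbox r ⟨j, hl⟩ true := by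
            rintro l rfl _
            rfl
          exact this _ hc _
        · exact (hv i h.choose (Ne.symm hc) hi h.choose_spec.1).2.2 r j hj _
    · have H := (hv i j hj.symm hi hjT).2.1 r
      cases bc with
      | false => simpa [Messages.receivedBy, M, hjT] using H.1
      | true => simpa [Messages.receivedBy, M, hjT] using H.2
  · funext d
    simp [M, hi]

/-- The views opened for the challenge `e` are accepting and pairwise consistent. -/
def Convincing (pub : Bits P) (v : ∀ i, π.View i) (e : Bits (Fin π.n)) : Prop :=
  (∀ i, e i = true → (v i).output pub = true) ∧
    ∀ i j (h : i ≠ j), e i = true → e j = true → π.Consistent pub h (v i) (v j)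

-- Graph of conflicting views with a maximum matching. `N` is an exponent that serves both cases: `n
-- - t` parties lie outside a small `T`, and a large `T` comes from at least `(t + 1) / 2` edges.
open SuperpositionProof in
theorem favg_convincing_le {F : Bits P → (Fin π.n → Bits W) → Bool} {t N : ℕ}
    (hrob : π.Robust F t) (ht : t < π.n) (hs : 0 < t / 2) (hN : N ≤ π.n - t)
    (hN' : 2 * N ≤ t + 1) {pub : Bits P} (hF : ∀ ins, F pub ins = false)
    (v : ∀ i, π.View i) :
    favg (challengeSets π.n t) (fun e => indic (π.Convincing pub v e)) ≤
      (π.n + 1) * (1 - (((t / 2 : ℕ) : ℝ) / π.n) ^ 2) ^ N := by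
  have hsn : t / 2 < π.n := by omega
  set p : ℝ := ((t / 2 : ℕ) : ℝ) / π.n with hp
  have hn : (0 : ℝ) < π.n := by exact_mod_cast (by omega : 0 < π.n)
  have hp0 : 0 ≤ p := by positivity
  have hp1 : p ≤ 1 := by rw [hp, div_le_one hn]; exact_mod_cast hsn.le
  have hpp : p ^ 2 ≤ p := by nlinarith
  have hq : 0 ≤ 1 - p ^ 2 := by linarith
  have hq1 : 1 - p ^ 2 ≤ 1 := by nlinarith
  have hmono : ∀ {f g : Bits (Fin π.n) → ℝ}, (∀ e, f e ≤ g e) →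
      ∑ e, bernoulliWeight p e * f e ≤ ∑ e, bernoulliWeight p e * g e := by
    intro f g h
    refine Finset.sum_le_sum fun e _ => mul_le_mul_of_nonneg_left (h e) ?_
    rw [bernoulliWeight_eq]
    have : 0 ≤ 1 - p := by linarith
    positivity
  refine (favg_challengeSets_le hs hsn _ fun e => indic_nonneg _).trans ?_
  rw [← hp]
  gcongr
  obtain ⟨M, hM, hMr, T, hT, hTr⟩ := exists_maximal_matching fun i j : Fin π.n =>
    ∃ h : i ≠ j, ¬ π.Consistent pub h (v i) (v j)
  -- Few endpoints: corrupting `T` explains all remaining views, so every party outside `T` rejects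
  -- and a convincing challenge lies inside `T`. Since `p ^ 2 ≤ p`, this case also obeys the bound
  -- with `1 - p ^ 2`.
  by_cases hcard : T.card ≤ t
  · obtain ⟨msgs, hmsgs⟩ := π.exists_messages_of_consistent pub T v fun i j h hi hj => by
      by_contra hc
      exact hTr i j hi hj h ⟨h, hc⟩
    have hrej := hrob pub hF T hcard msgs v hmsgs
    calc _ ≤ ∑ e, bernoulliWeight p e * indic (∀ i, e i = true → i ∈ T) := by
          refine hmono fun e => indic_mono fun he i hi => ?_
          by_contra hiT
          have := he.1 i hi
          rw [hrej i hiT] at this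
          exact Bool.false_ne_true this
      _ = (1 - p) ^ (π.n - T.card) := sum_bernoulliWeight_subset p T
      _ ≤ (1 - p ^ 2) ^ (π.n - T.card) := by
          refine pow_le_pow_left₀ (by linarith) (by linarith) _
      _ ≤ (1 - p ^ 2) ^ N := pow_le_pow_of_le_one hq hq1 (by omega)
  -- Many endpoints: `t + 1 ≤ T.card ≤ 2 * M.card` gives `N ≤ M.card`, and a convincing challenge
  -- contains no conflicting pair.
  · calc _ ≤ ∑ e, bernoulliWeight p e *
            indic (∀ q ∈ M, ¬(e q.1 = true ∧ e q.2 = true)) := by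
          refine hmono fun e => indic_mono fun he q hqM hqe => ?_
          obtain ⟨h, hc⟩ := hMr q hqM
          exact hc (he.2 q.1 q.2 h hqe.1 hqe.2)
      _ = (1 - p ^ 2) ^ M.card := sum_bernoulliWeight_matching p hM
      _ ≤ (1 - p ^ 2) ^ N := pow_le_pow_of_le_one hq hq1 (by omega)

end MPCProtocol

/-! ## Asymptotics of the soundness error -/

theorem tendsto_cast_atTop_of_log_isLittleO {n : ℕ → ℕ}
    (hn : (fun k : ℕ => Real.log k) =o[atTop] (fun k : ℕ => (n k : ℝ))) :
    Tendsto (fun k => (n k : ℝ)) atTop atTop := by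
  refine tendsto_atTop_mono' atTop ?_ (Real.tendsto_log_atTop.comp tendsto_natCast_atTop_atTop)
  filter_upwards [hn.bound one_pos] with k hk
  rw [one_mul, Real.norm_eq_abs, Real.norm_eq_abs, Nat.abs_cast] at hk
  exact (le_abs_self _).trans hk

/-- Write `k ^ z` as `exp (z log k)`. Because `log k = o(n)`, half of the exponent `γ n` absorbs
this factor, and the other half tends to infinity. -/
theorem negligible_exp_neg {n : ℕ → ℕ}
    (hn : (fun k : ℕ => Real.log k) =o[atTop] (fun k : ℕ => (n k : ℝ))) {γ : ℝ} (hγ : 0 < γ) :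
    Negligible fun k => Real.exp (-γ * n k) := by
  intro z
  have htop := tendsto_cast_atTop_of_log_isLittleO hn
  have hlim : Tendsto (fun k => Real.exp (-(γ / 2 * n k))) atTop (𝓝 0) :=
    Real.tendsto_exp_neg_atTop_nhds_zero.comp (htop.const_mul_atTop (half_pos hγ))
  -- Dividing by `z + 1` instead of `z` covers `z = 0`.
  have hz : (0 : ℝ) < γ / 2 / (z + 1) := by positivity
  refine squeeze_zero' (Eventually.of_forall fun k => by positivity) ?_ hlim
  filter_upwards [hn.bound hz, eventually_ge_atTop 1] with k hk hk1
  have hk0 : (0 : ℝ) < k := by exact_mod_cast hk1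
  rw [Real.norm_eq_abs, Real.norm_eq_abs, Nat.abs_cast] at hk
  have h1 : (k : ℝ) ^ z = Real.exp (z * Real.log k) := by
    rw [Real.exp_nat_mul, Real.exp_log hk0]
  rw [h1, ← Real.exp_add, Real.exp_le_exp]
  have h2 : z * Real.log k ≤ γ / 2 * n k := by
    calc z * Real.log k ≤ (z + 1) * (γ / 2 / (z + 1) * n k) := by
          have := (le_abs_self _).trans hk
          have h3 : (0 : ℝ) ≤ γ / 2 / (z + 1) * n k := by positivity
          nlinarith [Nat.cast_nonneg (α := ℝ) z]
      _ = γ / 2 * n k := by field_simp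
  linarith

theorem negligible_succ_mul_exp_neg {n : ℕ → ℕ}
    (hn : (fun k : ℕ => Real.log k) =o[atTop] (fun k : ℕ => (n k : ℝ))) {γ : ℝ} (hγ : 0 < γ) :
    Negligible fun k => ((n k : ℝ) + 1) * Real.exp (-γ * n k) := by
  -- With this constant, `x + 1 ≤ exp x` at `x = γ / 2 * n` bounds `(n + 1) * min 1 (γ / 2)`, so the
  -- linear factor costs half of the exponent.
  have hδ : 0 < min 1 (γ / 2) := by positivity
  refine ((negligible_exp_neg hn (half_pos hγ)).const_mul (min 1 (γ / 2))⁻¹).of_abs_le fun k => ?_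
  rw [abs_of_nonneg (by positivity), abs_of_nonneg (by positivity), inv_mul_eq_div,
    le_div_iff₀ hδ]
  have h1 : ((n k : ℝ) + 1) * min 1 (γ / 2) ≤ Real.exp (γ / 2 * n k) := by
    have h2 := Real.add_one_le_exp (γ / 2 * n k)
    have h3 : (n k : ℝ) * min 1 (γ / 2) ≤ n k * (γ / 2) := by
      gcongr; exact min_le_right _ _
    linarith [min_le_left 1 (γ / 2)]
  calc _ = (((n k : ℝ) + 1) * min 1 (γ / 2)) * Real.exp (-γ * n k) := by ring
    _ ≤ Real.exp (γ / 2 * n k) * Real.exp (-γ * n k) := by gcongr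
    _ = _ := by rw [← Real.exp_add]; congr 1; ring

/-- For a linear number of corruptions, the error of the cut-and-choose test decays exponentially
in the number of parties. -/
theorem exists_challenge_error_le {n t : ℕ → ℕ} (htn : ∀ k, t k < n k)
    (hlin : ∃ c₁ c₂ : ℝ, 0 < c₁ ∧ c₂ < 1 ∧
      ∀ᶠ k in atTop, c₁ * n k ≤ t k ∧ (t k : ℝ) ≤ c₂ * n k)
    (hn : (fun k : ℕ => Real.log k) =o[atTop] (fun k : ℕ => (n k : ℝ))) :
    ∃ γ : ℝ, 0 < γ ∧ ∀ᶠ k in atTop, 0 < t k / 2 ∧ ∃ N, N ≤ n k - t k ∧ 2 * N ≤ t k + 1 ∧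
      (1 - (((t k / 2 : ℕ) : ℝ) / n k) ^ 2) ^ N ≤ Real.exp (-γ * n k) := by
  obtain ⟨c₁, c₂, hc₁, hc₂, hev⟩ := hlin
  have hc : 0 < min (1 - c₂) (c₁ / 2) := lt_min (by linarith) (by linarith)
  -- As soon as `c₁ n ≥ 2`, the rounding in `t / 2` still leaves `p ≥ c₁ / 4`. The largest
  -- admissible `N` is at least `min (1 - c₂) (c₁ / 2) * n`, and `(1 - p ^ 2) ^ N ≤ exp (-p ^ 2 N)`.
  refine ⟨(c₁ / 4) ^ 2 * min (1 - c₂) (c₁ / 2), by positivity, ?_⟩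
  filter_upwards [hev, (tendsto_cast_atTop_of_log_isLittleO hn).eventually_ge_atTop (2 / c₁)]
    with k hk hnk
  have hn0 : (0 : ℝ) < n k := lt_of_lt_of_le (by positivity) hnk
  rw [div_le_iff₀ hc₁] at hnk
  have hfloor : ((t k : ℝ) - 1) / 2 ≤ ((t k / 2 : ℕ) : ℝ) := by
    have : t k ≤ 2 * (t k / 2) + 1 := by omega
    have : (t k : ℝ) ≤ 2 * ((t k / 2 : ℕ) : ℝ) + 1 := by exact_mod_cast this
    linarith
  have hhalf : c₁ / 4 * n k ≤ ((t k / 2 : ℕ) : ℝ) := by linarith [hk.1]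
  have hpos : (0 : ℝ) < ((t k / 2 : ℕ) : ℝ) := lt_of_lt_of_le (by positivity) hhalf
  refine ⟨by exact_mod_cast hpos, min (n k - t k) ((t k + 1) / 2), min_le_left _ _, ?_, ?_⟩
  · have := min_le_right (n k - t k) ((t k + 1) / 2)
    omega
  set p : ℝ := ((t k / 2 : ℕ) : ℝ) / n k with hp
  set N := min (n k - t k) ((t k + 1) / 2) with hN
  have hp1 : p ≤ 1 := by
    rw [hp, div_le_one hn0]
    exact_mod_cast (by have := htn k; omega : t k / 2 ≤ n k)
  have hpc : c₁ / 4 ≤ p := by rw [hp, le_div_iff₀ hn0]; exact hhalf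
  have hNc : min (1 - c₂) (c₁ / 2) * n k ≤ N := by
    rw [hN, Nat.cast_min, le_min_iff, Nat.cast_sub (htn k).le]
    constructor
    · calc _ ≤ (1 - c₂) * n k := by gcongr; exact min_le_left _ _
        _ ≤ _ := by linarith [hk.2]
    · have : t k ≤ 2 * ((t k + 1) / 2) := by omega
      have : (t k : ℝ) ≤ 2 * (((t k + 1) / 2 : ℕ) : ℝ) := by exact_mod_cast this
      calc _ ≤ c₁ / 2 * n k := by gcongr; exact min_le_right _ _
        _ ≤ _ := by linarith [hk.1]
  have hp0 : 0 ≤ p := by positivity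
  calc (1 - p ^ 2) ^ N ≤ Real.exp (-p ^ 2) ^ N := by
        refine pow_le_pow_left₀ (by nlinarith) (Real.one_sub_le_exp_neg _) _
    _ = Real.exp (-(p ^ 2 * N)) := by rw [← Real.exp_nat_mul]; congr 1; ring
    _ ≤ _ := by
        rw [Real.exp_le_exp, neg_mul, neg_le_neg_iff, mul_assoc]
        gcongr

/-! ## Unbounded quantum provers -/

theorem sum_norm_sq_mulVec {S : Type} [Fintype S] [DecidableEq S] (U : Matrix.unitaryGroup S ℂ)
    (v : S → ℂ) : ∑ i, ‖(U.1.mulVec v) i‖ ^ 2 = ∑ i, ‖v i‖ ^ 2 := by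
  have key : ∀ w : S → ℂ, ((∑ i, ‖w i‖ ^ 2 : ℝ) : ℂ) = star w ⬝ᵥ w := by
    intro w
    push_cast
    refine Finset.sum_congr rfl fun i _ => ?_
    rw [Pi.star_apply, ← Complex.conj_mul']
    rfl
  have hU : U.1.conjTranspose * U.1 = 1 := Matrix.mem_unitaryGroup_iff'.1 U.2
  have : ((∑ i, ‖(U.1.mulVec v) i‖ ^ 2 : ℝ) : ℂ) = ((∑ i, ‖v i‖ ^ 2 : ℝ) : ℂ) := by
    rw [key, key, Matrix.star_mulVec, Matrix.dotProduct_mulVec, Matrix.vecMul_vecMul, hU,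
      Matrix.vecMul_one]
  exact_mod_cast this

namespace QProver

variable {A E Z : Type} [Fintype A] [Fintype Z]

theorem prob_nonneg (Q : QProver A E Z) (a : Bits A) (e : Bits E) (z : Bits Z) :
    0 ≤ Q.prob a e z :=
  Finset.sum_nonneg fun _ _ => by positivity

open Classical in
/-- The probability that the first message is `a`. -/
noncomputable def firstProb (Q : QProver A E Z) (a : Bits A) : ℝ :=
  ∑ s, ‖if s.2.1 = a then Q.state s else 0‖ ^ 2

-- The move for `e` is unitary and is applied after the first message has been measured, so it
-- cannot influence the law of this message. Nothing else about quantum mechanics enters soundness.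
open Classical in
theorem sum_prob (Q : QProver A E Z) (a : Bits A) (e : Bits E) :
    ∑ z, Q.prob a e z = Q.firstProb a := by
  unfold firstProb prob
  rw [← sum_norm_sq_mulVec (Q.move e), Finset.sum_comm, Fintype.sum_prod_type,
    Fintype.sum_prod_type]
  refine Finset.sum_congr rfl fun d _ => ?_
  rw [Fintype.sum_prod_type]

open Classical in
theorem sum_firstProb (Q : QProver A E Z) : ∑ a, Q.firstProb a = 1 := by
  unfold firstProb
  rw [Finset.sum_comm, ← Q.normalized]
  refine Finset.sum_congr rfl fun s _ => ?_
  rw [Finset.sum_eq_single s.2.1]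
  · simp
  · intro a _ ha
    simp [Ne.symm ha]
  · simp

theorem firstProb_nonneg (Q : QProver A E Z) (a : Bits A) : 0 ≤ Q.firstProb a :=
  Finset.sum_nonneg fun _ _ => by positivity

open Classical in
/-- If acceptance implies a condition on the first message and the challenge, and for every first
message a random challenge satisfies it with probability at most `β`, then a quantum prover
convinces the verifier with probability at most `β`. -/
theorem favg_accept_le (Q : QProver A E Z) (S : Finset (Bits E))
    (acc : Bits A → Bits E → Bits Z → Prop) (conv : Bits A → Bits E → Prop)
    (h : ∀ a e z, acc a e z → conv a e) {β : ℝ}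
    (hβ : ∀ a, favg S (fun e => indic (conv a e)) ≤ β) :
    favg S (fun e => ∑ a, ∑ z, indic (acc a e z) * Q.prob a e z) ≤ β := by
  calc favg S (fun e => ∑ a, ∑ z, indic (acc a e z) * Q.prob a e z)
      ≤ favg S (fun e => ∑ a, indic (conv a e) * Q.firstProb a) := by
        refine favg_mono fun e _ => Finset.sum_le_sum fun a _ => ?_
        rw [← Q.sum_prob a e, Finset.mul_sum]
        exact Finset.sum_le_sum fun z _ =>
          mul_le_mul_of_nonneg_right (indic_mono (h a e z)) (Q.prob_nonneg a e z)
    _ = ∑ a, favg S (fun e => indic (conv a e)) * Q.firstProb a := by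
        unfold favg
        rw [Finset.sum_comm, Finset.sum_div]
        exact Finset.sum_congr rfl fun a _ => by rw [← Finset.sum_mul, div_mul_eq_mul_div]
    _ ≤ ∑ a, β * Q.firstProb a :=
        Finset.sum_le_sum fun a _ => mul_le_mul_of_nonneg_right (hβ a) (Q.firstProb_nonneg a)
    _ = β := by rw [← Finset.mul_sum, Q.sum_firstProb, mul_one]

end QProver

/-! ## Soundness -/

theorem PolySizeComputable.polyBounded_card_in {ι κ : ℕ → Type} [∀ k, Fintype (ι k)]
    [∀ k, Fintype (κ k)] {f : ∀ k, Bits (ι k) → Bits (κ k)} (h : PolySizeComputable f) :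
    PolyBounded fun k => Fintype.card (ι k) := by
  obtain ⟨p, hp⟩ := h
  refine ⟨p, fun k => ?_⟩
  obtain ⟨D, hD, -⟩ := hp k
  unfold BoolCircuit.size at hD
  dsimp only
  omega

theorem PolySizeComputable.polyBounded_card_out {ι κ : ℕ → Type} [∀ k, Fintype (ι k)]
    [∀ k, Fintype (κ k)] {f : ∀ k, Bits (ι k) → Bits (κ k)} (h : PolySizeComputable f) :
    PolyBounded fun k => Fintype.card (κ k) := by
  obtain ⟨p, hp⟩ := h
  refine ⟨p, fun k => ?_⟩
  obtain ⟨D, hD, -⟩ := hp k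
  unfold BoolCircuit.size at hD
  dsimp only
  omega

/-- The emulating circuit outputs the views of all parties, of which there is at least one. -/
theorem MPCEfficient.polyBounded_viewLen {P W : ℕ → Type} [∀ k, Fintype (P k)]
    [∀ k, Fintype (W k)] {π : ∀ k, MPCProtocol (P k) (W k)} (h : MPCEfficient π)
    (hn : ∀ k, 0 < (π k).n) : PolyBounded fun k => (π k).viewLen := by
  refine (PolySizeComputable.polyBounded_card_out h).mono fun k => ?_
  rw [Fintype.card_sigma, Finset.sum_congr rfl fun i _ => (π k).card_viewIdx i]
  simpa using Nat.le_mul_of_pos_left _ (hn k)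

namespace CommitmentScheme

/-- The key pair generated with coins `s` admits a commitment from which a wrong message is
extracted. -/
def ExtractionFails (C : CommitmentScheme) (k ℓ : ℕ) (s : Bits (Fin (C.coinB k))) : Prop :=
  ∃ m r, C.extract k ℓ (C.genB k s).2 (C.commit k ℓ (C.genB k s).1 m r) ≠ m

end CommitmentScheme

namespace SuperpositionProof

variable {R : NPRelation} {C : CommitmentScheme}

/-- The string `c` is a commitment to `0`. Coins opening it to `1` would make the extractor return
both bits; the other alternative of the claim would give a witness for `x`. -/
theorem functionality_eq_false {k n : ℕ} {x : Bits (Fin k)} (hx : List.ofFn x ∉ R.language)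
    {s : Bits (Fin (C.coinB k) ⊕ (Fin (C.rLen k 1) ⊕ Fin (C.coinB k)))}
    (hs : ¬C.ExtractionFails k 1 fun i => s (.inl i)) (ins : Fin n → Bits (WitIdx R C k)) :
    functionality R C k n (Sum.elim x (genCrs k s)) ins = false := by
  unfold functionality claim
  split_ifs with h
  · rw [decide_eq_false_iff_not]
    intro heq
    simp only [CommitmentScheme.ExtractionFails, not_exists, not_not] at hs
    have h0 := hs (fun _ => false) fun i => s (.inr (.inl i))
    have h1 := hs (fun _ => true) fun i => (xorAll ins) (.inr (.inr i))
    have heq' : C.commit k 1 (C.genB k fun i => s (.inl i)).1 (fun _ => true)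
        (fun i => (xorAll ins) (.inr (.inr i))) =
        C.commit k 1 (C.genB k fun i => s (.inl i)).1 (fun _ => false)
        (fun i => s (.inr (.inl i))) := heq
    rw [heq', h0] at h1
    exact Bool.false_ne_true (congrFun h1 0)
  · rw [← Bool.not_eq_true]
    intro hR
    refine hx ⟨List.ofFn fun i => (xorAll ins) (.inr (.inl i)), ?_, hR⟩
    rw [List.length_ofFn, List.length_ofFn]

/-- The views are extracted from the first message alone, hence fixed before the challenge; correct
openings have to reveal exactly these views. -/
theorem convincing_of_verifierAccepts {k : ℕ} (π : MPCProtocol (PubIdx C k) (WitIdx R C k))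
    {x : Bits (Fin k)} {s : Bits (Fin (C.coinB k) ⊕ (Fin (C.rLen k 1) ⊕ Fin (C.coinB k)))}
    (hs : ¬C.ExtractionFails k π.viewLen fun i => s (.inr (.inr i)))
    {a : Bits (Fin π.n × Fin (C.cLen k π.viewLen))} {e : Bits (Fin π.n)}
    {z : Bits (Fin π.n × (Fin π.viewLen ⊕ Fin (C.rLen k π.viewLen)))}
    (h : verifierAccepts π x (genCrs k s) a e z) :
    π.Convincing (Sum.elim x (genCrs k s)) (fun i => π.decodeView i
      (C.extract k π.viewLen (C.genB k fun i => s (.inr (.inr i))).2 fun b => a (i, b))) e := by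
  simp only [CommitmentScheme.ExtractionFails, not_exists, not_not] at hs
  have hv : ∀ i, e i = true → π.decodeView i
      (C.extract k π.viewLen (C.genB k fun i => s (.inr (.inr i))).2 fun b => a (i, b)) =
      openedView π z i := by
    intro i hi
    have h1 := h.1 i hi
    unfold openedView
    rw [← h1]
    exact congrArg _ (hs _ _)
  refine ⟨fun i hi => ?_, fun i j hij hi hj => ?_⟩
  · simp only [hv i hi]
    exact h.2.1 i hi
  · simp only [hv i hi, hv j hj]
    exact h.2.2 i j hij hi hj

/-- A union bound: coins for which one of the two key pairs fails to extract are charged with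
success probability one, all others with `β`. -/
theorem cheatProb_le (π : ∀ k, MPCProtocol (PubIdx C k) (WitIdx R C k)) (t : ℕ → ℕ) (k : ℕ)
    {β : ℝ} (hβ0 : 0 ≤ β)
    (hβ : ∀ pub, (∀ ins, functionality R C k (π k).n pub ins = false) → ∀ v,
      favg (challengeSets (π k).n (t k)) (fun e => indic ((π k).Convincing pub v e)) ≤ β)
    {x : Bits (Fin k)} (hx : List.ofFn x ∉ R.language)
    (Pr : Bits ((proofSystem π t).Crs k) → QProver ((proofSystem π t).Msg k)
      ((proofSystem π t).Chal k) ((proofSystem π t).Resp k)) :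
    (proofSystem π t).cheatProb k x Pr ≤ β +
      ((uavg fun s : Bits (Fin (C.coinB k)) => indic (C.ExtractionFails k 1 s)) +
        uavg fun s : Bits (Fin (C.coinB k)) => indic (C.ExtractionFails k (π k).viewLen s)) := by
  classical
  have hpt : ∀ s : Bits (Fin (C.coinB k) ⊕ (Fin (C.rLen k 1) ⊕ Fin (C.coinB k))),
      favg ((proofSystem π t).challenges k) (fun e =>
        ∑ a : Bits ((proofSystem π t).Msg k), ∑ z : Bits ((proofSystem π t).Resp k),
          indic ((proofSystem π t).accepts k x ((proofSystem π t).crsGen k s) a e z) *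
            (Pr ((proofSystem π t).crsGen k s)).prob a e z) ≤
      β + (indic (C.ExtractionFails k 1 fun i => s (.inl i)) +
        indic (C.ExtractionFails k (π k).viewLen fun i => s (.inr (.inr i)))) := by
    intro s
    by_cases h1 : C.ExtractionFails k 1 fun i => s (.inl i)
    · rw [indic_of_true h1]
      refine (QProver.favg_accept_le _ _ _ (fun _ _ => True) (fun _ _ _ _ => trivial) (β := 1)
        fun a => favg_le_of_forall_le zero_le_one fun e _ => indic_le_one _).trans ?_
      linarith [indic_nonneg (C.ExtractionFails k (π k).viewLen fun i => s (.inr (.inr i)))]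
    by_cases h2 : C.ExtractionFails k (π k).viewLen fun i => s (.inr (.inr i))
    · rw [indic_of_true h2]
      refine (QProver.favg_accept_le _ _ _ (fun _ _ => True) (fun _ _ _ _ => trivial) (β := 1)
        fun a => favg_le_of_forall_le zero_le_one fun e _ => indic_le_one _).trans ?_
      linarith [indic_nonneg (C.ExtractionFails k 1 fun i => s (.inl i))]
    · refine (QProver.favg_accept_le _ _ _ _
        (fun a e z h => convincing_of_verifierAccepts (π k) h2 h) fun a =>
        hβ _ (functionality_eq_false hx h1) _).trans ?_
      linarith [indic_nonneg (C.ExtractionFails k 1 fun i => s (.inl i)),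
        indic_nonneg (C.ExtractionFails k (π k).viewLen fun i => s (.inr (.inr i)))]
  have hb1 : (uavg fun s : Bits (Fin (C.coinB k) ⊕ (Fin (C.rLen k 1) ⊕ Fin (C.coinB k))) =>
      indic (C.ExtractionFails k 1 fun i => s (.inl i))) =
      uavg fun s : Bits (Fin (C.coinB k)) => indic (C.ExtractionFails k 1 s) := by
    rw [uavg_bits_sum]
    simp only [Sum.elim_inl, uavg_const]
  have hb2 : (uavg fun s : Bits (Fin (C.coinB k) ⊕ (Fin (C.rLen k 1) ⊕ Fin (C.coinB k))) =>
      indic (C.ExtractionFails k (π k).viewLen fun i => s (.inr (.inr i)))) =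
      uavg fun s : Bits (Fin (C.coinB k)) => indic (C.ExtractionFails k (π k).viewLen s) := by
    rw [uavg_bits_sum]
    refine (uavg_congr fun a => uavg_bits_sum _).trans ?_
    simp only [Sum.elim_inr, uavg_const]
  rw [← hb1, ← hb2, ← uavg_add]
  refine ((uavg_inst _ _ _).trans_le (uavg_mono hpt)).trans ?_
  rw [uavg_add, uavg_const]

theorem proofSystem_sound (hC : C.Extractable)
    (π : ∀ k, MPCProtocol (PubIdx C k) (WitIdx R C k)) (t : ℕ → ℕ)
    (hrob : ∀ k, (π k).Robust (functionality R C k (π k).n) (t k))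
    (heff : MPCEfficient π) (htn : ∀ k, t k < (π k).n)
    (hlin : ∃ c₁ c₂ : ℝ, 0 < c₁ ∧ c₂ < 1 ∧
      ∀ᶠ k in Filter.atTop, c₁ * (π k).n ≤ t k ∧ (t k : ℝ) ≤ c₂ * (π k).n)
    (hn : (fun k : ℕ => Real.log k) =o[Filter.atTop] (fun k : ℕ => ((π k).n : ℝ))) :
    (proofSystem π t).Sound R.language := by
  classical
  obtain ⟨γ, hγ, hev⟩ := exists_challenge_error_le htn hlin hn
  let good : ℕ → Prop := fun k => 0 < t k / 2 ∧ ∃ N, N ≤ (π k).n - t k ∧ 2 * N ≤ t k + 1 ∧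
      (1 - (((t k / 2 : ℕ) : ℝ) / (π k).n) ^ 2) ^ N ≤ Real.exp (-γ * (π k).n)
  -- Soundness asks for a bound at every `k`. The exponential bound is available for all large `k`,
  -- and the trivial bound `1` at the others does not affect negligibility.
  let β : ℕ → ℝ := fun k => if good k then (((π k).n : ℝ) + 1) * Real.exp (-γ * (π k).n) else 1
  have hβ0 : ∀ k, 0 ≤ β k := fun k => by
    simp only [β]
    split_ifs <;> positivity
  have hβneg : Negligible β := by
    refine (negligible_succ_mul_exp_neg hn hγ).of_eventually_abs_le ?_
    filter_upwards [hev] with k hk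
    simp only [β, good, if_pos hk, le_refl]
  refine ⟨_, hβneg.add ((hC (fun _ => 1) (polyBounded_const 1)).add
    (hC (fun k => (π k).viewLen) (heff.polyBounded_viewLen fun k => (htn k).pos))),
    fun k x hx Pr => cheatProb_le π t k (hβ0 k) ?_ hx Pr⟩
  intro pub hF v
  by_cases hk : good k
  · obtain ⟨hs, N, hN, hN', hle⟩ := id hk
    refine ((π k).favg_convincing_le (hrob k) (htn k) hs hN hN' hF v).trans ?_
    simp only [β, if_pos hk]
    gcongr
  · simp only [β, if_neg hk]
    exact favg_le_of_forall_le zero_le_one fun e _ => indic_le_one _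

end SuperpositionProof

/-! ## Linearity and unitarity of quantum circuits -/

namespace QGate

variable {ι κ : Type}

theorem apply_add (g : QGate ι) (φ ψ : QState ι) : g.apply (φ + ψ) = g.apply φ + g.apply ψ := by
  funext b
  cases g with
  | single i U => simp only [apply, Pi.add_apply, mul_add, Finset.sum_add_distrib]
  | toffoli i j l hi hj => rfl

theorem apply_smul (g : QGate ι) (c : ℂ) (ψ : QState ι) : g.apply (c • ψ) = c • g.apply ψ := by
  funext b
  cases g with
  | single i U =>
    simp only [apply, Pi.smul_apply, smul_eq_mul, Finset.mul_sum]
    exact Finset.sum_congr rfl fun _ _ => by ring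
  | toffoli i j l hi hj => rfl

open Classical in
theorem update_extend {f : ι ↪ κ} (b : Bits κ) (i : ι) (c : Bool) :
    Function.update b (f i) c = Function.extend f (Function.update (b ∘ f) i c) b := by
  funext y
  by_cases hy : ∃ j, f j = y
  · obtain ⟨j, rfl⟩ := hy
    rw [f.injective.extend_apply]
    by_cases hj : j = i
    · subst hj; simp
    · rw [Function.update_of_ne hj, Function.update_of_ne (f.injective.ne hj)]; rfl
  · rw [Function.extend_apply' _ _ _ hy, Function.update_of_ne fun h => hy ⟨i, h.symm⟩]

/-- Wires outside the range of `f` are spectators: the amplitude at `b` involves only strings that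
agree with `b` there. -/
theorem map_apply (f : ι ↪ κ) (g : QGate ι) (ψ : QState κ) (b : Bits κ) :
    (g.map f).apply ψ b = g.apply (fun b' => ψ (Function.extend f b' b)) (b ∘ f) := by
  cases g with
  | single i U => simp only [map, apply, update_extend]; rfl
  | toffoli i j l hi hj => simp only [map, apply, update_extend]; rfl

end QGate

namespace QCircuit

variable {ι κ : Type}

theorem run_nil (ψ : QState ι) : QCircuit.run [] ψ = ψ := rfl

theorem run_cons (g : QGate ι) (C : QCircuit ι) (ψ : QState ι) :
    QCircuit.run (g :: C) ψ = QCircuit.run C (g.apply ψ) := rfl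

theorem run_append (C D : QCircuit ι) (ψ : QState ι) :
    QCircuit.run (C ++ D) ψ = QCircuit.run D (QCircuit.run C ψ) :=
  List.foldl_append

/-- The transformation performed by a circuit, as a linear map. -/
noncomputable def runLin (C : QCircuit ι) : QState ι →ₗ[ℂ] QState ι where
  toFun := C.run
  map_add' φ ψ := by
    induction C generalizing φ ψ with
    | nil => rfl
    | cons g C ih => simp only [run_cons, QGate.apply_add, ih]
  map_smul' c ψ := by
    induction C generalizing ψ with
    | nil => rfl
    | cons g C ih => simp only [run_cons, QGate.apply_smul, ih, RingHom.id_apply]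

theorem run_sum {J : Type} (C : QCircuit ι) (s : Finset J) (φ : J → QState ι) :
    C.run (∑ j ∈ s, φ j) = ∑ j ∈ s, C.run (φ j) :=
  map_sum C.runLin φ s

theorem run_smul (C : QCircuit ι) (c : ℂ) (φ : QState ι) : C.run (c • φ) = c • C.run φ :=
  map_smul C.runLin c φ

theorem run_zero (C : QCircuit ι) : C.run 0 = 0 :=
  map_zero C.runLin

/-- The spectator principle for whole circuits: for each content of the wires outside the range of
`f`, the circuit acts separately on the corresponding slice of the state. -/
theorem embed_run (f : ι ↪ κ) (C : QCircuit ι) (ψ : QState κ) (b : Bits κ) :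
    (C.embed f).run ψ b = C.run (fun b' => ψ (Function.extend f b' b)) (b ∘ f) := by
  induction C generalizing ψ with
  | nil =>
    have : Function.extend f (b ∘ f) b = b := by
      funext y
      by_cases hy : ∃ j, f j = y
      · obtain ⟨j, rfl⟩ := hy
        rw [f.injective.extend_apply]; rfl
      · rw [Function.extend_apply' _ _ _ hy]
    exact congrArg ψ this.symm
  | cons g C ih =>
    have e1 : (QCircuit.embed f (g :: C)).run ψ =
        QCircuit.run (QCircuit.embed f C) ((g.map f).apply ψ) := rfl
    rw [e1, ih, run_cons]
    congr 1
    funext b'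
    rw [QGate.map_apply]
    have h1 : Function.extend f b' b ∘ f = b' := by
      funext i
      exact f.injective.extend_apply _ _ _
    have h2 : ∀ b'' : Bits ι, Function.extend f b'' (Function.extend f b' b) =
        Function.extend f b'' b := by
      intro b''
      funext y
      by_cases hy : ∃ j, f j = y
      · obtain ⟨j, rfl⟩ := hy
        rw [f.injective.extend_apply, f.injective.extend_apply]
      · rw [Function.extend_apply' _ _ _ hy, Function.extend_apply' _ _ _ hy,
          Function.extend_apply' _ _ _ hy]
    simp only [h1, h2]

theorem embed_length (f : ι ↪ κ) (C : QCircuit ι) : (C.embed f).length = C.length :=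
  List.length_map _

end QCircuit

theorem QGate.sum_norm_sq_apply {ι : Type} [Fintype (Bits ι)] (g : QGate ι) (ψ : QState ι) :
    ∑ b, ‖g.apply ψ b‖ ^ 2 = ∑ b, ‖ψ b‖ ^ 2 := by
  classical
  cases g with
  | toffoli i j l hi hj =>
    have hinv : Function.Involutive fun b : Bits ι =>
        Function.update b l (xor (b l) (b i && b j)) := by
      intro b
      simp only [Function.update_self, Function.update_of_ne hi, Function.update_of_ne hj,
        Function.update_idem]
      simp
    exact Equiv.sum_comp hinv.toPerm fun b => ‖ψ b‖ ^ 2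
  | single i U =>
    -- Strings that differ only at wire `i` form pairs, and `U` acts on each pair as a
    -- two-dimensional unitary; `hdouble` sums over pairs by counting each of them twice.
    let fl : Bits ι → Bits ι := fun b => Function.update b i (!b i)
    have hinv : Function.Involutive fl := by
      intro b
      simp [fl]
    have hdouble : ∀ F : Bits ι → ℝ, 2 * ∑ b, F b = ∑ b, (F b + F (fl b)) := by
      intro F
      have h : ∑ b, F (fl b) = ∑ b, F b := Equiv.sum_comp hinv.toPerm F
      rw [Finset.sum_add_distrib, h, two_mul]
    have key : ∀ b, ‖(QGate.single i U).apply ψ b‖ ^ 2 +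
        ‖(QGate.single i U).apply ψ (fl b)‖ ^ 2 = ‖ψ b‖ ^ 2 + ‖ψ (fl b)‖ ^ 2 := by
      intro b
      have h := sum_norm_sq_mulVec U fun c => ψ (Function.update b i c)
      simp only [Fintype.sum_bool] at h
      have hA : ∀ b' : Bits ι, (∀ c, Function.update b' i c = Function.update b i c) →
          (QGate.single i U).apply ψ b' =
            (U.1.mulVec fun c => ψ (Function.update b i c)) (b' i) := by
        intro b' hb'
        simp only [apply, hb']
        rfl
      rw [hA b fun c => rfl, hA (fl b) fun c => by simp [fl]]
      have hs : Function.update b i (b i) = b := Function.update_eq_self i b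
      have hfl : fl b i = !b i := by simp [fl]
      rw [hfl]
      simp only [fl]
      cases hb : b i <;> rw [hb] at hs <;>
        simp only [Bool.not_false, Bool.not_true, hs] at h ⊢ <;> linarith
    have h1 := hdouble fun b => ‖(QGate.single i U).apply ψ b‖ ^ 2
    have h2 := hdouble fun b => ‖ψ b‖ ^ 2
    rw [Finset.sum_congr rfl fun b _ => key b] at h1
    linarith

theorem QCircuit.sum_norm_sq_run {ι : Type} [Fintype (Bits ι)] (C : QCircuit ι) (ψ : QState ι) :
    ∑ b, ‖C.run ψ b‖ ^ 2 = ∑ b, ‖ψ b‖ ^ 2 := by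
  induction C generalizing ψ with
  | nil => rfl
  | cons g C ih => rw [run_cons, ih, g.sum_norm_sq_apply]

theorem sum_norm_sq_ket {ι : Type} [Fintype (Bits ι)] (b₀ : Bits ι) : ∑ b, ‖ket b₀ b‖ ^ 2 = 1 := by
  rw [Finset.sum_eq_single b₀]
  · simp [ket]
  · intro b _ hb
    simp [ket, hb]
  · simp

theorem probOne_nonneg {ι : Type} [Fintype ι] (o : ι) (ψ : QState ι) : 0 ≤ probOne o ψ :=
  Finset.sum_nonneg fun b _ => by split_ifs <;> positivity

theorem probOne_eq {ι : Type} [Fintype ι] [Fintype (Bits ι)] (o : ι) (ψ : QState ι) :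
    probOne o ψ = ∑ b : Bits ι, if b o = true then ‖ψ b‖ ^ 2 else 0 := by
  unfold probOne
  convert rfl

theorem probOne_le {ι : Type} [Fintype ι] [Fintype (Bits ι)] (o : ι) (ψ : QState ι) :
    probOne o ψ ≤ ∑ b, ‖ψ b‖ ^ 2 := by
  rw [probOne_eq]
  exact Finset.sum_le_sum fun b _ => by split_ifs <;> [exact le_rfl; positivity]

/-! ## Slices of a state of a composite register -/

section Slice

variable {S V : Type}

/-- The (unnormalised) state of `V` if the register `S` contains `s`. -/
def slice (ψ : QState (S ⊕ V)) (s : Bits S) : QState V := fun v => ψ (Sum.elim s v)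

theorem extend_inr (s : Bits S) (v v' : Bits V) :
    Function.extend (Function.Embedding.inr : V ↪ S ⊕ V) v' (Sum.elim s v) = Sum.elim s v' := by
  funext y
  cases y with
  | inl a => rw [Function.extend_apply' _ _ _ (by rintro ⟨j, hj⟩; cases hj)]; rfl
  | inr a => exact Function.Embedding.inr.injective.extend_apply _ _ _

theorem slice_embed_inr (C : QCircuit V) (ψ : QState (S ⊕ V)) (s : Bits S) :
    slice ((C.embed Function.Embedding.inr).run ψ) s = C.run (slice ψ s) := by
  funext v
  unfold slice
  rw [QCircuit.embed_run]
  simp only [extend_inr]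
  rfl

theorem probOne_inr [Fintype S] [Fintype V] [Fintype (Bits S)] (o : V) (ψ : QState (S ⊕ V)) :
    probOne (Sum.inr o) ψ = ∑ s, probOne o (slice ψ s) := by
  classical
  simp only [probOne_eq]
  rw [← (Equiv.sumArrowEquivProdArrow S V Bool).symm.sum_comp, Fintype.sum_prod_type]
  rfl

theorem probOne_smul [Fintype V] (o : V) (c : ℂ) (ψ : QState V) :
    probOne o (c • ψ) = ‖c‖ ^ 2 * probOne o ψ := by
  unfold probOne
  rw [Finset.mul_sum]
  refine Finset.sum_congr rfl fun b _ => ?_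
  split_ifs
  · rw [Pi.smul_apply, smul_eq_mul, norm_mul, mul_pow]
  · ring

end Slice

/-! ## The game played by a superposition verifier -/

/-- The probability that the verifier outputs `1`, if it receives the classical input `inp` and its
query is answered with the function `f`. -/
noncomputable def gameProb {I E Z : Type} [Fintype I] [Fintype E] [Fintype Z] (V : QVerifier I E Z)
    (inp : Bits I) (f : Bits E → Bits Z) : ℝ :=
  probOne V.outQubit
    (V.finish.run (runInSuperposition f (V.query.run (ket (V.initBits inp)))))

section Game

variable {I E Z : Type} {a : ℕ}

theorem runInSuperposition_smul (f : Bits E → Bits Z) (c : ℂ) (ψ : QState (VReg I E Z a)) :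
    runInSuperposition f (c • ψ) = c • runInSuperposition f ψ := rfl

theorem sum_norm_sq_runInSuperposition [Fintype (Bits (VReg I E Z a))] (f : Bits E → Bits Z)
    (ψ : QState (VReg I E Z a)) :
    ∑ b, ‖runInSuperposition f ψ b‖ ^ 2 = ∑ b, ‖ψ b‖ ^ 2 := by
  have hinv : Function.Involutive fun b : Bits (VReg I E Z a) =>
      (Sum.elim (fun c => b (.inl c)) (Sum.elim (Sum.elim (fun e => b (.inr (.inl (.inl e))))
        (fun z => xor (b (.inr (.inl (.inr z)))) (f (fun e => b (.inr (.inl (.inl e)))) z)))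
        (fun a => b (.inr (.inr a)))) : Bits (VReg I E Z a)) := by
    intro b
    funext y
    rcases y with c | ((e | z) | a) <;> simp
  exact Equiv.sum_comp hinv.toPerm fun b => ‖ψ b‖ ^ 2

theorem gameProb_nonneg [Fintype I] [Fintype E] [Fintype Z] (V : QVerifier I E Z) (inp : Bits I)
    (f : Bits E → Bits Z) : 0 ≤ gameProb V inp f :=
  probOne_nonneg _ _

theorem gameProb_le_one [Fintype I] [Fintype E] [Fintype Z] (V : QVerifier I E Z) (inp : Bits I)
    (f : Bits E → Bits Z) : gameProb V inp f ≤ 1 := by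
  classical
  refine (probOne_le _ _).trans_eq ?_
  rw [QCircuit.sum_norm_sq_run, sum_norm_sq_runInSuperposition, QCircuit.sum_norm_sq_run,
    sum_norm_sq_ket]

theorem abs_gameProb_le_one [Fintype I] [Fintype E] [Fintype Z] (V : QVerifier I E Z)
    (inp : Bits I) (f : Bits E → Bits Z) : |gameProb V inp f| ≤ 1 := by
  rw [abs_of_nonneg (gameProb_nonneg V inp f)]
  exact gameProb_le_one V inp f

open Classical in
/-- The part of an answered query in which the challenge is `e`. -/
noncomputable def answeredPart (ψ : QState (VReg I E Z a)) (e : Bits E) (z : Bits Z) :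
    QState (VReg I E Z a) := fun b =>
  if (fun i => b (.inr (.inl (.inl i)))) = e then
    runInSuperposition (fun _ => z) ψ b else 0

open Classical in
theorem runInSuperposition_eq_sum [Fintype E] (f : Bits E → Bits Z) (ψ : QState (VReg I E Z a)) :
    runInSuperposition f ψ = ∑ e, answeredPart ψ e (f e) := by
  funext b
  rw [Finset.sum_apply, Finset.sum_eq_single fun i => b (.inr (.inl (.inl i)))]
  · simp [answeredPart, runInSuperposition]
  · intro e _ he
    simp [answeredPart, he.symm]
  · simp

open Classical in
/-- The contribution of a pair of challenges to the output probability. -/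
noncomputable def pairTerm [Fintype I] [Fintype E] [Fintype Z] (V : QVerifier I E Z)
    (inp : Bits I) (e e' : Bits E) (z z' : Bits Z) : ℝ :=
  ∑ b : Bits (VReg I E Z V.anc), if b V.outQubit = true then
    (V.finish.run (answeredPart (V.query.run (ket (V.initBits inp))) e z) b *
      (starRingEnd ℂ) (V.finish.run (answeredPart (V.query.run (ket (V.initBits inp))) e' z') b)).re
    else 0

open Classical in
/-- The output probability is a sum of terms that depend on the answers to two challenges only. -/
theorem gameProb_eq_sum_pairTerm [Fintype I] [Fintype E] [Fintype Z] (V : QVerifier I E Z)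
    (inp : Bits I) (f : Bits E → Bits Z) :
    gameProb V inp f = ∑ q : Bits E × Bits E, pairTerm V inp q.1 q.2 (f q.1) (f q.2) := by
  unfold gameProb pairTerm
  rw [probOne_eq]
  rw [Finset.sum_comm]
  refine Finset.sum_congr rfl fun b _ => ?_
  by_cases hb : b V.outQubit = true
  · simp only [hb, if_true]
    -- Writing the squared modulus of a sum over challenges as `z * conj z` gives a double sum; real
    -- parts keep its terms real.
    rw [runInSuperposition_eq_sum, QCircuit.run_sum, Finset.sum_apply, Fintype.sum_prod_type,
      ← Complex.ofReal_re (‖_‖ ^ 2), Complex.ofReal_pow, ← Complex.mul_conj', map_sum,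
      Finset.sum_mul_sum]
    simp only [Complex.re_sum]
  · simp [hb]

end Game

theorem sum_arrow_prod {n : ℕ} {K R : Type} [Fintype K] [Fintype R]
    (F : (Fin n → K) → (Fin n → R) → ℝ) :
    ∑ x : Fin n → K × R, F (fun i => (x i).1) (fun i => (x i).2) = ∑ c, ∑ r, F c r := by
  rw [← (Equiv.arrowProdEquivProdArrow (Fin n) (fun _ => K) (fun _ => R)).symm.sum_comp,
    Fintype.sum_prod_type]
  rfl

/-! ## Resampling the coins of a commitment -/

section Resampling

variable {V K R : Type} [Fintype R] (com : V → R → K)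

/-- The probability that a commitment to `v` is `c`. -/
noncomputable def comProb (v : V) (c : K) : ℝ := uavg fun r => indic (com v r = c)

open Classical in
/-- The conditional distribution of the coins of a commitment, given the message `v` and the
commitment `c`; it is uniform if `c` is not a commitment to `v`. -/
noncomputable def condCoin (v : V) (c : K) (r : R) : ℝ :=
  if comProb com v c = 0 then (Fintype.card R : ℝ)⁻¹
  else indic (com v r = c) / Fintype.card R / comProb com v c

theorem comProb_nonneg (v : V) (c : K) : 0 ≤ comProb com v c :=
  uavg_nonneg fun _ => indic_nonneg _

theorem condCoin_nonneg (v : V) (c : K) (r : R) : 0 ≤ condCoin com v c r := by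
  unfold condCoin
  have := comProb_nonneg com v c
  have := indic_nonneg (com v r = c)
  split_ifs <;> positivity

theorem sum_condCoin [Nonempty R] (v : V) (c : K) : ∑ r, condCoin com v c r = 1 := by
  unfold condCoin
  split_ifs with h
  · simp
  · rw [← Finset.sum_div, ← Finset.sum_div]
    exact div_self h

/-- The chain rule for the joint law of commitment and coins. For a commitment of probability zero
both sides vanish, so the uniform default in `condCoin` does no harm. -/
theorem comProb_mul_condCoin (v : V) (c : K) (r : R) :
    comProb com v c * condCoin com v c r = indic (com v r = c) / Fintype.card R := by
  unfold condCoin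
  split_ifs with h
  · rw [h, zero_mul]
    unfold comProb uavg at h
    have hR : (Fintype.card R : ℝ) ≠ 0 := by
      have : Nonempty R := ⟨r⟩
      exact_mod_cast Fintype.card_ne_zero
    rw [div_eq_zero_iff, or_iff_left hR,
      Finset.sum_eq_zero_iff_of_nonneg fun _ _ => indic_nonneg _] at h
    rw [h r (Finset.mem_univ r), zero_div]
  · field_simp

theorem sum_comProb [Fintype K] [Nonempty R] (v : V) : ∑ c, comProb com v c = 1 := by
  classical
  unfold comProb
  rw [← uavg_sum]
  refine (uavg_congr fun r => ?_).trans (uavg_const 1)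
  simp [indic]

theorem toReal_commit_eq_comProb [Nonempty R] (v : V) (c : K) :
    (((PMF.uniformOfFintype R).map (com v)) c).toReal = comProb com v c := by
  classical
  rw [toReal_map_uniform]
  exact uavg_congr fun r => by simp [indic]

/-- A commitment with its coins, and a commitment to `v₀` with coins resampled as if it were a
commitment to `v`, are as close as the two commitments. -/
theorem sum_abs_resample [Fintype K] [Nonempty R] (v v₀ : V) :
    ∑ x : K × R, |comProb com v x.1 * condCoin com v x.1 x.2 -
      comProb com v₀ x.1 * condCoin com v x.1 x.2| =
    2 * statDist ((PMF.uniformOfFintype R).map (com v)) ((PMF.uniformOfFintype R).map (com v₀)) := by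
  rw [Fintype.sum_prod_type, statDist, mul_div_cancel₀ _ two_ne_zero]
  refine Finset.sum_congr rfl fun c _ => ?_
  rw [toReal_commit_eq_comProb, toReal_commit_eq_comProb]
  simp only [← sub_mul, abs_mul, ← Finset.mul_sum, abs_of_nonneg (condCoin_nonneg com v c _),
    sum_condCoin, mul_one]

variable {n : ℕ}

/-- Drawing coins and committing is the same as drawing the commitment and then its coins from the
conditional law, independently for all parties. -/
theorem uavg_commit_eq_sum [Fintype K] [Nonempty R] (v : Fin n → V)
    (G : (Fin n → K) → (Fin n → R) → ℝ) :
    (uavg fun r : Fin n → R => G (fun i => com (v i) (r i)) r) =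
      ∑ x : Fin n → K × R, (∏ i, comProb com (v i) (x i).1 * condCoin com (v i) (x i).1 (x i).2) *
        G (fun i => (x i).1) (fun i => (x i).2) := by
  classical
  simp only [comProb_mul_condCoin]
  rw [sum_arrow_prod fun (c : Fin n → K) (r : Fin n → R) =>
    (∏ i, indic (com (v i) (r i) = c i) / Fintype.card R) * G c r, Finset.sum_comm]
  unfold uavg
  rw [Finset.sum_div]
  refine Finset.sum_congr rfl fun r _ => ?_
  rw [Finset.sum_eq_single fun i => com (v i) (r i)]
  · rw [Finset.prod_congr rfl fun i _ => by rw [indic_of_true rfl]]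
    simp [div_eq_inv_mul]
  · intro c _ hc
    obtain ⟨i, hi⟩ := Function.ne_iff.1 hc
    rw [Finset.prod_eq_zero (Finset.mem_univ i), zero_mul]
    rw [indic_of_false (Ne.symm hi), zero_div]
  · simp

/-- The loss when commitments to `v i` are replaced by commitments to `v₀`, and the coins are
resampled. -/
theorem abs_uavg_commit_sub_resample_le [Fintype K] [Nonempty R] (v : Fin n → V) (v₀ : V) {δ : ℝ}
    (hδ : ∀ v, statDist ((PMF.uniformOfFintype R).map (com v))
      ((PMF.uniformOfFintype R).map (com v₀)) ≤ δ)
    (G : (Fin n → K) → (Fin n → R) → ℝ) (hG : ∀ c r, |G c r| ≤ 1) :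
    |(uavg fun r : Fin n → R => G (fun i => com (v i) (r i)) r) -
      ∑ c : Fin n → K, (∏ i, comProb com v₀ (c i)) *
        ∑ r : Fin n → R, (∏ i, condCoin com (v i) (c i) (r i)) * G c r| ≤ 2 * n * δ := by
  have hq : ∑ c : Fin n → K, (∏ i, comProb com v₀ (c i)) *
        ∑ r : Fin n → R, (∏ i, condCoin com (v i) (c i) (r i)) * G c r =
      ∑ x : Fin n → K × R, (∏ i, comProb com v₀ (x i).1 * condCoin com (v i) (x i).1 (x i).2) *
        G (fun i => (x i).1) (fun i => (x i).2) := by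
    refine Eq.trans ?_ (sum_arrow_prod fun (c : Fin n → K) (r : Fin n → R) =>
      (∏ i, comProb com v₀ (c i) * condCoin com (v i) (c i) (r i)) * G c r).symm
    refine Finset.sum_congr rfl fun c _ => ?_
    rw [Finset.mul_sum]
    refine Finset.sum_congr rfl fun r _ => ?_
    rw [Finset.prod_mul_distrib, mul_assoc]
  rw [hq, uavg_commit_eq_sum, ← Finset.sum_sub_distrib]
  -- Both experiments are product distributions with the same conditional coins, so their distance
  -- is at most the sum of the distances of single commitments.
  calc _ ≤ ∑ x : Fin n → K × R,
        |(∏ i, comProb com (v i) (x i).1 * condCoin com (v i) (x i).1 (x i).2) -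
          ∏ i, comProb com v₀ (x i).1 * condCoin com (v i) (x i).1 (x i).2| := by
        refine (Finset.abs_sum_le_sum_abs _ _).trans (Finset.sum_le_sum fun x _ => ?_)
        rw [← sub_mul, abs_mul]
        exact mul_le_of_le_one_right (abs_nonneg _) (hG _ _)
    _ ≤ ∑ i, ∑ x : K × R, |comProb com (v i) x.1 * condCoin com (v i) x.1 x.2 -
          comProb com v₀ x.1 * condCoin com (v i) x.1 x.2| := by
        have hnn : ∀ (u : V) (i : Fin n) (x : K × R),
            0 ≤ comProb com u x.1 * condCoin com (v i) x.1 x.2 := fun u i x =>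
          mul_nonneg (comProb_nonneg com u x.1) (condCoin_nonneg com _ _ _)
        have hone : ∀ (u : V) (i : Fin n),
            ∑ x : K × R, comProb com u x.1 * condCoin com (v i) x.1 x.2 = 1 := by
          intro u i
          rw [Fintype.sum_prod_type]
          simp only [← Finset.mul_sum, sum_condCoin, mul_one, sum_comProb]
        have key := sum_abs_prod_sub_prod_le (n := n) (X := K × R)
          (fun i x => comProb com (v i) x.1 * condCoin com (v i) x.1 x.2)
          (fun i x => comProb com v₀ x.1 * condCoin com (v i) x.1 x.2)
          (fun i x => hnn (v i) i x) (fun i x => hnn v₀ i x) (fun i => hone (v i) i)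
          (fun i => hone v₀ i)
        exact key
    _ ≤ ∑ _i : Fin n, 2 * δ := by
        refine Finset.sum_le_sum fun i _ => ?_
        rw [sum_abs_resample]
        linarith [hδ (v i)]
    _ = 2 * n * δ := by
        rw [Finset.sum_const, Finset.card_fin, nsmul_eq_mul]
        ring

end Resampling

/-- The average of a function of some coordinates depends only on the weights of these
coordinates. -/
theorem sum_prod_mul_congr {n : ℕ} {R : Type} [Fintype R] (T : Finset (Fin n))
    (κ κ' : Fin n → R → ℝ) (hκ : ∀ i, ∑ r, κ i r = 1) (hκ' : ∀ i, ∑ r, κ' i r = 1)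
    (hT : ∀ i ∈ T, κ i = κ' i) (h : (Fin n → R) → ℝ)
    (hh : ∀ r r', (∀ i ∈ T, r i = r' i) → h r = h r') :
    ∑ r, (∏ i, κ i (r i)) * h r = ∑ r, (∏ i, κ' i (r i)) * h r := by
  classical
  rcases isEmpty_or_nonempty R with hR | ⟨⟨r₀⟩⟩
  · rcases Nat.eq_zero_or_pos n with rfl | hn
    · simp
    · have := hκ ⟨0, hn⟩
      simp at this
  obtain ⟨p, hp⟩ : ∃ p : Fin n → Prop, ∀ i, p i ↔ i ∈ T := ⟨fun i => i ∈ T, fun _ => Iff.rfl⟩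
  let e := Equiv.piEquivPiSubtypeProd p fun _ => R
  -- Coordinates outside `T` do not enter `h` and sum to one, so they may be frozen at an arbitrary
  -- `r₀`.
  have key : ∀ μ : Fin n → R → ℝ, (∀ i, ∑ r, μ i r = 1) →
      ∑ r, (∏ i, μ i (r i)) * h r =
        ∑ y : {i // p i} → R, (∏ i : {i // p i}, μ i (y i)) * h (e.symm (y, fun _ => r₀)) := by
    intro μ hμ
    rw [← e.symm.sum_comp, Fintype.sum_prod_type]
    refine Finset.sum_congr rfl fun y _ => ?_
    have h1 : ∀ z : {i // ¬p i} → R, (∏ i, μ i (e.symm (y, z) i)) * h (e.symm (y, z)) =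
        ((∏ i : {i // p i}, μ i (y i)) * h (e.symm (y, fun _ => r₀))) *
          ∏ i : {i // ¬p i}, μ i (z i) := by
      intro z
      have h2 : h (e.symm (y, z)) = h (e.symm (y, fun _ => r₀)) := by
        refine hh _ _ fun i hi => ?_
        simp [e, Equiv.piEquivPiSubtypeProd, (hp i).2 hi]
      rw [h2, ← Fintype.prod_subtype_mul_prod_subtype p]
      have h3 : ∀ i : {i // p i}, e.symm (y, z) i = y i := fun i => by
        simp [e, Equiv.piEquivPiSubtypeProd, i.2]
      have h4 : ∀ i : {i // ¬p i}, e.symm (y, z) i = z i := fun i => by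
        simp [e, Equiv.piEquivPiSubtypeProd, i.2]
      simp only [h3, h4]
      ring
    simp only [h1, ← Finset.mul_sum]
    rw [← Fintype.prod_sum fun (i : {i // ¬p i}) r => μ i r]
    simp [hμ]
  rw [key κ hκ, key κ' hκ']
  refine Finset.sum_congr rfl fun y _ => ?_
  congr 1
  exact Finset.prod_congr rfl fun i _ => by rw [hT i ((hp i).1 i.2)]

/-- Let the first message consist of commitments to the `v i`, and let a bounded function of the
commitments and openings be a sum of functions that depend on at most `t` openings each. If any
`t` of the `v i` have the same joint distribution in two experiments, then the averages in the two
experiments are close. -/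
theorem abs_uavg_commit_sub_le {Ω V K R J : Type} [Fintype Ω] [Nonempty Ω] [Fintype K] [Fintype R]
    [Nonempty R] [Fintype J] {n t : ℕ} (com : V → R → K) (v₀ : V) {δ : ℝ}
    (hδ : ∀ v, statDist ((PMF.uniformOfFintype R).map (com v))
      ((PMF.uniformOfFintype R).map (com v₀)) ≤ δ)
    (v v' : Ω → Fin n → V)
    (hpriv : ∀ T : Finset (Fin n), T.card ≤ t → ∀ φ : (Fin n → V) → ℝ,
      (∀ u u', (∀ i ∈ T, u i = u' i) → φ u = φ u') →
      (uavg fun ω => φ (v ω)) = uavg fun ω => φ (v' ω))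
    (G : (Fin n → K) → (Fin n → V) → (Fin n → R) → ℝ) (hG : ∀ c u r, |G c u r| ≤ 1)
    (h : J → (Fin n → K) → (Fin n → V) → (Fin n → R) → ℝ) (hsum : ∀ c u r, G c u r = ∑ j, h j c u r)
    (T : J → Finset (Fin n)) (hT : ∀ j, (T j).card ≤ t)
    (hloc : ∀ j c u u' r r', (∀ i ∈ T j, u i = u' i ∧ r i = r' i) → h j c u r = h j c u' r') :
    |(uavg fun ω => uavg fun r : Fin n → R => G (fun i => com (v ω i) (r i)) (v ω) r) -
      uavg fun ω => uavg fun r : Fin n → R => G (fun i => com (v' ω i) (r i)) (v' ω) r| ≤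
      4 * n * δ := by
  -- In the ideal experiment the commitments do not depend on the views `u`; these enter only
  -- through the resampled coins and through `G`. Passing to it costs `2 * n * δ` on either side.
  let ideal : (Fin n → V) → ℝ := fun u => ∑ c : Fin n → K, (∏ i, comProb com v₀ (c i)) *
        ∑ r : Fin n → R, (∏ i, condCoin com (u i) (c i) (r i)) * G c u r
  have hstep : ∀ w : Ω → Fin n → V,
      |(uavg fun ω => uavg fun r : Fin n → R => G (fun i => com (w ω i) (r i)) (w ω) r) -
        uavg fun ω => ideal (w ω)| ≤ 2 * n * δ := by
    intro w
    refine (abs_uavg_sub_le (h := fun _ => 2 * n * δ) fun ω => ?_).trans_eq (uavg_const _)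
    exact abs_uavg_commit_sub_resample_le com (w ω) v₀ hδ (fun c r => G c (w ω) r)
      fun c r => hG _ _ _
  -- For fixed commitments `c` and a fixed term `j`, the ideal value depends only on the views in `T
  -- j`. Thus `hpriv` gives exact equality, and the number of terms does not matter.
  have hideal : (uavg fun ω => ideal (v ω)) = uavg fun ω => ideal (v' ω) := by
    have hexp : ∀ u, ideal u = ∑ c : Fin n → K, ∑ j, (∏ i, comProb com v₀ (c i)) *
        ∑ r : Fin n → R, (∏ i, condCoin com (u i) (c i) (r i)) * h j c u r := by
      intro u
      refine Finset.sum_congr rfl fun c _ => ?_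
      simp only [hsum, Finset.mul_sum]
      rw [Finset.sum_comm]
    simp only [hexp, uavg_sum, uavg_const_mul]
    refine Finset.sum_congr rfl fun c _ => Finset.sum_congr rfl fun j _ => ?_
    congr 1
    simp only [← uavg_sum]
    refine hpriv (T j) (hT j)
      (fun u => ∑ r : Fin n → R, (∏ i, condCoin com (u i) (c i) (r i)) * h j c u r) ?_
    intro u u' huu'
    have h1 : ∀ r, h j c u' r = h j c u r := fun r =>
      hloc j c u' u r r fun i hi => ⟨(huu' i hi).symm, rfl⟩
    simp only [h1]
    exact sum_prod_mul_congr (T j) _ _ (fun i => sum_condCoin com _ _)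
      (fun i => sum_condCoin com _ _) (fun i hi => by rw [huu' i hi]) _
      fun r r' hr => hloc j c u u r r' fun i hi => ⟨rfl, hr i hi⟩
  have h1 := abs_sub_le_iff.1 (hstep v)
  have h2 := abs_sub_le_iff.1 (hstep v')
  rw [abs_sub_le_iff]
  constructor <;> linarith [h1.1, h1.2, h2.1, h2.2]

/-! ## Classical straight-line programs -/

/-- A classical gate: it adds `a ∧ b` (negated if `inv`) to the wire `t`. -/
structure CGate (T : Type) where
  inv : Bool
  a : T
  b : T
  t : T

namespace CGate

variable {T T' : Type}

open Classical in
noncomputable def exec (g : CGate T) (m : Bits T) : Bits T :=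
  Function.update m g.t (xor (m g.t) (xor g.inv (m g.a && m g.b)))

def map (φ : T → T') (g : CGate T) : CGate T' := ⟨g.inv, φ g.a, φ g.b, φ g.t⟩

/-- The gate does not read the wire that it changes. -/
def Valid (g : CGate T) : Prop := g.a ≠ g.t ∧ g.b ≠ g.t

theorem exec_self (g : CGate T) (m : Bits T) :
    g.exec m g.t = xor (m g.t) (xor g.inv (m g.a && m g.b)) := by
  simp [exec]

theorem exec_of_ne (g : CGate T) (m : Bits T) {y : T} (h : y ≠ g.t) : g.exec m y = m y := by
  simp [exec, h]

theorem exec_mk_self (inv : Bool) (a b t : T) (m : Bits T) :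
    (CGate.mk inv a b t).exec m t = xor (m t) (xor inv (m a && m b)) :=
  exec_self _ _

theorem exec_exec (g : CGate T) (hg : g.Valid) (m : Bits T) : g.exec (g.exec m) = m := by
  funext y
  by_cases hy : y = g.t
  · subst hy
    rw [exec_self, exec_self, exec_of_ne g m hg.1, exec_of_ne g m hg.2]
    simp
  · rw [exec_of_ne _ _ hy, exec_of_ne _ _ hy]

/-- The relabelling may merge wires that are only read; it suffices that no other wire is sent to
the image of the target. -/
theorem map_exec_comp (φ : T → T') (g : CGate T) (hφ : ∀ x, φ x = φ g.t → x = g.t)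
    (m : Bits T') : (g.map φ).exec m ∘ φ = g.exec (m ∘ φ) := by
  funext y
  by_cases hy : y = g.t
  · subst hy
    rw [exec_self]
    exact exec_self (g.map φ) m
  · rw [exec_of_ne _ _ hy]
    exact exec_of_ne (g.map φ) m fun h => hy (hφ y h)

/-- Run a list of gates. -/
noncomputable def execList (P : List (CGate T)) (m : Bits T) : Bits T := P.foldl (fun m g => g.exec m) m

theorem execList_append (P Q : List (CGate T)) (m : Bits T) :
    execList (P ++ Q) m = execList Q (execList P m) :=
  List.foldl_append

theorem execList_nil (m : Bits T) : execList [] m = m := rfl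

theorem execList_cons (g : CGate T) (P : List (CGate T)) (m : Bits T) :
    execList (g :: P) m = execList P (g.exec m) := rfl

theorem execList_of_forall_ne (P : List (CGate T)) (m : Bits T) {y : T} (h : ∀ g ∈ P, y ≠ g.t) :
    execList P m y = m y := by
  induction P generalizing m with
  | nil => rfl
  | cons g P ih =>
    rw [execList_cons, ih _ fun g' hg' => h g' (List.mem_cons_of_mem _ hg'),
      exec_of_ne _ _ (h g List.mem_cons_self)]

theorem execList_map_comp (φ : T → T') (P : List (CGate T))
    (hφ : ∀ g ∈ P, ∀ x, φ x = φ g.t → x = g.t) (m : Bits T') :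
    execList (P.map (map φ)) m ∘ φ = execList P (m ∘ φ) := by
  induction P generalizing m with
  | nil => rfl
  | cons g P ih =>
    rw [List.map_cons, execList_cons, execList_cons,
      ih fun g' hg' => hφ g' (List.mem_cons_of_mem _ hg'),
      map_exec_comp φ g (hφ g List.mem_cons_self)]

theorem execList_reverse (P : List (CGate T)) (hP : ∀ g ∈ P, g.Valid) (m : Bits T) :
    execList P.reverse (execList P m) = m := by
  induction P generalizing m with
  | nil => rfl
  | cons g P ih =>
    rw [List.reverse_cons, execList_append, execList_cons, execList_cons, execList_nil,
      ih fun g' hg' => hP g' (List.mem_cons_of_mem _ hg')]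
    exact g.exec_exec (hP g List.mem_cons_self) m

/-- Wires that a program does not use may be changed before or after it. -/
theorem execList_xor (P : List (CGate T)) (m d : Bits T)
    (hd : ∀ g ∈ P, d g.a = false ∧ d g.b = false ∧ d g.t = false) :
    execList P (fun y => xor (m y) (d y)) = fun y => xor (execList P m y) (d y) := by
  induction P generalizing m with
  | nil => rfl
  | cons g P ih =>
    obtain ⟨ha, hb, ht⟩ := hd g List.mem_cons_self
    rw [execList_cons, execList_cons, ← ih _ fun g' hg' => hd g' (List.mem_cons_of_mem _ hg')]
    congr 1
    funext y
    by_cases hy : y = g.t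
    · subst hy
      rw [exec_self, exec_self, ha, hb, ht]
      simp
    · rw [exec_of_ne _ _ hy, exec_of_ne _ _ hy]

end CGate

/-- The function `f` is computed by a straight-line program with at most `s` gates and `s`
auxiliary wires, which do not change the input. -/
def HasProgram {ι κ : Type} (s : ℕ) (f : Bits ι → Bits κ) : Prop :=
  ∃ (A : Type) (_ : Fintype A) (P : List (CGate (ι ⊕ A))) (out : κ → ι ⊕ A),
    Fintype.card A ≤ s ∧ P.length ≤ s ∧ (∀ g ∈ P, g.Valid ∧ ∃ t, g.t = Sum.inr t) ∧
    ∀ x o, CGate.execList P (Sum.elim x fun _ => false) (out o) = f x o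

namespace HasProgram

variable {ι κ μ : Type} {s s' : ℕ}

theorem mono {f : Bits ι → Bits κ} (h : HasProgram s f) (hs : s ≤ s') : HasProgram s' f := by
  obtain ⟨A, iA, P, out, h1, h2, h3⟩ := h
  exact ⟨A, iA, P, out, h1.trans hs, h2.trans hs, h3⟩

theorem congr {f g : Bits ι → Bits κ} (h : HasProgram s f) (hfg : ∀ x, f x = g x) :
    HasProgram s g := by
  rwa [← funext hfg]

theorem reindex {f : Bits ι → Bits κ} (h : HasProgram s f) (u : μ → κ) :
    HasProgram s fun x o => f x (u o) := by
  obtain ⟨A, iA, P, out, h1, h2, h3, h4⟩ := h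
  exact ⟨A, iA, P, out ∘ u, h1, h2, h3, fun x o => h4 x (u o)⟩

theorem comap {f : Bits κ → Bits μ} (h : HasProgram s f) (u : κ → ι) :
    HasProgram s fun x : Bits ι => f fun i => x (u i) := by
  obtain ⟨A, iA, P, out, h1, h2, h3, h4⟩ := h
  let φ : κ ⊕ A → ι ⊕ A := Sum.map u id
  have hφ : ∀ g ∈ P, ∀ x, φ x = φ g.t → x = g.t := by
    intro g hg x hx
    obtain ⟨-, t, ht⟩ := h3 g hg
    rw [ht] at hx ⊢
    cases x with
    | inl i => cases hx
    | inr i => cases hx; rfl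
  refine ⟨A, iA, P.map (CGate.map φ), φ ∘ out, h1, by simpa using h2, ?_, ?_⟩
  · intro g hg
    obtain ⟨g, hgP, rfl⟩ := List.mem_map.1 hg
    obtain ⟨⟨ha, hb⟩, t, ht⟩ := h3 g hgP
    exact ⟨⟨fun h => ha (hφ g hgP _ h), fun h => hb (hφ g hgP _ h)⟩, t, by
      simp [CGate.map, ht, φ]⟩
  · intro x o
    have h5 := congrFun (CGate.execList_map_comp φ P hφ (Sum.elim x fun _ => false)) (out o)
    have h6 : (Sum.elim x fun _ => false : Bits (ι ⊕ A)) ∘ φ =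
        Sum.elim (fun i => x (u i)) fun _ => false := by
      funext y
      cases y <;> rfl
    rw [h6, h4] at h5
    exact h5

/-- A program that uses the input, and the output of another program. -/
theorem bind {f : Bits ι → Bits κ} {g : Bits (ι ⊕ κ) → Bits μ} (hf : HasProgram s f)
    (hg : HasProgram s' g) :
    HasProgram (s + s') fun x => Sum.elim (f x) (g (Sum.elim x (f x))) := by
  obtain ⟨A, iA, P, out, h1, h2, h3, h4⟩ := hf
  obtain ⟨B, iB, Q, out', k1, k2, k3, k4⟩ := hg
  let φ : ι ⊕ A → ι ⊕ (A ⊕ B) := Sum.map id Sum.inl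
  -- The second program reads the output wires of the first in place. The map need not be injective,
  -- since several outputs may share a wire, but it is faithful on the targets in `B`.
  let ψ : (ι ⊕ κ) ⊕ B → ι ⊕ (A ⊕ B) :=
    Sum.elim (Sum.elim Sum.inl (φ ∘ out)) (Sum.inr ∘ Sum.inr)
  have hφi : Function.Injective φ := Function.Injective.sumMap Function.injective_id
    Sum.inl_injective
  have hφB : ∀ y b, φ y ≠ Sum.inr (Sum.inr b) := by
    rintro (y | y) b h <;> cases h
  have hψ : ∀ g ∈ Q, ∀ x, ψ x = ψ g.t → x = g.t := by
    intro g hg x hx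
    obtain ⟨-, t, ht⟩ := k3 g hg
    rw [ht] at hx ⊢
    rcases x with (i | o) | b
    · cases hx
    · exact absurd hx (hφB _ _)
    · cases hx; rfl
  refine ⟨A ⊕ B, inferInstance, P.map (CGate.map φ) ++ Q.map (CGate.map ψ),
    Sum.elim (φ ∘ out) (ψ ∘ out'), ?_, ?_, ?_, ?_⟩
  · rw [Fintype.card_sum]; omega
  · rw [List.length_append, List.length_map, List.length_map]; omega
  · intro g hg
    rcases List.mem_append.1 hg with hg | hg
    · obtain ⟨g, hgP, rfl⟩ := List.mem_map.1 hg
      obtain ⟨⟨ha, hb⟩, t, ht⟩ := h3 g hgP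
      exact ⟨⟨fun h => ha (hφi h), fun h => hb (hφi h)⟩, Sum.inl t, by simp [CGate.map, ht, φ]⟩
    · obtain ⟨g, hgP, rfl⟩ := List.mem_map.1 hg
      obtain ⟨⟨ha, hb⟩, t, ht⟩ := k3 g hgP
      exact ⟨⟨fun h => ha (hψ g hgP _ h), fun h => hb (hψ g hgP _ h)⟩, Sum.inr t, by
        simp [CGate.map, ht, ψ]⟩
  · intro x
    rw [CGate.execList_append]
    set m₁ := CGate.execList (P.map (CGate.map φ)) (Sum.elim x fun _ => false) with hm₁
    have e1 : ∀ y, m₁ (φ y) = CGate.execList P (Sum.elim x fun _ => false) y := by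
      intro y
      have h5 := congrFun (CGate.execList_map_comp φ P (fun _ _ _ h => hφi h)
        (Sum.elim x fun _ => false)) y
      have h6 : (Sum.elim x fun _ => false : Bits (ι ⊕ (A ⊕ B))) ∘ φ =
          Sum.elim x fun _ => false := by
        funext y
        cases y <;> rfl
      rw [h6] at h5
      exact h5
    have e2 : ∀ b, m₁ (Sum.inr (Sum.inr b)) = false := by
      intro b
      refine CGate.execList_of_forall_ne _ _ fun g hg => ?_
      obtain ⟨g, -, rfl⟩ := List.mem_map.1 hg
      exact (hφB _ _).symm
    have e3 : ∀ i, m₁ (Sum.inl i) = x i := by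
      intro i
      refine CGate.execList_of_forall_ne _ _ fun g hg => ?_
      obtain ⟨g, hgP, rfl⟩ := List.mem_map.1 hg
      obtain ⟨-, t, ht⟩ := h3 g hgP
      simp [CGate.map, ht, φ]
    -- Seen through `ψ`, the memory left by the first program is a correct initial memory for the
    -- second: unchanged input, computed values, clean auxiliary wires.
    have e4 : m₁ ∘ ψ = Sum.elim (Sum.elim x (f x)) fun _ => false := by
      funext y
      rcases y with (i | o) | b
      · exact e3 i
      · exact (e1 (out o)).trans (h4 x o)
      · exact e2 b
    have e5 := CGate.execList_map_comp ψ Q hψ m₁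
    rw [e4] at e5
    rintro (o | o)
    · refine (CGate.execList_of_forall_ne _ _ fun g hg => ?_).trans ((e1 (out o)).trans (h4 x o))
      obtain ⟨g, hgP, rfl⟩ := List.mem_map.1 hg
      obtain ⟨-, t, ht⟩ := k3 g hgP
      simp only [CGate.map, ht]
      exact hφB _ _
    · exact (congrFun e5 (out' o)).trans (k4 _ o)

theorem proj (u : κ → ι) : HasProgram 0 fun (x : Bits ι) o => x (u o) :=
  ⟨Empty, inferInstance, [], fun o => Sum.inl (u o), by simp, by simp, by simp, fun _ _ => rfl⟩

theorem const (c : Bits κ) : HasProgram 2 fun _ : Bits ι => c := by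
  -- Wire `false` stays `0`, and the negated conjunction of this wire with itself sets wire `true`
  -- to `1`; each output refers to one of the two.
  refine ⟨Bool, inferInstance, [⟨true, .inr false, .inr false, .inr true⟩],
    fun o => .inr (c o), by simp, by simp, ?_, ?_⟩
  · intro g hg
    rw [List.mem_singleton] at hg
    subst hg
    simp [CGate.Valid]
  · intro x o
    rw [CGate.execList_cons, CGate.execList_nil]
    cases h : c o
    · rw [CGate.exec_of_ne _ _ (by simp [h])]
      exact h.symm
    · simp only [h]
      exact CGate.exec_mk_self _ _ _ _ _

theorem gate (inv : Bool) (i j : ι) :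
    HasProgram 1 fun (x : Bits ι) (_ : Unit) => xor inv (x i && x j) := by
  refine ⟨Unit, inferInstance, [⟨inv, .inl i, .inl j, .inr ()⟩],
    fun o => .inr o, by simp, by simp, ?_, ?_⟩
  · intro g hg
    rw [List.mem_singleton] at hg
    subst hg
    simp [CGate.Valid]
  · intro x o
    rw [CGate.execList_cons, CGate.execList_nil]
    refine (CGate.exec_mk_self _ _ _ _ _).trans ?_
    simp

theorem xor_gate (i j : ι) : HasProgram 2 fun (x : Bits ι) (_ : Unit) => xor (x i) (x j) := by
  refine ⟨Unit, inferInstance, [⟨false, .inl i, .inl i, .inr ()⟩, ⟨false, .inl j, .inl j, .inr ()⟩],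
    fun o => .inr o, by simp, by simp, ?_, ?_⟩
  · intro g hg
    simp only [List.mem_cons, List.not_mem_nil, or_false] at hg
    rcases hg with rfl | rfl <;> simp [CGate.Valid]
  · intro x o
    rw [CGate.execList_cons, CGate.execList_cons, CGate.execList_nil]
    refine (CGate.exec_mk_self _ _ _ _ _).trans ?_
    rw [CGate.exec_mk_self, CGate.exec_of_ne _ _ (by simp)]
    simp

theorem pair {f : Bits ι → Bits κ} {g : Bits ι → Bits μ} (hf : HasProgram s f)
    (hg : HasProgram s' g) : HasProgram (s + s') fun x => Sum.elim (f x) (g x) :=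
  hf.bind (hg.comap Sum.inl)

theorem comp {f : Bits ι → Bits κ} {g : Bits κ → Bits μ} (hg : HasProgram s' g)
    (hf : HasProgram s f) : HasProgram (s + s') fun x => g (f x) :=
  (hf.bind (hg.comap Sum.inr)).reindex Sum.inr

/-- Several programs with the same input. -/
theorem pi {J : Type} [Fintype J] {κ : J → Type} {f : ∀ j, Bits ι → Bits (κ j)}
    (h : ∀ j, HasProgram s (f j)) :
    HasProgram (2 + Fintype.card J * s) fun x (q : Σ j, κ j) => f q.1 x q.2 := by
  classical
  have key : ∀ S : Finset J, HasProgram (2 + S.card * s)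
      fun x (q : Σ j, κ j) => if q.1 ∈ S then f q.1 x q.2 else false := by
    intro S
    induction S using Finset.induction_on with
    | empty => simpa using const (ι := ι) (κ := Σ j, κ j) fun _ => false
    | insert a S ha ih =>
      rw [Finset.card_insert_of_notMem ha]
      refine (((ih.pair (h a)).reindex fun q : Σ j, κ j =>
        if hq : q.1 = a then Sum.inr (hq ▸ q.2) else Sum.inl q).mono ?_).congr ?_
      · rw [Nat.add_mul, Nat.one_mul, Nat.add_assoc]
      · intro x
        funext ⟨j, o⟩
        by_cases hj : j = a
        · subst hj
          simp
        · simp [hj]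
  exact (key Finset.univ).congr fun x => by simp

/-- Both branches are computed, and each output bit is selected by `b ⊕ (c ∧ (a ⊕ b))`, which takes
five gates. -/
theorem ite {f g : Bits ι → Bits κ} [Fintype κ] (c : ι) (hf : HasProgram s f)
    (hg : HasProgram s' g) :
    HasProgram (s + s' + (2 + Fintype.card κ * 5)) fun x => if x c = true then f x else g x := by
  have hmux : ∀ a b c : ι ⊕ (κ ⊕ κ), HasProgram 5 fun (x : Bits (ι ⊕ (κ ⊕ κ))) (_ : Unit) =>
      if x c = true then x a else x b := by
    intro a b c
    have h1 := xor_gate a b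
    have h2 : HasProgram 1 _ := gate (ι := (ι ⊕ (κ ⊕ κ)) ⊕ Unit) false (.inl c) (.inr ())
    have h3 : HasProgram 2 _ :=
      xor_gate (ι := ((ι ⊕ (κ ⊕ κ)) ⊕ (Unit ⊕ Unit))) (.inl b) (.inr (.inr ()))
    refine ((((h1.bind h2).bind h3).reindex Sum.inr).mono (by norm_num)).congr fun x => ?_
    funext o
    simp only [Sum.elim_inl, Sum.elim_inr]
    cases x a <;> cases x b <;> cases x c <;> rfl
  have hall : HasProgram (2 + Fintype.card κ * 5) fun (x : Bits (ι ⊕ (κ ⊕ κ))) (q : Σ _ : κ, Unit) =>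
      if x (.inl c) = true then x (.inr (.inl q.1)) else x (.inr (.inr q.1)) :=
    pi fun o : κ => hmux (.inr (.inl o)) (.inr (.inr o)) (.inl c)
  refine (((hf.pair hg).bind hall).reindex fun o => Sum.inr ⟨o, ()⟩).congr fun x => ?_
  funext o
  by_cases hc : x c = true <;> simp [hc]

end HasProgram

/-! ## From Boolean circuits to programs -/

theorem BoolCircuit.length_gateVals {ι : Type} (gs : List ((ι ⊕ ℕ) × (ι ⊕ ℕ))) (x : Bits ι) :
    (gateVals gs x).length = gs.length := by
  induction gs using List.reverseRecOn with
  | nil => rfl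
  | append_singleton gs g ih =>
    unfold gateVals at ih ⊢
    rw [List.foldl_append]
    simpa using ih

/-- Outputs are indexed by all of `ℕ`, so that a reference to a gate not yet computed reads a
constant `0` wire, in agreement with the default in `wire`. -/
theorem BoolCircuit.hasProgram_gateVals {ι : Type} (gs : List ((ι ⊕ ℕ) × (ι ⊕ ℕ))) :
    HasProgram (2 + gs.length) fun (x : Bits ι) (q : ℕ) => (gateVals gs x).getD q false := by
  induction gs using List.reverseRecOn with
  | nil =>
    refine (HasProgram.const (ι := ι) (κ := ℕ) fun _ => false).congr fun x => ?_
    funext q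
    simp [gateVals]
  | append_singleton gs g ih =>
    have h := (ih.bind (HasProgram.gate (ι := ι ⊕ ℕ) true g.1 g.2)).reindex fun q : ℕ =>
      if q = gs.length then Sum.inr () else Sum.inl q
    refine (h.mono ?_).congr fun x => ?_
    · rw [List.length_append, List.length_singleton, Nat.add_assoc]
    · funext q
      have hv : gateVals (gs ++ [g]) x = gateVals gs x ++
          [!(wire x (gateVals gs x) g.1 && wire x (gateVals gs x) g.2)] := by
        simp only [gateVals, List.foldl_append, List.foldl_cons, List.foldl_nil]
      have hw : ∀ w : ι ⊕ ℕ, (Sum.elim x (fun q => (gateVals gs x).getD q false) :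
          Bits (ι ⊕ ℕ)) w = wire x (gateVals gs x) w := by
        rintro (i | i) <;> rfl
      rw [hv]
      simp only [hw]
      have hl := length_gateVals gs x
      by_cases hq : q = gs.length
      · subst hq
        rw [if_pos rfl, ← hl]
        simp
      · rw [if_neg hq]
        simp only [Sum.elim_inl]
        rcases lt_or_gt_of_ne hq with h | h
        · rw [List.getD_append _ _ _ _ (by omega)]
        · rw [List.getD_append_right _ _ _ _ (by omega), List.getD_eq_default _ _ (by omega),
            List.getD_eq_default _ _ (by simp; omega)]

theorem BoolCircuit.hasProgram_eval {ι κ : Type} (D : BoolCircuit ι κ) :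
    HasProgram (2 + D.gates.length) D.eval := by
  have h := (HasProgram.proj (id : ι → ι)).pair (hasProgram_gateVals D.gates)
  refine ((h.mono (by omega)).reindex D.out).congr fun x => ?_
  funext o
  unfold eval
  cases D.out o <;> rfl

theorem PolySizeComputable.exists_hasProgram {ι κ : ℕ → Type} [∀ k, Fintype (ι k)]
    [∀ k, Fintype (κ k)] {f : ∀ k, Bits (ι k) → Bits (κ k)} (h : PolySizeComputable f) :
    ∃ s : ℕ → ℕ, PolyBounded s ∧ ∀ k, HasProgram (s k) (f k) := by
  obtain ⟨p, hp⟩ := h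
  refine ⟨fun k => 2 + p.eval k, (polyBounded_const 2).add (polyBounded_eval p), fun k => ?_⟩
  obtain ⟨D, hD, hDf⟩ := hp k
  refine (D.hasProgram_eval.mono ?_).congr hDf
  unfold BoolCircuit.size at hD
  dsimp only
  omega

/-! ## Quantum circuits for classical functions -/

/-- The Pauli `X` gate. -/
def pauliX : Matrix.unitaryGroup Bool ℂ :=
  ⟨Matrix.of fun i j => if i = j then 0 else 1, by
    rw [Matrix.mem_unitaryGroup_iff]
    ext i j
    cases i <;> cases j <;> simp [Matrix.mul_apply, Matrix.star_apply]⟩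

namespace CGate

variable {T : Type}

open Classical in
/-- The quantum circuit for a classical gate. -/
noncomputable def toQ (g : CGate T) : QCircuit T :=
  if h : g.Valid then
    .toffoli g.a g.b g.t h.1 h.2 :: if g.inv then [.single g.t pauliX] else []
  else []

open Classical in
theorem pauliX_apply (t : T) (ψ : QState T) (b : Bits T) :
    (QGate.single t pauliX).apply ψ b = ψ (Function.update b t (!b t)) := by
  simp only [QGate.apply, Fintype.sum_bool, pauliX]
  cases b t <;> simp

theorem run_toQ (g : CGate T) (hg : g.Valid) (ψ : QState T) :
    g.toQ.run ψ = fun b => ψ (g.exec b) := by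
  classical
  funext b
  unfold toQ
  rw [dif_pos hg]
  cases hinv : g.inv
  · simp only [Bool.false_eq_true, if_false, QCircuit.run_cons, QCircuit.run_nil, QGate.apply]
    congr 1
    simp only [exec, hinv, Bool.false_xor]
  · simp only [if_true, QCircuit.run_cons, QCircuit.run_nil]
    rw [pauliX_apply]
    simp only [QGate.apply]
    congr 1
    funext y
    by_cases hy : y = g.t
    · subst hy
      simp only [Function.update_self, exec, hinv, Function.update_of_ne hg.1,
        Function.update_of_ne hg.2]
      cases b g.t <;> cases b g.a <;> cases b g.b <;> rfl
    · simp [exec, hy]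

theorem length_toQ_le (g : CGate T) : g.toQ.length ≤ 2 := by
  unfold toQ
  split_ifs <;> simp

/-- The quantum circuit for a list of classical gates. -/
noncomputable def listToQ (P : List (CGate T)) : QCircuit T := P.flatMap toQ

/-- States are functions on basis strings, so a circuit acts by precomposition with the inverse map;
as valid gates are involutions, this reverses the program. -/
theorem run_listToQ (P : List (CGate T)) (hP : ∀ g ∈ P, g.Valid) (ψ : QState T) :
    (listToQ P).run ψ = fun b => ψ (execList P.reverse b) := by
  induction P generalizing ψ with
  | nil => rfl
  | cons g P ih =>
    have e : listToQ (g :: P) = g.toQ ++ listToQ P := List.flatMap_cons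
    rw [e, QCircuit.run_append, g.run_toQ (hP g List.mem_cons_self),
      ih fun g' hg' => hP g' (List.mem_cons_of_mem _ hg')]
    funext b
    rw [List.reverse_cons, execList_append]
    rfl

theorem length_listToQ_le (P : List (CGate T)) : (listToQ P).length ≤ 2 * P.length := by
  induction P with
  | nil => simp [listToQ]
  | cons g P ih =>
    have e : listToQ (g :: P) = g.toQ ++ listToQ P := List.flatMap_cons
    rw [e, List.length_append, List.length_cons]
    have := g.length_toQ_le
    omega

end CGate

/-- The circuit `O` adds the value of the function `f` at the wires `u` to the wires `v`, if the
auxiliary wires `w` are zero; it performs an involution `σ` of the computational basis. -/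
structure IsXorOracle {T ι κ A : Type} (O : QCircuit T) (σ : Bits T → Bits T) (u : ι → T)
    (v : κ → T) (w : A → T) (f : Bits ι → Bits κ) : Prop where
  run : ∀ ψ, O.run ψ = fun b => ψ (σ b)
  involutive : Function.Involutive σ
  frame : ∀ b y, (∀ o, y ≠ v o) → σ b y = b y
  value : ∀ b, (∀ a, b (w a) = false) → ∀ o, σ b (v o) = xor (b (v o)) (f (fun i => b (u i)) o)

/-- No source is a target, so the order of the copies is irrelevant; without duplicates every target
is changed once. -/
theorem CGate.execList_copy {T κ : Type} (src v : κ → T) (hv : Function.Injective v)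
    (hsrc : ∀ o o', src o ≠ v o') (l : List κ) (hl : l.Nodup) (hmem : ∀ o, o ∈ l) (m : Bits T) :
    execList (l.map fun o => ⟨false, src o, src o, v o⟩) m =
      fun y => xor (m y) (Function.extend v (fun o => m (src o)) (fun _ => false) y) := by
  funext y
  by_cases hy : ∃ o, v o = y
  · obtain ⟨o, rfl⟩ := hy
    rw [hv.extend_apply]
    obtain ⟨l₁, l₂, rfl⟩ := List.append_of_mem (hmem o)
    have h1 : o ∉ l₁ := fun h => by
      rw [List.nodup_append] at hl
      exact hl.2.2 o h o List.mem_cons_self rfl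
    have h2 : o ∉ l₂ := fun h => by
      rw [List.nodup_append, List.nodup_cons] at hl
      exact hl.2.1.1 h
    rw [List.map_append, List.map_cons, execList_append, execList_cons, execList_of_forall_ne,
      exec_mk_self, execList_of_forall_ne, execList_of_forall_ne]
    · simp
    · intro g hg
      obtain ⟨o', -, rfl⟩ := List.mem_map.1 hg
      exact hsrc o o'
    · intro g hg
      obtain ⟨o', ho', rfl⟩ := List.mem_map.1 hg
      exact fun h => h1 (hv h ▸ ho')
    · intro g hg
      obtain ⟨o', ho', rfl⟩ := List.mem_map.1 hg
      exact fun h => h2 (hv h ▸ ho')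
  · rw [Function.extend_apply' _ _ _ hy, Bool.xor_false]
    refine execList_of_forall_ne _ _ fun g hg => ?_
    obtain ⟨o', -, rfl⟩ := List.mem_map.1 hg
    exact fun h => hy ⟨o', h.symm⟩

/-- Every program can be run as a quantum circuit which cleans up its auxiliary wires. -/
theorem HasProgram.exists_oracle {ι κ : Type} [Fintype κ] {s : ℕ} {f : Bits ι → Bits κ}
    (h : HasProgram s f) : ∃ (A : Type) (_ : Fintype A), Fintype.card A ≤ s ∧
      ∀ {T : Type} (u : ι → T) (v : κ → T) (w : A → T), Function.Injective v →
        Function.Injective w → (∀ i o, u i ≠ v o) → (∀ i a, u i ≠ w a) → (∀ a o, w a ≠ v o) →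
        ∃ (O : QCircuit T) (σ : Bits T → Bits T),
          O.length ≤ 4 * s + 2 * Fintype.card κ ∧ IsXorOracle O σ u v w f := by
  obtain ⟨A, iA, P, out, h1, h2, h3, h4⟩ := h
  refine ⟨A, iA, h1, fun {T} u v w hv hw huv huw hwv => ?_⟩
  let φ : ι ⊕ A → T := Sum.elim u w
  have hφ : ∀ g ∈ P, ∀ x, φ x = φ g.t → x = g.t := by
    intro g hg x hx
    obtain ⟨-, t, ht⟩ := h3 g hg
    rw [ht] at hx ⊢
    cases x with
    | inl i => exact absurd hx (huw i t)
    | inr a => exact congrArg Sum.inr (hw hx)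
  have hφv : ∀ y o, φ y ≠ v o := by
    rintro (i | a) o
    · exact huv i o
    · exact hwv a o
  let P' := P.map (CGate.map φ)
  have hP' : ∀ g ∈ P', g.Valid := by
    intro g hg
    obtain ⟨g, hgP, rfl⟩ := List.mem_map.1 hg
    obtain ⟨⟨ha, hb⟩, -⟩ := h3 g hgP
    exact ⟨fun h => ha (hφ g hgP _ h), fun h => hb (hφ g hgP _ h)⟩
  have hP'v : ∀ g ∈ P', ∀ o, g.a ≠ v o ∧ g.b ≠ v o ∧ g.t ≠ v o := by
    intro g hg o
    obtain ⟨g, hgP, rfl⟩ := List.mem_map.1 hg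
    exact ⟨hφv _ _, hφv _ _, hφv _ _⟩
  let copy : κ → CGate T := fun o => ⟨false, φ (out o), φ (out o), v o⟩
  let l : List κ := Finset.univ.toList
  -- Compute, copy, uncompute. The reversed list has the same shape, so the map given by
  -- `run_listToQ` is again of this form.
  let Q := P' ++ (l.map copy ++ P'.reverse)
  have hQ : ∀ g ∈ Q, g.Valid := by
    intro g hg
    simp only [Q, List.mem_append, List.mem_reverse] at hg
    rcases hg with hg | hg | hg
    · exact hP' g hg
    · obtain ⟨o, -, rfl⟩ := List.mem_map.1 hg
      exact ⟨hφv _ _, hφv _ _⟩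
    · exact hP' g hg
  let d : Bits T → Bits T := fun b =>
    Function.extend v (fun o => CGate.execList P' b (φ (out o))) fun _ => false
  have hd0 : ∀ b y, (∀ o, y ≠ v o) → d b y = false := fun b y hy =>
    Function.extend_apply' _ _ _ fun ⟨o, ho⟩ => hy o ho.symm
  have hdP : ∀ b, ∀ g ∈ P', d b g.a = false ∧ d b g.b = false ∧ d b g.t = false := fun b g hg =>
    ⟨hd0 b _ fun o => (hP'v g hg o).1, hd0 b _ fun o => (hP'v g hg o).2.1,
      hd0 b _ fun o => (hP'v g hg o).2.2⟩
  have hσ : ∀ b, CGate.execList Q.reverse b = fun y => xor (b y) (d b y) := by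
    intro b
    have e : Q.reverse = P' ++ (l.reverse.map copy ++ P'.reverse) := by
      simp [Q]
    rw [e, CGate.execList_append, CGate.execList_append,
      CGate.execList_copy (fun o => φ (out o)) v hv (fun o o' => hφv _ _) l.reverse
        (List.nodup_reverse.2 (Finset.nodup_toList _)) (fun o => by simp [l])]
    rw [CGate.execList_xor P'.reverse (CGate.execList P' b) (d b)
      fun g hg => hdP b g (List.mem_reverse.1 hg), CGate.execList_reverse P' hP']
  refine ⟨CGate.listToQ Q, CGate.execList Q.reverse, ?_, CGate.run_listToQ Q hQ, ?_, ?_, ?_⟩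
  · refine (CGate.length_listToQ_le Q).trans ?_
    have : Q.length = P.length + (Fintype.card κ + P.length) := by
      simp [Q, P', l]
    omega
  · intro b
    -- The program never touches the wires `v`, so the string to be added is unaffected by the
    -- addition. This yields an involution even when the auxiliary wires are dirty.
    have e : d (fun y => xor (b y) (d b y)) = d b := by
      have h5 : (fun o => CGate.execList P' (fun y => xor (b y) (d b y)) (φ (out o))) =
          fun o => CGate.execList P' b (φ (out o)) := by
        funext o
        rw [CGate.execList_xor P' b (d b) (hdP b)]
        dsimp only
        rw [hd0 b _ fun o' => hφv _ o', Bool.xor_false]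
      change Function.extend v _ _ = Function.extend v _ _
      rw [h5]
    rw [hσ, hσ, e]
    funext y
    simp
  · intro b y hy
    rw [hσ]
    dsimp only
    rw [hd0 b y hy, Bool.xor_false]
  · intro b hb o
    rw [hσ]
    change xor (b (v o)) (Function.extend v _ _ (v o)) = _
    rw [hv.extend_apply]
    have h5 := congrFun (CGate.execList_map_comp φ P hφ b) (out o)
    have h6 : b ∘ φ = Sum.elim (fun i => b (u i)) fun _ => false := by
      funext y
      cases y with
      | inl i => rfl
      | inr a => exact hb a
    rw [h6, h4] at h5
    exact congrArg _ h5

namespace IsXorOracle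

variable {T ι κ A : Type} {O : QCircuit T} {σ : Bits T → Bits T} {u : ι → T}
    {v : κ → T} {w : A → T} {f : Bits ι → Bits κ}

theorem run_ket (h : IsXorOracle O σ u v w f) (b : Bits T) : O.run (ket b) = ket (σ b) := by
  rw [h.run]
  funext b'
  unfold ket
  congr 1
  rw [← h.involutive.eq_iff, eq_iff_iff]

end IsXorOracle

/-! ## Answering a query with a quantum circuit -/

/-- The position of the registers `S` and of the query registers. -/
def queryEmb (S C E Z : Type) (a : ℕ) : S ⊕ (E ⊕ Z) ↪ S ⊕ VReg C E Z a :=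
  Function.Embedding.sumMap (Function.Embedding.refl _)
    (Function.Embedding.inl.trans Function.Embedding.inr)

/-- The circuit `O` answers the query with the function `resp tab`, where `tab` is read from the
register `S`; it uses auxiliary wires `w` in this register. -/
structure IsAnswer {S Tab E Z A : Type} (O : QCircuit (S ⊕ (E ⊕ Z))) (tab : Tab → S) (w : A → S)
    (resp : Bits (Tab ⊕ E) → Bits Z) : Prop where
  slice_run : ∀ {C : Type} {a : ℕ} (ψ : QState (S ⊕ VReg C E Z a)) (s : Bits S),
    (∀ i, s (w i) = false) → slice ((O.embed (queryEmb S C E Z a)).run ψ) s =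
      runInSuperposition (fun e => resp (Sum.elim (fun i => s (tab i)) e)) (slice ψ s)
  slice_zero : ∀ {C : Type} {a : ℕ} (ψ : QState (S ⊕ VReg C E Z a)) (s : Bits S),
    slice ψ s = 0 → slice ((O.embed (queryEmb S C E Z a)).run ψ) s = 0

/-- The oracle changes only the response register, so it preserves the content `s` of `S` and acts
on each slice separately. For a zero slice this needs no clean ancillas, hence the unconditional
second clause. -/
theorem IsXorOracle.isAnswer {S Tab E Z A : Type} {O : QCircuit (S ⊕ (E ⊕ Z))}
    {σ : Bits (S ⊕ (E ⊕ Z)) → Bits (S ⊕ (E ⊕ Z))} {tab : Tab → S} {w : A → S}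
    {resp : Bits (Tab ⊕ E) → Bits Z}
    (h : IsXorOracle O σ (Sum.elim (Sum.inl ∘ tab) (Sum.inr ∘ Sum.inl)) (Sum.inr ∘ Sum.inr)
      (Sum.inl ∘ w) resp) : IsAnswer O tab w resp := by
  have hrun : ∀ {C : Type} {a : ℕ} (ψ : QState (S ⊕ VReg C E Z a)) (s : Bits S)
      (v : Bits (VReg C E Z a)), slice ((O.embed (queryEmb S C E Z a)).run ψ) s v =
        ψ (Function.extend (queryEmb S C E Z a)
          (σ (Sum.elim s v ∘ queryEmb S C E Z a)) (Sum.elim s v)) := by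
    intro C a ψ s v
    unfold slice
    rw [QCircuit.embed_run, h.run]
  have hext : ∀ {C : Type} {a : ℕ} (s : Bits S) (v : Bits (VReg C E Z a)) (i : S),
      Function.extend (queryEmb S C E Z a)
          (σ (Sum.elim s v ∘ queryEmb S C E Z a)) (Sum.elim s v) (Sum.inl i) = s i := by
    intro C a s v i
    refine ((queryEmb S C E Z a).injective.extend_apply _ _ (Sum.inl i)).trans ?_
    exact h.frame _ _ fun o ho => by cases ho
  constructor
  · intro C a ψ s hs
    funext v
    rw [hrun]
    unfold runInSuperposition slice
    congr 1
    funext y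
    rcases y with i | (c | ((e | z) | j))
    · exact hext s v i
    · rw [Function.extend_apply' _ _ _ (by rintro ⟨(j | (j | j)), hj⟩ <;> cases hj)]
      rfl
    · refine ((queryEmb S C E Z a).injective.extend_apply _ _ (Sum.inr (Sum.inl e))).trans ?_
      exact h.frame _ _ fun o ho => by cases ho
    · refine ((queryEmb S C E Z a).injective.extend_apply _ _ (Sum.inr (Sum.inr z))).trans ?_
      refine (h.value _ hs z).trans ?_
      refine congrArg (fun g => xor (v (.inr (.inl (.inr z)))) (resp g z)) ?_
      funext q
      rcases q with q | q <;> rfl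
    · rw [Function.extend_apply' _ _ _ (by rintro ⟨(j | (j | j)), hj⟩ <;> cases hj)]
      rfl
  · intro C a ψ s hs
    funext v
    rw [hrun]
    set b := Function.extend (queryEmb S C E Z a)
          (σ (Sum.elim s v ∘ queryEmb S C E Z a)) (Sum.elim s v) with hb
    have : b = Sum.elim s fun y => b (Sum.inr y) := by
      funext y
      rcases y with i | y
      · exact hext s v i
      · rfl
    rw [this]
    exact congrFun hs _

theorem HasProgram.exists_answer {Tab E Z : Type} [Fintype Z] {s : ℕ}
    {resp : Bits (Tab ⊕ E) → Bits Z} (h : HasProgram s resp) :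
    ∃ (A : Type) (_ : Fintype A), Fintype.card A ≤ s ∧
      ∀ {S : Type} (tab : Tab → S) (w : A → S), Function.Injective w → (∀ i a, tab i ≠ w a) →
        ∃ O : QCircuit (S ⊕ (E ⊕ Z)), O.length ≤ 4 * s + 2 * Fintype.card Z ∧
          IsAnswer O tab w resp := by
  obtain ⟨A, iA, hA, H⟩ := h.exists_oracle
  refine ⟨A, iA, hA, fun {S} tab w hw htw => ?_⟩
  obtain ⟨O, σ, hO, h⟩ := H (T := S ⊕ (E ⊕ Z)) (Sum.elim (Sum.inl ∘ tab) (Sum.inr ∘ Sum.inl))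
    (Sum.inr ∘ Sum.inr) (Sum.inl ∘ w) (Sum.inr_injective.comp Sum.inr_injective)
    (Sum.inl_injective.comp hw) (by rintro (i | i) o h <;> cases h)
    (by
      rintro (i | i) a h
      · exact htw i a (Sum.inl_injective h)
      · cases h)
    (by intro a o h; cases h)
  exact ⟨O, hO, h.isAnswer⟩

theorem probOne_zero {V : Type} [Fintype V] (o : V) : probOne o (0 : QState V) = 0 := by
  simp [probOne]

/-- The output probability of a verifier that interacts with a register `S` whose content is
classical. -/
theorem probOne_interaction {S C Tab E Z A : Type} [Fintype S] [Fintype (Bits S)] [Fintype C] [Fintype E] [Fintype Z]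
    {O : QCircuit (S ⊕ (E ⊕ Z))} {tab : Tab → S} {w : A → S} {resp : Bits (Tab ⊕ E) → Bits Z}
    (h : IsAnswer O tab w resp) (V : QVerifier C E Z) (ψ : QState (S ⊕ VReg C E Z V.anc))
    (c : Bits S → ℂ) (inp : Bits S → Bits C)
    (hψ : ∀ s, slice ψ s = c s • ket (V.initBits (inp s)))
    (hc : ∀ s, c s ≠ 0 → ∀ i, s (w i) = false) :
    probOne (Sum.inr V.outQubit) ((V.finish.embed Function.Embedding.inr).run
      ((O.embed (queryEmb S C E Z V.anc)).run ((V.query.embed Function.Embedding.inr).run ψ))) =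
    ∑ s, ‖c s‖ ^ 2 *
      gameProb V (inp s) (fun e => resp (Sum.elim (fun i => s (tab i)) e)) := by
  rw [probOne_inr]
  refine Finset.sum_congr rfl fun s _ => ?_
  rw [slice_embed_inr]
  -- A content `s` with dirty auxiliary wires has amplitude zero and contributes nothing; on all
  -- others the answer is the intended function.
  by_cases hs : c s = 0
  · rw [h.slice_zero, QCircuit.run_zero, probOne_zero, hs]
    · simp
    · rw [slice_embed_inr, hψ, hs, zero_smul, QCircuit.run_zero]
  · rw [h.slice_run _ _ (hc s hs), slice_embed_inr, hψ, QCircuit.run_smul,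
      runInSuperposition_smul, QCircuit.run_smul, probOne_smul]
    rfl

/-! ## Distinguishers -/

theorem exists_distinguisher {X Y T : Type} [Fintype X] [Fintype Y] [Fintype T] (e : T ≃ X ⊕ Y)
    (y₀ : Y) (circ : QCircuit T) : ∃ D : QDistinguisher X,
      D.size ≤ Fintype.card Y + circ.length ∧ ∀ s, D.prob s =
        probOne (e.symm (Sum.inr y₀)) (circ.run (ket ((Sum.elim s fun _ => false) ∘ e))) := by
  classical
  have hcard : Fintype.card Y = (Fintype.card Y - 1) + 1 := by
    have := Fintype.card_pos_iff.2 ⟨y₀⟩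
    omega
  let e₁ : Y ≃ Fin (Fintype.card Y - 1 + 1) := Fintype.equivFinOfCardEq hcard
  -- Ancillas are renumbered so that the wire to be measured becomes number `0`.
  let e₂ : Y ≃ Fin (Fintype.card Y - 1 + 1) := e₁.trans (Equiv.swap (e₁ y₀) 0)
  have he₂ : e₂ y₀ = 0 := by simp [e₂]
  let ε : T ≃ X ⊕ Fin (Fintype.card Y - 1 + 1) := e.trans (Equiv.sumCongr (Equiv.refl X) e₂)
  refine ⟨⟨Fintype.card Y - 1, QCircuit.embed ε.toEmbedding circ⟩, ?_, ?_⟩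
  · unfold QDistinguisher.size
    dsimp only
    rw [QCircuit.embed_length]
    omega
  · intro s
    unfold QDistinguisher.prob
    dsimp only
    have ho : ε (e.symm (Sum.inr y₀)) = Sum.inr 0 := by
      simp [ε, he₂]
    rw [probOne_eq, probOne_eq, ← (Equiv.arrowCongr ε (Equiv.refl Bool)).sum_comp]
    refine Finset.sum_congr rfl fun b _ => ?_
    have hb : ∀ t, (Equiv.arrowCongr ε (Equiv.refl Bool)) b (ε t) = b t := by
      intro t
      simp [Equiv.arrowCongr]
    have hext : ∀ b' b'' : Bits T, Function.extend ε.toEmbedding b'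
        ((Equiv.arrowCongr ε (Equiv.refl Bool)) b'') = b' ∘ ε.symm := by
      intro b' b''
      funext y
      obtain ⟨t, rfl⟩ := ε.surjective y
      refine (ε.injective.extend_apply _ _ t).trans ?_
      simp
    have hket : (fun b' : Bits T => ket (Sum.elim s fun _ => false :
        Bits (X ⊕ Fin (Fintype.card Y - 1 + 1))) (b' ∘ ε.symm)) =
        ket ((Sum.elim s fun _ => false) ∘ e) := by
      funext b'
      unfold ket
      congr 1
      rw [eq_iff_iff]
      constructor
      · intro H
        funext t
        have := congrFun H (ε t)
        simp only [Function.comp_apply, Equiv.symm_apply_apply] at this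
        rw [this]
        simp only [ε, Equiv.trans_apply, Function.comp_apply]
        cases e t <;> rfl
      · intro H
        funext y
        obtain ⟨t, rfl⟩ := ε.surjective y
        simp only [Function.comp_apply, Equiv.symm_apply_apply, H]
        simp only [ε, Equiv.trans_apply]
        cases e t <;> rfl
    have hrun : (QCircuit.embed ε.toEmbedding circ).run (ket (Sum.elim s fun _ => false))
        ((Equiv.arrowCongr ε (Equiv.refl Bool)) b) =
        circ.run (ket ((Sum.elim s fun _ => false) ∘ e)) b := by
      rw [QCircuit.embed_run]
      simp only [hext, hket]
      congr 1
      funext t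
      exact hb t
    rw [hrun, ← hb (e.symm (Sum.inr y₀)), ho]

/-- An efficient distinguisher can compute the data for the game from its input, and play the
game with the verifier. -/
theorem exists_game_distinguisher {X C Tab E Z : Type} [Fintype X] [Fintype C] [Fintype Tab]
    [Fintype E] [Fintype Z] {s₁ s₂ : ℕ} {data : Bits X → Bits (C ⊕ Tab)}
    {resp : Bits (Tab ⊕ E) → Bits Z} (hdata : HasProgram s₁ data) (hresp : HasProgram s₂ resp)
    (V : QVerifier C E Z) : ∃ D : QDistinguisher X,
      D.size ≤ 5 * (s₁ + s₂) + 3 * (Fintype.card C + Fintype.card Tab + Fintype.card E +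
        Fintype.card Z) + V.size + 1 ∧
      ∀ x, D.prob x = gameProb V (fun i => data x (.inl i))
        (fun e => resp (Sum.elim (fun i => data x (.inr i)) e)) := by
  classical
  obtain ⟨A₁, _, hA₁, H₁⟩ := hdata.exists_oracle
  obtain ⟨A₂, _, hA₂, H₂⟩ := hresp.exists_answer
  -- The private side holds the input, the table of openings and the workspaces of the two oracles.
  -- The first oracle writes the verifier's classical input directly into the verifier's own
  -- register.
  let S := X ⊕ (Tab ⊕ (A₁ ⊕ A₂))
  let W := VReg C E Z V.anc
  obtain ⟨O₁, σ, hO₁, ho₁⟩ := H₁ (T := S ⊕ W) (fun i => Sum.inl (Sum.inl i))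
    (Sum.elim (fun i => Sum.inr (Sum.inl i)) (fun i => Sum.inl (Sum.inr (Sum.inl i))))
    (fun i => Sum.inl (Sum.inr (Sum.inr (Sum.inl i))))
    (by
      rintro (i | i) (j | j) h
      · cases h; rfl
      · cases h
      · cases h
      · cases h; rfl)
    (by intro i j h; cases h; rfl) (by rintro i (o | o) h <;> cases h) (by intro i a h; cases h)
    (by rintro a (o | o) h <;> cases h)
  obtain ⟨O₂, hO₂, ho₂⟩ := H₂ (S := S) (fun i => Sum.inr (Sum.inl i))
    (fun i => Sum.inr (Sum.inr (Sum.inr i))) (by intro i j h; cases h; rfl)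
    (by intro i a h; cases h)
  obtain ⟨D, hD, hDp⟩ := exists_distinguisher (X := X) (Y := (Tab ⊕ (A₁ ⊕ A₂)) ⊕ W) (T := S ⊕ W)
    (Equiv.sumAssoc _ _ _) (Sum.inr V.outQubit)
    (O₁ ++ (QCircuit.embed Function.Embedding.inr V.query ++
      (O₂.embed (queryEmb S C E Z V.anc) ++ QCircuit.embed Function.Embedding.inr V.finish)))
  refine ⟨D, ?_, ?_⟩
  · refine hD.trans ?_
    have hW : Fintype.card W = Fintype.card C +
        (Fintype.card E + Fintype.card Z + (V.anc + 1)) := by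
      simp only [W, VReg, Fintype.card_sum, Fintype.card_fin]
    simp only [List.length_append, QCircuit.embed_length, Fintype.card_sum, QVerifier.size,
      hW] at hO₁ hO₂ ⊢
    omega
  · intro x
    rw [hDp]
    simp only [QCircuit.run_append]
    rw [ho₁.run_ket]
    set b₀ : Bits (S ⊕ W) := (Sum.elim x fun _ => false) ∘ Equiv.sumAssoc _ _ _ with hb₀
    have hval := ho₁.value b₀ fun _ => rfl
    have hframe := ho₁.frame b₀
    have hx : (fun i => b₀ (Sum.inl (Sum.inl i))) = x := rfl
    rw [hx] at hval
    have hinit : (fun v => σ b₀ (Sum.inr v)) = V.initBits fun i => data x (.inl i) := by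
      funext v
      rcases v with c | v
      · refine (hval (.inl c)).trans ?_
        exact Bool.false_xor _
      · exact hframe (Sum.inr (Sum.inr v)) (by rintro (o | o) h <;> cases h)
    have htab : ∀ i, σ b₀ (Sum.inl (Sum.inr (Sum.inl i))) = data x (.inr i) := by
      intro i
      refine (hval (.inr i)).trans ?_
      exact Bool.false_xor _
    have hanc : ∀ i, σ b₀ (Sum.inl (Sum.inr (Sum.inr (Sum.inr i)))) = false := fun i =>
      hframe _ (by rintro (o | o) h <;> cases h)
    let s₀ : Bits S := fun i => σ b₀ (Sum.inl i)
    -- Before the query the state is a single basis vector, so exactly one content `s₀` of the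
    -- private side occurs.
    refine (probOne_interaction ho₂ V (ket (σ b₀)) (fun s => if s = s₀ then 1 else 0)
      (fun _ i => data x (.inl i)) ?_ ?_).trans ?_
    · intro s
      rw [← hinit]
      funext v
      unfold slice ket
      rw [Pi.smul_apply, smul_eq_mul, ite_mul, one_mul, zero_mul, ← ite_and]
      congr 1
      rw [eq_iff_iff]
      constructor
      · intro H
        exact ⟨funext fun i => congrFun H (Sum.inl i), funext fun i => congrFun H (Sum.inr i)⟩
      · rintro ⟨H1, H2⟩
        funext y
        rcases y with i | i
        · exact congrFun H1 i
        · exact congrFun H2 i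
    · intro s hs i
      have : s = s₀ := by
        by_contra H
        exact hs (if_neg H)
      rw [this]
      exact hanc i
    · rw [Finset.sum_eq_single s₀]
      · simp only [if_true, norm_one, one_pow, one_mul, s₀, htab]
      · intro s _ hs
        simp [hs]
      · simp

/-! ## Simulators -/

/-- The Hadamard gate. -/
noncomputable def hadamard : Matrix.unitaryGroup Bool ℂ :=
  ⟨Matrix.of fun i j => ((√2)⁻¹ : ℝ) * (if i && j then -1 else 1), by
    have h : (((√2)⁻¹ : ℝ) : ℂ) * (((√2)⁻¹ : ℝ) : ℂ) = 1 / 2 := by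
      rw [← Complex.ofReal_mul, ← mul_inv, Real.mul_self_sqrt (by norm_num)]
      norm_num
    rw [Matrix.mem_unitaryGroup_iff]
    ext i j
    simp only [Matrix.mul_apply, Matrix.star_apply, Matrix.of_apply, Fintype.sum_bool, star_mul']
    simp only [RCLike.star_def, Complex.conj_ofReal]
    generalize (((√2)⁻¹ : ℝ) : ℂ) = r at h
    cases i <;> cases j <;> simp <;> linear_combination 2 * h⟩

open Classical in
/-- Hadamard gates on clean wires produce a uniform superposition. -/
theorem run_hadamard_ket {T : Type} (b₀ : Bits T) (l : List T) (hl : l.Nodup)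
    (h₀ : ∀ i ∈ l, b₀ i = false) :
    QCircuit.run (l.map fun i => QGate.single i hadamard) (ket b₀) =
      fun b => if ∀ y, y ∉ l → b y = b₀ y then (((√2)⁻¹ : ℝ) : ℂ) ^ l.length else 0 := by
  induction l using List.reverseRecOn with
  | nil =>
    funext b
    simp [QCircuit.run_nil, ket, funext_iff]
  | append_singleton l i ih =>
    have hl' := List.nodup_append.1 hl
    have hi : i ∉ l := fun h => hl'.2.2 i h i (List.mem_singleton_self i) rfl
    rw [List.map_append, QCircuit.run_append, ih hl'.1 fun j hj => h₀ j (by simp [hj])]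
    funext b
    simp only [List.map_cons, List.map_nil, QCircuit.run_cons, QCircuit.run_nil, QGate.apply,
      Fintype.sum_bool]
    have hi0 : b₀ i = false := h₀ i (by simp)
    have h1 : ¬ ∀ y, y ∉ l → Function.update b i true y = b₀ y := by
      intro H
      have := H i hi
      simp [hi0] at this
    have h2 : (∀ y, y ∉ l → Function.update b i false y = b₀ y) ↔
        ∀ y, y ∉ l ++ [i] → b y = b₀ y := by
      constructor
      · intro H y hy
        simp only [List.mem_append, List.mem_singleton, not_or] at hy
        have := H y hy.1
        rwa [Function.update_of_ne hy.2] at this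
      · intro H y hy
        by_cases hyi : y = i
        · subst hyi; simp [hi0]
        · rw [Function.update_of_ne hyi]
          exact H y (by simp [hy, hyi])
    rw [if_neg h1, mul_zero, zero_add, if_congr h2 rfl rfl]
    have h3 : hadamard.1 (b i) false = (((√2)⁻¹ : ℝ) : ℂ) := by
      simp [hadamard]
    rw [h3, List.length_append, List.length_singleton, pow_succ']
    split_ifs <;> simp

/-- A simulator can choose uniform coins, compute the first message and private data from the
instance and these coins, and answer the query with the private data. -/
theorem exists_game_simulator {X M Q Tab E Z : Type} [Fintype X] [Fintype M] [Fintype Q]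
    [Fintype Tab] [Fintype E] [Fintype Z] [Fintype (Bits Q)] {s₁ s₂ : ℕ}
    {data : Bits (X ⊕ Q) → Bits (M ⊕ Tab)}
    {resp : Bits (Tab ⊕ E) → Bits Z} (hdata : HasProgram s₁ data) (hresp : HasProgram s₂ resp) :
    ∃ Sim : QSimulator X M E Z, Sim.size ≤ 5 * (s₁ + s₂) + 3 * (Fintype.card Q +
        Fintype.card M + Fintype.card Tab + Fintype.card Z) ∧
      ∀ (V : QVerifier (X ⊕ M) E Z) (x : Bits X), Sim.prob V x = uavg fun q : Bits Q =>
        gameProb V (Sum.elim x fun i => data (Sum.elim x q) (.inl i))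
          (fun e => resp (Sum.elim (fun i => data (Sum.elim x q) (.inr i)) e)) := by
  classical
  obtain ⟨A₁, _, hA₁, H₁⟩ := hdata.exists_oracle
  obtain ⟨A₂, _, hA₂, H₂⟩ := hresp.exists_answer
  let anc := Fintype.card (Q ⊕ (Tab ⊕ (A₁ ⊕ A₂)))
  let ε : Q ⊕ (Tab ⊕ (A₁ ⊕ A₂)) ≃ Fin anc := Fintype.equivFin _
  let S := SReg X M anc
  let coin : Q → S := fun q => Sum.inr (Sum.inr (ε (Sum.inl q)))
  let tab : Tab → S := fun i => Sum.inr (Sum.inr (ε (Sum.inr (Sum.inl i))))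
  let anc₁ : A₁ → S := fun i => Sum.inr (Sum.inr (ε (Sum.inr (Sum.inr (Sum.inl i)))))
  let anc₂ : A₂ → S := fun i => Sum.inr (Sum.inr (ε (Sum.inr (Sum.inr (Sum.inr i)))))
  have hε : ∀ {a b}, (Sum.inr (Sum.inr (ε a)) : S) = Sum.inr (Sum.inr (ε b)) → a = b :=
    fun h => ε.injective (Sum.inr_injective (Sum.inr_injective h))
  obtain ⟨O₁, σ, hO₁, ho₁⟩ := H₁ (T := S)
    (Sum.elim (fun i => Sum.inl i) coin)
    (Sum.elim (fun i => Sum.inr (Sum.inl i)) tab) anc₁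
    (by
      rintro (i | i) (j | j) h
      · cases h; rfl
      · cases h
      · cases h
      · cases hε h; rfl)
    (by intro i j h; cases hε h; rfl)
    (by
      rintro (i | i) (o | o) h
      · cases h
      · cases h
      · cases h
      · cases hε h)
    (by
      rintro (i | i) a h
      · cases h
      · cases hε h)
    (by
      rintro a (o | o) h
      · cases h
      · cases hε h)
  obtain ⟨O₂, hO₂, ho₂⟩ := H₂ (S := S) tab anc₂ (by intro i j h; cases hε h; rfl)
    (by intro i a h; cases hε h)
  have hcoin : Function.Injective coin := by intro i j h; cases hε h; rfl
  let l : List S := (Finset.univ : Finset Q).toList.map coin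
  have hl : l.Nodup := (Finset.nodup_toList _).map hcoin
  have hmem : ∀ y, y ∈ l ↔ ∃ q, coin q = y := by intro y; simp [l]
  -- The coins are a uniform superposition that is never measured. All later circuits only read
  -- them, so they have the same effect as classical uniform bits.
  let Sim : QSimulator X M E Z :=
    ⟨anc, (l.map fun i => QGate.single i hadamard) ++ O₁, O₂⟩
  refine ⟨Sim, ?_, ?_⟩
  · have hlen : l.length = Fintype.card Q := by simp [l]
    have hanc : anc = Fintype.card Q + (Fintype.card Tab + (Fintype.card A₁ + Fintype.card A₂)) := by
      simp only [anc, Fintype.card_sum]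
    simp only [QSimulator.size, Sim, List.length_append, List.length_map, hlen, hanc,
      Fintype.card_sum] at hO₁ hO₂ ⊢
    omega
  · intro V x
    let b₀ : Bits S := Sum.elim x fun _ => false
    let r : ℂ := (((√2)⁻¹ : ℝ) : ℂ) ^ l.length
    let hst : Bits S → ℂ := fun b => if ∀ y, y ∉ l → b y = b₀ y then r else 0
    let started : QState S := Sim.start.run (ket b₀)
    have hstarted : ∀ s, started s = hst (σ s) := by
      intro s
      simp only [started, Sim]
      rw [QCircuit.run_append, run_hadamard_ket b₀ l hl fun i hi => by
        obtain ⟨q, rfl⟩ := (hmem i).1 hi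
        rfl, ho₁.run]
      simp only [hst, r]
      congr
    have hclean : ∀ s, started s ≠ 0 → ∀ i, s (anc₂ i) = false := by
      intro s hs i
      rw [hstarted] at hs
      have h1 : ∀ y, y ∉ l → σ s y = b₀ y := by
        by_contra H
        exact hs (if_neg H)
      have h2 : anc₂ i ∉ l := by
        rw [hmem]
        rintro ⟨q, hq⟩
        cases hε hq
      have h3 := h1 _ h2
      rw [ho₁.frame] at h3
      · exact h3
      · rintro (o | o) h
        · cases h
        · cases hε h
    let F : Bits S → ℝ := fun s => gameProb V (Sum.elim x fun i => s (Sum.inr (Sum.inl i)))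
      (fun e => resp (Sum.elim (fun i => s (tab i)) e))
    have hprob : Sim.prob V x = ∑ s : Bits S, ‖started s‖ ^ 2 * F s := by
      -- Measuring the message keeps the contents `s` whose message part is `m`; summing over `m`
      -- then restores the sum over all `s`.
      have hm : ∀ m : Bits M, probOne (Sum.inr V.outQubit)
          ((V.finish.embed Function.Embedding.inr).run
            ((O₂.embed (queryEmb S (X ⊕ M) E Z V.anc)).run
              ((V.query.embed Function.Embedding.inr).run fun b =>
                if (fun q => b (.inl (.inr (.inl q)))) = m ∧
                  (fun q => b (.inr q)) = V.initBits (Sum.elim x m)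
                then started (fun q => b (.inl q)) else 0))) =
          ∑ s : Bits S, if (fun i => s (Sum.inr (Sum.inl i))) = m then
            ‖started s‖ ^ 2 * F s else 0 := by
        intro m
        refine (probOne_interaction ho₂ V _
          (fun s => if (fun i => s (Sum.inr (Sum.inl i))) = m then started s else 0)
          (fun _ => Sum.elim x m) ?_ ?_).trans ?_
        · intro s
          funext v
          unfold slice ket
          rw [Pi.smul_apply, smul_eq_mul, mul_ite, mul_one, mul_zero, ← ite_and]
          by_cases h1 : (fun i => s (Sum.inr (Sum.inl i))) = m <;>
            by_cases h2 : v = V.initBits (Sum.elim x m) <;> simp [h1, h2]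
        · intro s hs
          exact hclean s fun h => hs (by rw [h, ite_self])
        · refine Finset.sum_congr rfl fun s _ => ?_
          by_cases hs : (fun i => s (Sum.inr (Sum.inl i))) = m
          · rw [if_pos hs, if_pos hs, ← hs]
          · rw [if_neg hs, if_neg hs, norm_zero]
            ring
      calc Sim.prob V x = ∑ m : Bits M, ∑ s : Bits S,
            if (fun i => s (Sum.inr (Sum.inl i))) = m then ‖started s‖ ^ 2 * F s else 0 := by
            unfold QSimulator.prob
            refine Finset.sum_congr (by congr!) fun m _ => ?_
            exact hm m
        _ = ∑ s : Bits S, ‖started s‖ ^ 2 * F s := by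
            rw [Finset.sum_comm]
            exact Finset.sum_congr rfl fun s _ => by simp
    let Sq : Bits Q → Bits S := fun q => Function.extend coin q b₀
    have hSq_coin : ∀ q i, Sq q (coin i) = q i := fun q i => hcoin.extend_apply _ _ _
    have hSq_off : ∀ q y, y ∉ l → Sq q y = b₀ y := fun q y hy =>
      Function.extend_apply' _ _ _ fun h => hy ((hmem y).2 h)
    have hSq_inj : Function.Injective Sq := by
      intro q q' h
      funext i
      rw [← hSq_coin q i, h, hSq_coin]
    have hnorm : ‖r‖ ^ 2 = (Fintype.card (Bits Q) : ℝ)⁻¹ := by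
      have hlen : l.length = Fintype.card Q := by simp [l]
      have h2 : ((√2)⁻¹ : ℝ) ^ 2 = 2⁻¹ := by
        rw [inv_pow, Real.sq_sqrt (by norm_num)]
      have hcard : Fintype.card (Bits Q) = 2 ^ Fintype.card Q := by
        rw [← Nat.card_eq_fintype_card, Nat.card_fun, Nat.card_eq_fintype_card,
          Nat.card_eq_fintype_card, Fintype.card_bool]
      simp only [r, hlen]
      rw [norm_pow, Complex.norm_real, Real.norm_of_nonneg (by positivity), ← pow_mul, mul_comm,
        pow_mul, h2, hcard, Nat.cast_pow, Nat.cast_ofNat, inv_pow]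
    -- After a change of variables by the involution `σ`, only the strings `Sq q` carry weight: one
    -- for each choice of coins, all with squared amplitude `1 / |Bits Q|`.
    have hsum : ∑ s : Bits S, ‖started s‖ ^ 2 * F s =
        ∑ q : Bits Q, (Fintype.card (Bits Q) : ℝ)⁻¹ * F (σ (Sq q)) := by
      have h1 : ∑ s : Bits S, ‖started s‖ ^ 2 * F s = ∑ s : Bits S, ‖hst s‖ ^ 2 * F (σ s) := by
        refine (Equiv.sum_comp (ho₁.involutive.toPerm) _).symm.trans ?_
        refine Finset.sum_congr rfl fun s _ => ?_
        rw [hstarted]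
        simp only [Function.Involutive.coe_toPerm, ho₁.involutive s]
      rw [h1]
      symm
      refine Fintype.sum_of_injective Sq hSq_inj _ _ ?_ ?_
      · intro s hs
        have : hst s = 0 := by
          refine if_neg fun H => hs ⟨fun i => s (coin i), ?_⟩
          funext y
          by_cases hy : y ∈ l
          · obtain ⟨i, rfl⟩ := (hmem y).1 hy
            exact hSq_coin _ i
          · rw [hSq_off _ y hy, H y hy]
        rw [this, norm_zero]
        ring
      · intro q
        have : hst (Sq q) = r := if_pos fun y hy => hSq_off q y hy
        rw [this, hnorm]
    rw [hprob, hsum, ← Finset.mul_sum, inv_mul_eq_div]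
    refine congrArg (fun z : ℝ => z / (Fintype.card (Bits Q) : ℝ)) ?_
    refine Finset.sum_congr rfl fun q _ => ?_
    have hval := ho₁.value (Sq q) fun a => by
      refine (hSq_off q _ ?_).trans rfl
      rw [hmem]
      rintro ⟨i, hi⟩
      cases hε hi
    have hin : (fun i => Sq q ((Sum.elim (fun i => Sum.inl i) coin : X ⊕ Q → S) i)) =
        Sum.elim x q := by
      funext i
      rcases i with i | i
      · refine (hSq_off q _ ?_).trans rfl
        rw [hmem]
        rintro ⟨j, hj⟩
        cases hj
      · exact hSq_coin q i
    rw [hin] at hval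
    have hM : ∀ i, σ (Sq q) (Sum.inr (Sum.inl i)) = data (Sum.elim x q) (.inl i) := by
      intro i
      refine (hval (.inl i)).trans ?_
      have : Sq q (Sum.inr (Sum.inl i)) = false := by
        refine (hSq_off q _ ?_).trans rfl
        rw [hmem]
        rintro ⟨j, hj⟩
        cases hj
      exact (congrArg (fun z => xor z _) this).trans (Bool.false_xor _)
    have hT : ∀ i, σ (Sq q) (tab i) = data (Sum.elim x q) (.inr i) := by
      intro i
      refine (hval (.inr i)).trans ?_
      have : Sq q (tab i) = false := by
        refine (hSq_off q _ ?_).trans rfl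
        rw [hmem]
        rintro ⟨j, hj⟩
        cases hε hj
      exact (congrArg (fun z => xor z _) this).trans (Bool.false_xor _)
    simp only [F, hM, hT]

/-! ## Statistical witness indistinguishability of the protocol -/

theorem odd_card_filter_update {n : ℕ} {W : Type} (p : Fin n → Prop) [DecidablePred p]
    (s : Fin n → Bits W) (i₀ : Fin n) (h₀ : p i₀) (d : Bits W) (b : W) :
    decide (Odd (Finset.univ.filter fun j : Fin n => p j ∧
      Function.update s i₀ (fun b => xor (s i₀ b) (d b)) j b = true).card) =
    xor (d b) (decide (Odd (Finset.univ.filter fun j : Fin n => p j ∧ s j b = true).card)) := by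
  have h1 : ∀ j ∈ Finset.univ.erase i₀,
      (if p j ∧ Function.update s i₀ (fun b => xor (s i₀ b) (d b)) j b = true then 1 else 0) =
        if p j ∧ s j b = true then 1 else 0 := by
    intro j hj
    rw [Function.update_of_ne (Finset.ne_of_mem_erase hj)]
  rw [Finset.card_filter, Finset.card_filter, ← Finset.add_sum_erase _ _ (Finset.mem_univ i₀),
    ← Finset.add_sum_erase _ _ (Finset.mem_univ i₀), Finset.sum_congr rfl h1,
    Function.update_self]
  simp only [h₀, true_and]
  generalize ∑ j ∈ Finset.univ.erase i₀, (if p j ∧ s j b = true then 1 else 0) = m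
  by_cases hm : Odd m <;> cases d b <;> cases s i₀ b <;>
    simp [hm, Nat.add_comm 1, Nat.odd_add_one]

/-- If `i₀` is not last, the change of its coin and the change of the secret cancel in the last
share. If `i₀` is last, its coin is not used and only its own share moves. -/
theorem additiveShares_update {n : ℕ} {W : Type} (w w' : Bits W) (s : Fin n → Bits W)
    {i i₀ : Fin n} (hi : i ≠ i₀) :
    additiveShares w' (Function.update s i₀ fun b => xor (s i₀ b) (xor (w b) (w' b))) i =
      additiveShares w s i := by
  funext b
  unfold additiveShares
  split_ifs with h
  · have h₀ : i₀.1 + 1 ≠ n := fun h' => hi (Fin.ext (by omega))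
    rw [odd_card_filter_update (fun j : Fin n => j.1 + 1 ≠ n) s i₀ h₀ (fun b => xor (w b) (w' b)) b]
    cases w b <;> cases w' b <;> simp
  · rw [Function.update_of_ne hi]

/-- Additive secret sharing hides the secret from any incomplete set of parties. -/
theorem uavg_additiveShares {n : ℕ} {W : Type} [Fintype (Fin n → Bits W)] (w w' : Bits W)
    (A B : (Fin n → Bits W) → ℝ) (i₀ : Fin n)
    (hAB : ∀ s s', (∀ i, i ≠ i₀ → additiveShares w s i = additiveShares w' s' i) →
      A (additiveShares w s) = B (additiveShares w' s')) :
    (uavg fun s => A (additiveShares w s)) = uavg fun s => B (additiveShares w' s) := by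
  let σ : (Fin n → Bits W) → (Fin n → Bits W) := fun s =>
    Function.update s i₀ fun b => xor (s i₀ b) (xor (w b) (w' b))
  have hσ : Function.Involutive σ := by
    intro s
    simp only [σ, Function.update_self, Function.update_idem, Bool.xor_assoc, Bool.xor_self,
      Bool.xor_false]
    exact Function.update_eq_self _ _
  rw [← uavg_involutive hσ fun s => B (additiveShares w' s)]
  exact uavg_congr fun s => hAB _ _ fun i hi => (additiveShares_update w w' s hi).symm

namespace MPCProtocol

variable {P W : Type} {π : MPCProtocol P W}

theorem Private.uavg_eq [Fintype W] {F : Bits P → (Fin π.n → Bits W) → Bool}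
    {t : ℕ} (h : π.Private F t) (pub : Bits P) {T : Finset (Fin π.n)} (hT : T.card ≤ t)
    {ins ins' : Fin π.n → Bits W} (hins : ∀ i ∈ T, ins i = ins' i) (hF : F pub ins = F pub ins')
    (φ : (Fin π.n → Bits (Fin π.viewLen)) → ℝ)
    (hφ : ∀ u u', (∀ i ∈ T, u i = u' i) → φ u = φ u') :
    (uavg fun ρ : Fin π.n → Bits (Fin π.tapeLen) =>
        φ fun i => π.encodeView (π.honestView pub ins ρ i)) =
      uavg fun ρ : Fin π.n → Bits (Fin π.tapeLen) =>
        φ fun i => π.encodeView (π.honestView pub ins' ρ i) := by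
  classical
  obtain ⟨Sim, hSim⟩ := h pub T hT
  -- Views outside `T` are filled with zeros, which `φ` ignores. Both averages then become the same
  -- expectation over the output of `Sim`, as inputs in `T` and the value of `F` agree.
  let ψ : (∀ i : {i // i ∈ T}, π.View i.1) → ℝ := fun v =>
    φ fun i => if hi : i ∈ T then π.encodeView (v ⟨i, hi⟩) else fun _ => false
  have key : ∀ ins'' : Fin π.n → Bits W,
      (uavg fun ρ : Fin π.n → Bits (Fin π.tapeLen) =>
        φ fun i => π.encodeView (π.honestView pub ins'' ρ i)) =
      ∑ v, (Sim (fun i => ins'' i.1) (F pub ins'') v).toReal * ψ v := by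
    intro ins''
    rw [← hSim ins'']
    have h1 := sum_map_uniform_mul
      (fun (ρ : Fin π.n → Bits (Fin π.tapeLen)) (i : {i // i ∈ T}) =>
        π.honestView pub ins'' ρ i.1) ψ
    rw [h1]
    refine uavg_congr fun ρ => hφ _ _ fun i hi => ?_
    rw [dif_pos hi]
  rw [key, key, hF]
  have : (fun i : {i // i ∈ T} => ins i.1) = fun i => ins' i.1 := funext fun i => hins i i.2
  rw [this]

end MPCProtocol

namespace SuperpositionProof

variable {R : NPRelation} {C : CommitmentScheme} {k : ℕ}
  (π : MPCProtocol (PubIdx C k) (WitIdx R C k))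

/-- The view of party `i`, when the prover uses an arbitrary witness `W` of the claim. -/
noncomputable def claimView (pub : Bits (PubIdx C k)) (W : Bits (WitIdx R C k)) (ρ : Bits (CoinIdx π))
    (i : Fin π.n) : Bits (Fin π.viewLen) :=
  π.encodeView (π.honestView pub (additiveShares W fun j b => ρ (.inl (j, b)))
    (fun j b => ρ (.inr (.inl (j, b)))) i)

/-- The first message of a prover that uses the witness `W`. -/
noncomputable def claimFirst (pub : Bits (PubIdx C k)) (pk : Bits (Fin (C.pkLen k)))
    (W : Bits (WitIdx R C k)) (ρ : Bits (CoinIdx π)) : Bits (Fin π.n × Fin (C.cLen k π.viewLen)) :=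
  fun q => C.commit k π.viewLen pk (claimView π pub W ρ q.1)
    (fun b => ρ (.inr (.inr (q.1, b)))) q.2

/-- The openings of all commitments of a prover that uses the witness `W`. -/
noncomputable def claimTable (pub : Bits (PubIdx C k)) (W : Bits (WitIdx R C k)) (ρ : Bits (CoinIdx π)) :
    Bits (Fin π.n × (Fin π.viewLen ⊕ Fin (C.rLen k π.viewLen))) :=
  fun q => Sum.elim (claimView π pub W ρ q.1) (fun b => ρ (.inr (.inr (q.1, b)))) q.2

/-- The part of a table that is opened on challenge `e`. -/
noncomputable def openTable {n : ℕ} {Z : Type} (t : ℕ) (tab : Bits (Fin n × Z)) (e : Bits (Fin n)) :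
    Bits (Fin n × Z) :=
  fun q => if e ∈ challengeSets n t ∧ e q.1 = true then tab q else false

/-- The probability that the verifier `V` outputs `1`, when the prover uses the witness `W` and
the coins `ρ`. -/
noncomputable def claimGame (t : ℕ)
    (V : QVerifier (Fin k ⊕ (CrsIdx C k ⊕ (Fin π.n × Fin (C.cLen k π.viewLen)))) (Fin π.n)
      (Fin π.n × (Fin π.viewLen ⊕ Fin (C.rLen k π.viewLen))))
    (x : Bits (Fin k)) (crs : Bits (CrsIdx C k)) (W : Bits (WitIdx R C k)) (ρ : Bits (CoinIdx π)) :
    ℝ :=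
  gameProb V (Sum.elim x (Sum.elim crs (claimFirst π (Sum.elim x crs) (key crs) W ρ)))
    (openTable t (claimTable π (Sum.elim x crs) W ρ))

theorem card_opened_le {n t : ℕ} (e : Bits (Fin n)) :
    (Finset.univ.filter fun i => e ∈ challengeSets n t ∧ e i = true).card ≤ t / 2 := by
  by_cases he : e ∈ challengeSets n t
  · simp only [he, true_and]
    exact (Finset.mem_filter.1 he).2.le
  · simp [he]

/-- Separates the coins `ω` that determine the views from the coins `r` of the commitments, which is
the form required by `abs_uavg_commit_sub_le`. -/
theorem uavg_claimGame (t : ℕ)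
    (V : QVerifier (Fin k ⊕ (CrsIdx C k ⊕ (Fin π.n × Fin (C.cLen k π.viewLen)))) (Fin π.n)
      (Fin π.n × (Fin π.viewLen ⊕ Fin (C.rLen k π.viewLen))))
    (x : Bits (Fin k)) (crs : Bits (CrsIdx C k)) (W : Bits (WitIdx R C k))
    [Fintype (Bits (CoinIdx π))] [Fintype (Fin π.n → Bits (WitIdx R C k))] :
    (uavg fun ρ => claimGame π t V x crs W ρ) =
      uavg fun ω : (Fin π.n → Bits (WitIdx R C k)) × (Fin π.n → Bits (Fin π.tapeLen)) =>
        uavg fun r : Fin π.n → Bits (Fin (C.rLen k π.viewLen)) =>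
        gameProb V (Sum.elim x (Sum.elim crs fun q => C.commit k π.viewLen (key crs)
            (π.encodeView (π.honestView (Sum.elim x crs) (additiveShares W ω.1) ω.2 q.1))
            (r q.1) q.2))
          (openTable t fun q => Sum.elim
            (π.encodeView (π.honestView (Sum.elim x crs) (additiveShares W ω.1) ω.2 q.1))
            (r q.1) q.2) := by
  classical
  rw [uavg_bits_sum]
  simp only [uavg_bits_sum]
  rw [uavg_prod, ← uavg_bits_curry]
  refine uavg_congr fun s => ?_
  rw [← uavg_bits_curry]
  refine uavg_congr fun ρ => ?_
  rw [← uavg_bits_curry]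
  rfl

/-- Statistical witness indistinguishability against superposition queries. A pair of challenges
opens at most `2 * (t / 2) ≤ t` views, and any `t` views have the same law for both witnesses, since
both make the protocol accept. -/
theorem abs_uavg_claimGame_sub_le {t : ℕ}
    (hpriv : π.Private (functionality R C k π.n) t) (htn : t < π.n)
    (V : QVerifier (Fin k ⊕ (CrsIdx C k ⊕ (Fin π.n × Fin (C.cLen k π.viewLen)))) (Fin π.n)
      (Fin π.n × (Fin π.viewLen ⊕ Fin (C.rLen k π.viewLen))))
    (x : Bits (Fin k)) (crs : Bits (CrsIdx C k)) {W W' : Bits (WitIdx R C k)}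
    (hW : claim (Sum.elim x crs) W = true) (hW' : claim (Sum.elim x crs) W' = true)
    (v₀ : Bits (Fin π.viewLen)) {δ : ℝ}
    (hδ : ∀ v, statDist (C.commitDist k π.viewLen (key crs) v)
      (C.commitDist k π.viewLen (key crs) v₀) ≤ δ) :
    |(uavg fun ρ => claimGame π t V x crs W ρ) - uavg fun ρ => claimGame π t V x crs W' ρ| ≤
      4 * π.n * δ := by
  classical
  let Ω := (Fin π.n → Bits (WitIdx R C k)) × (Fin π.n → Bits (Fin π.tapeLen))
  let view : Bits (WitIdx R C k) → Ω → Fin π.n → Bits (Fin π.viewLen) := fun W ω i =>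
    π.encodeView (π.honestView (Sum.elim x crs) (additiveShares W ω.1) ω.2 i)
  let G : (Fin π.n → Bits (Fin (C.cLen k π.viewLen))) → (Fin π.n → Bits (Fin π.viewLen)) →
      (Fin π.n → Bits (Fin (C.rLen k π.viewLen))) → ℝ := fun c u r =>
    gameProb V (Sum.elim x (Sum.elim crs fun q => c q.1 q.2))
      (openTable t fun q => Sum.elim (u q.1) (r q.1) q.2)
  let h : Bits (Fin π.n) × Bits (Fin π.n) → (Fin π.n → Bits (Fin (C.cLen k π.viewLen))) →
      (Fin π.n → Bits (Fin π.viewLen)) → (Fin π.n → Bits (Fin (C.rLen k π.viewLen))) → ℝ :=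
    fun q c u r => pairTerm V (Sum.elim x (Sum.elim crs fun q => c q.1 q.2)) q.1 q.2
      (openTable t (fun q => Sum.elim (u q.1) (r q.1) q.2) q.1)
      (openTable t (fun q => Sum.elim (u q.1) (r q.1) q.2) q.2)
  have hgame : ∀ W, (uavg fun ρ => claimGame π t V x crs W ρ) =
      uavg fun ω : Ω => uavg fun r : Fin π.n → Bits (Fin (C.rLen k π.viewLen)) =>
        G (fun i => C.commit k π.viewLen (key crs) (view W ω i) (r i)) (view W ω) r := by
    intro W
    exact uavg_claimGame π t V x crs W
  rw [hgame, hgame]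
  let opened : Bits (Fin π.n) → Finset (Fin π.n) := fun e =>
    Finset.univ.filter fun i => e ∈ challengeSets π.n t ∧ e i = true
  have hopen : ∀ (e : Bits (Fin π.n)) (u u' : Fin π.n → Bits (Fin π.viewLen))
      (r r' : Fin π.n → Bits (Fin (C.rLen k π.viewLen))), (∀ i ∈ opened e, u i = u' i ∧ r i = r' i) →
      openTable t (fun q : Fin π.n × (Fin π.viewLen ⊕ Fin (C.rLen k π.viewLen)) =>
        Sum.elim (u q.1) (r q.1) q.2) e =
      openTable t (fun q => Sum.elim (u' q.1) (r' q.1) q.2) e := by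
    intro e u u' r r' h
    funext q
    unfold openTable
    split_ifs with hq
    · obtain ⟨h1, h2⟩ := h q.1 (by simpa [opened] using hq)
      simp only [h1, h2]
    · rfl
  have hG : ∀ c u r, |G c u r| ≤ 1 := fun c u r => abs_gameProb_le_one _ _ _
  have hsum : ∀ c u r, G c u r = ∑ q, h q c u r := fun c u r =>
    (gameProb_eq_sum_pairTerm _ _ _).trans (Finset.sum_congr (by congr!) fun _ _ => rfl)
  have key := abs_uavg_commit_sub_le (t := t) (C.commit k π.viewLen (key crs)) v₀ hδ
    (view W) (view W') ?_ G hG h hsum (fun q => opened q.1 ∪ opened q.2) ?_ ?_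
  · exact key
  · intro T hT φ hφ
    -- Some party is outside `T` because `t < n`. Its share absorbs the difference of the witnesses,
    -- so the inputs inside `T` can be matched before privacy is applied.
    obtain ⟨i₀, hi₀⟩ : ∃ i, i ∉ T := by
      by_contra! H
      have := Finset.card_le_card (s := Finset.univ) (t := T) fun i _ => H i
      rw [Finset.card_univ, Fintype.card_fin] at this
      omega
    have hF : ∀ W, claim (Sum.elim x crs) W = true → ∀ s,
        functionality R C k π.n (Sum.elim x crs) (additiveShares W s) = true := by
      intro W hW s
      unfold functionality
      rw [xorAll_additiveShares (by omega), hW]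
    rw [uavg_prod, uavg_prod]
    let A : (Fin π.n → Bits (WitIdx R C k)) → ℝ := fun ins =>
      uavg fun ρ : Fin π.n → Bits (Fin π.tapeLen) =>
        φ fun i => π.encodeView (π.honestView (Sum.elim x crs) ins ρ i)
    refine uavg_additiveShares W W' A A i₀ fun s s' hs => ?_
    refine hpriv.uavg_eq _ hT (fun i hi => hs i ?_) ?_ φ hφ
    · rintro rfl
      exact hi₀ hi
    · rw [hF W hW, hF W' hW']
  · intro q
    refine (Finset.card_union_le _ _).trans ?_
    have h1 := card_opened_le (t := t) q.1
    have h2 := card_opened_le (t := t) q.2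
    simp only [opened]
    omega
  · intro q c u u' r r' hu
    have h1 := hopen q.1 u u' r r' fun i hi => hu i (Finset.mem_union_left _ hi)
    have h2 := hopen q.2 u u' r r' fun i hi => hu i (Finset.mem_union_right _ hi)
    simp only [h, h1, h2]

end SuperpositionProof

/-! ## Programs of the prover -/

namespace HasProgram

variable {ι κ μ : Type} {s s' : ℕ}

/-- Each output is an input or a constant. -/
theorem select (u : κ → ι ⊕ Bool) : HasProgram 2 fun (x : Bits ι) o => Sum.elim x id (u o) :=
  (((proj id).pair (const (ι := ι) (κ := Bool) id)).reindex u).mono (by omega)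

theorem parity {n : ℕ} (p : Fin n → Prop) [DecidablePred p] (u : Fin n → ι) :
    HasProgram (2 + n * 2) fun (x : Bits ι) (_ : Unit) =>
      decide (Odd (Finset.univ.filter fun j => p j ∧ x (u j) = true).card) := by
  have key : ∀ S : Finset (Fin n), HasProgram (2 + S.card * 2) fun (x : Bits ι) (_ : Unit) =>
      decide (Odd (S.filter fun j => p j ∧ x (u j) = true).card) := by
    intro S
    induction S using Finset.induction_on with
    | empty => simpa using const (ι := ι) (κ := Unit) fun _ => false
    | insert i S hi ih =>
      by_cases hp : p i
      · have h := (ih.bind (xor_gate (ι := ι ⊕ Unit) (.inl (u i)) (.inr ()))).reindex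
          (fun _ : Unit => Sum.inr ())
        refine (h.mono (by rw [Finset.card_insert_of_notMem hi]; omega)).congr fun x => ?_
        funext _
        simp only [Sum.elim_inl, Sum.elim_inr, Finset.filter_insert, hp, true_and]
        cases hx : x (u i)
        · simp
        · rw [if_pos rfl, Finset.card_insert_of_notMem (by simp [hi])]
          generalize (S.filter fun j => p j ∧ x (u j) = true).card = c
          by_cases hc : Odd c <;> simp [Nat.odd_add_one, hc]
      · refine (ih.mono (by rw [Finset.card_insert_of_notMem hi]; omega)).congr fun x => ?_
        rw [Finset.filter_insert, if_neg fun h => hp h.1]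
  simpa using key Finset.univ

theorem hasProgram_additiveShares {n : ℕ} {W : Type} [Fintype W] (w : W → ι) (v : Fin n × W → ι) :
    HasProgram (2 + n * Fintype.card W * (4 + n * 2)) fun (x : Bits ι) (q : Fin n × W) =>
      additiveShares (fun b => x (w b)) (fun j b => x (v (j, b))) q.1 q.2 := by
  have h : ∀ q : Fin n × W, HasProgram (4 + n * 2) fun (x : Bits ι) (_ : Unit) =>
      additiveShares (fun b => x (w b)) (fun j b => x (v (j, b))) q.1 q.2 := by
    rintro ⟨i, b⟩
    by_cases hi : i.1 + 1 = n
    · have h1 := ((parity (fun j : Fin n => j.1 + 1 ≠ n) (fun j => v (j, b))).bind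
        (xor_gate (ι := ι ⊕ Unit) (.inl (w b)) (.inr ()))).reindex (fun _ : Unit => Sum.inr ())
      refine (h1.mono (by omega)).congr fun x => ?_
      funext _
      simp only [additiveShares, if_pos hi]
      rfl
    · refine ((proj (ι := ι) fun _ : Unit => v (i, b)).mono (by omega)).congr fun x => ?_
      funext _
      simp only [additiveShares, if_neg hi]
  have := (pi h).reindex fun q : Fin n × W => ⟨q, ()⟩
  simpa [Fintype.card_prod] using this

/-- A unary counter of the ones among some inputs. -/
theorem count {n m : ℕ} (u : Fin n → ι) :
    HasProgram (2 + n * (6 + 5 * m)) fun (x : Bits ι) (c : Fin m) =>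
      decide ((Finset.univ.filter fun j => x (u j) = true).card = c.1) := by
  have key : ∀ S : Finset (Fin n), HasProgram (2 + S.card * (6 + 5 * m))
      fun (x : Bits ι) (c : Fin m) => decide ((S.filter fun j => x (u j) = true).card = c.1) := by
    intro S
    induction S using Finset.induction_on with
    | empty => simpa using const (ι := ι) (κ := Fin m) fun c => decide (0 = c.1)
    | insert i S hi ih =>
      -- When the new input is `1`, the unary indicator moves up one cell, and counts of `m` or more
      -- fall off the end.
      have h1 : HasProgram 2 _ := select (ι := ι ⊕ Fin m) (κ := Fin m) fun c =>
        if c.1 = 0 then .inr false else .inl (.inr ⟨c.1 - 1, by omega⟩)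
      have h2 : HasProgram 2 _ := select (ι := ι ⊕ Fin m) (κ := Fin m) fun c => .inl (.inr c)
      have h := (ih.bind (h1.ite (.inl (u i)) h2)).reindex fun c : Fin m => Sum.inr c
      refine (h.mono ?_).congr fun x => ?_
      · rw [Finset.card_insert_of_notMem hi, Fintype.card_fin, add_mul, one_mul]
        omega
      · funext c
        rw [Finset.filter_insert]
        by_cases hx : x (u i) = true
        · rw [if_pos hx, Finset.card_insert_of_notMem (by simp [hi])]
          refine (congrFun (if_pos hx) c).trans ?_
          by_cases hc : c.1 = 0
          · simp [hc]
          · simp only [hc, if_false, Sum.elim_inl, Sum.elim_inr]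
            exact decide_eq_decide.2 (by omega)
        · rw [if_neg hx]
          exact congrFun (if_neg hx) c
  simpa using key Finset.univ

end HasProgram

/-- A counter with cells `0, …, t / 2` suffices: its last cell tells whether the set has the right
size. Each output bit is then the conjunction of this cell, membership and the table entry. -/
theorem SuperpositionProof.hasProgram_openTable {n : ℕ} {Z : Type} [Fintype Z] (t : ℕ) :
    HasProgram (4 + n * (11 + 5 * (t / 2)) + n * Fintype.card Z * 2)
      fun b : Bits ((Fin n × Z) ⊕ Fin n) =>
        openTable t (fun q => b (.inl q)) (fun i => b (.inr i)) := by
  have h1 := (HasProgram.count (m := t / 2 + 1) (fun i : Fin n => (Sum.inr i : (Fin n × Z) ⊕ Fin n))).reindex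
    fun _ : Unit => (⟨t / 2, by omega⟩ : Fin (t / 2 + 1))
  have h2 : ∀ q : Fin n × Z, HasProgram 2 fun (y : Bits (((Fin n × Z) ⊕ Fin n) ⊕ Unit)) (_ : Unit) =>
      (y (.inr ()) && y (.inl (.inr q.1))) && y (.inl (.inl q)) := by
    intro q
    have h3 : HasProgram 1 _ := HasProgram.gate (ι := ((Fin n × Z) ⊕ Fin n) ⊕ Unit) false
      (.inr ()) (.inl (.inr q.1))
    have h4 : HasProgram 1 _ := HasProgram.gate (ι := (((Fin n × Z) ⊕ Fin n) ⊕ Unit) ⊕ Unit) false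
      (.inr ()) (.inl (.inl (.inl q)))
    refine ((h3.bind h4).reindex fun _ : Unit => Sum.inr ()).congr fun y => ?_
    funext _
    simp
  have h5 := (h1.bind (HasProgram.pi h2)).reindex fun q : Fin n × Z => Sum.inr ⟨q, ()⟩
  refine (h5.mono ?_).congr fun b => ?_
  · rw [Fintype.card_prod, Fintype.card_fin]
    have : n * (6 + 5 * (t / 2 + 1)) = n * (11 + 5 * (t / 2)) := by ring
    omega
  · funext q
    simp only [Sum.elim_inl, Sum.elim_inr, openTable, challengeSets, Finset.mem_filter,
      Finset.mem_univ, true_and]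
    by_cases ha : (Finset.univ.filter fun j => b (.inr j) = true).card = t / 2 <;>
      cases hb : b (.inr q.1) <;> simp [ha]

namespace SuperpositionProof

variable {R : NPRelation} {C : CommitmentScheme}

/-- The input of the verifier, together with the openings of all commitments, for a prover with
given public input, witness and coins. -/
noncomputable def proverData {k : ℕ} (π : MPCProtocol (PubIdx C k) (WitIdx R C k))
    (b : Bits (PubIdx C k ⊕ (WitIdx R C k ⊕ CoinIdx π))) :
    Bits ((Fin k ⊕ (CrsIdx C k ⊕ (Fin π.n × Fin (C.cLen k π.viewLen)))) ⊕
      (Fin π.n × (Fin π.viewLen ⊕ Fin (C.rLen k π.viewLen)))) :=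
  Sum.elim (Sum.elim (fun i => b (.inl (.inl i))) (Sum.elim (fun i => b (.inl (.inr i)))
      (claimFirst π (fun i => b (.inl i)) (fun i => b (.inl (.inr (.inr (.inr i)))))
        (fun i => b (.inr (.inl i))) fun i => b (.inr (.inr i)))))
    (claimTable π (fun i => b (.inl i)) (fun i => b (.inr (.inl i))) fun i => b (.inr (.inr i)))

theorem hasProgram_claimView {k s : ℕ} (π : MPCProtocol (PubIdx C k) (WitIdx R C k))
    (h : HasProgram s fun (b : Bits (PubIdx C k ⊕ ((Fin π.n × WitIdx R C k) ⊕
        (Fin π.n × Fin π.tapeLen)))) (q : Σ i : Fin π.n, π.ViewIdx i) =>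
      π.honestView (fun a => b (.inl a)) (fun i a => b (.inr (.inl (i, a))))
        (fun i a => b (.inr (.inr (i, a)))) q.1 q.2) :
    HasProgram (2 + π.n * Fintype.card (WitIdx R C k) * (4 + π.n * 2) + s)
      fun (b : Bits (PubIdx C k ⊕ (WitIdx R C k ⊕ CoinIdx π))) (q : Fin π.n × Fin π.viewLen) =>
        claimView π (fun i => b (.inl i)) (fun i => b (.inr (.inl i)))
          (fun i => b (.inr (.inr i))) q.1 q.2 := by
  have h1 := HasProgram.hasProgram_additiveShares (n := π.n) (W := WitIdx R C k)
    (ι := PubIdx C k ⊕ (WitIdx R C k ⊕ CoinIdx π))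
    (fun i => .inr (.inl i)) (fun q => .inr (.inr (.inl q)))
  have h2 : HasProgram 0 _ := HasProgram.proj (ι := PubIdx C k ⊕ (WitIdx R C k ⊕ CoinIdx π))
    (fun i : PubIdx C k => .inl i)
  have h3 : HasProgram 0 _ := HasProgram.proj (ι := PubIdx C k ⊕ (WitIdx R C k ⊕ CoinIdx π))
    (fun i : Fin π.n × Fin π.tapeLen => .inr (.inr (.inr (.inl i))))
  have h4 := (h.comp (h2.pair (h1.pair h3))).reindex
    fun q : Fin π.n × Fin π.viewLen => ⟨q.1, (π.viewEquiv q.1).symm q.2⟩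
  exact (h4.mono (by omega)).congr fun b => rfl

theorem hasProgram_proverData {k s s' : ℕ} (π : MPCProtocol (PubIdx C k) (WitIdx R C k))
    (h : HasProgram s fun (b : Bits (PubIdx C k ⊕ ((Fin π.n × WitIdx R C k) ⊕
        (Fin π.n × Fin π.tapeLen)))) (q : Σ i : Fin π.n, π.ViewIdx i) =>
      π.honestView (fun a => b (.inl a)) (fun i a => b (.inr (.inl (i, a))))
        (fun i a => b (.inr (.inr (i, a)))) q.1 q.2)
    (h' : HasProgram s' fun b : Bits (Fin (C.pkLen k) ⊕ (Fin π.viewLen ⊕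
        Fin (C.rLen k π.viewLen))) =>
      C.commit k π.viewLen (fun i => b (.inl i)) (fun i => b (.inr (.inl i)))
        (fun i => b (.inr (.inr i)))) :
    HasProgram (2 + π.n * Fintype.card (WitIdx R C k) * (4 + π.n * 2) + s + (2 + π.n * s'))
      (proverData π) := by
  have h1 := hasProgram_claimView π h
  let ι := PubIdx C k ⊕ (WitIdx R C k ⊕ CoinIdx π)
  have h2 : ∀ i : Fin π.n, HasProgram s' _ := fun i =>
    h'.comap (ι := ι ⊕ (Fin π.n × Fin π.viewLen))
      (Sum.elim (fun j => Sum.inl (Sum.inl (Sum.inr (Sum.inr (Sum.inr j)))))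
        (Sum.elim (fun j => Sum.inr (i, j))
          (fun j => Sum.inl (Sum.inr (Sum.inr (Sum.inr (Sum.inr (i, j))))))))
  have h3 := (HasProgram.proj (id : ι → ι)).pair (h1.bind (HasProgram.pi h2))
  have h4 := h3.reindex (μ := (Fin k ⊕ (CrsIdx C k ⊕ (Fin π.n × Fin (C.cLen k π.viewLen)))) ⊕
      (Fin π.n × (Fin π.viewLen ⊕ Fin (C.rLen k π.viewLen))))
    (Sum.elim (Sum.elim (fun i => .inl (.inl (.inl i))) (Sum.elim (fun i => .inl (.inl (.inr i)))
        (fun q => .inr (.inr ⟨q.1, q.2⟩))))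
      (fun q => Sum.elim (fun j => .inr (.inl (q.1, j)))
        (fun j => .inl (.inr (.inr (.inr (.inr (q.1, j)))))) q.2))
  refine (h4.mono ?_).congr fun b => ?_
  · rw [Fintype.card_fin]
    omega
  · funext q
    rcases q with ((q | q | q) | ⟨i, q | q⟩) <;> rfl

/-! ### Polynomial bounds for the registers and programs -/

section

variable {π : ∀ k, MPCProtocol (PubIdx C k) (WitIdx R C k)}

/-- Every party has at least the selector bit as input, so `n` is bounded by the number of inputs of
the emulating circuit. -/
theorem polyBounded_parties (heff : MPCEfficient π) : PolyBounded fun k => (π k).n := by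
  refine (PolySizeComputable.polyBounded_card_in heff).mono fun k => ?_
  simp only [Fintype.card_sum, Fintype.card_prod, Fintype.card_fin, Fintype.card_unit]
  nlinarith

theorem polyBounded_card_witIdx (hC : C.Efficient) :
    PolyBounded fun k => Fintype.card (WitIdx R C k) := by
  refine ((polyBounded_const 1).add ((polyBounded_eval R.witLen).add
    (hC.commit (fun _ => 1) (polyBounded_const 1)).polyBounded_card_in)).mono fun k => ?_
  simp only [Fintype.card_sum, Fintype.card_fin, Fintype.card_unit]
  omega

theorem polyBounded_card_crsIdx (hC : C.Efficient) :
    PolyBounded fun k => Fintype.card (CrsIdx C k) := by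
  have h := hC.commit (fun _ => 1) (polyBounded_const 1)
  refine ((h.polyBounded_card_in.add h.polyBounded_card_out).add h.polyBounded_card_in).mono
    fun k => ?_
  simp only [Fintype.card_sum, Fintype.card_fin]
  omega

theorem polyBounded_card_msgIdx (hC : C.Efficient) (heff : MPCEfficient π)
    (hn : ∀ k, 0 < (π k).n) :
    PolyBounded fun k => Fintype.card (Fin (π k).n × Fin (C.cLen k (π k).viewLen)) := by
  have h := hC.commit (fun k => (π k).viewLen) (heff.polyBounded_viewLen hn)
  refine ((polyBounded_parties heff).mul h.polyBounded_card_out).mono fun k => ?_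
  simp only [Fintype.card_prod, Fintype.card_fin, le_refl]

theorem polyBounded_card_respIdx (hC : C.Efficient) (heff : MPCEfficient π)
    (hn : ∀ k, 0 < (π k).n) :
    PolyBounded fun k => Fintype.card
      (Fin (π k).n × (Fin (π k).viewLen ⊕ Fin (C.rLen k (π k).viewLen))) := by
  have h := hC.commit (fun k => (π k).viewLen) (heff.polyBounded_viewLen hn)
  refine ((polyBounded_parties heff).mul h.polyBounded_card_in).mono fun k => ?_
  simp only [Fintype.card_prod, Fintype.card_sum, Fintype.card_fin]
  exact Nat.mul_le_mul_left _ (Nat.le_add_left _ _)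

theorem exists_polyBounded_proverData
    (hC : C.Efficient) (heff : MPCEfficient π) (hn : ∀ k, 0 < (π k).n) :
    ∃ s : ℕ → ℕ, PolyBounded s ∧ ∀ k, HasProgram (s k) (proverData (π k)) := by
  obtain ⟨s₁, hs₁, h₁⟩ := PolySizeComputable.exists_hasProgram heff
  obtain ⟨s₂, hs₂, h₂⟩ := (hC.commit (fun k => (π k).viewLen)
    (heff.polyBounded_viewLen hn)).exists_hasProgram
  refine ⟨_, ?_, fun k => hasProgram_proverData (π k) (h₁ k) (h₂ k)⟩
  have hN := polyBounded_parties heff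
  have hW := polyBounded_card_witIdx (R := R) hC
  exact ((((polyBounded_const 2).add ((hN.mul hW).mul
    ((polyBounded_const 4).add (hN.mul (polyBounded_const 2))))).add hs₁).add
    ((polyBounded_const 2).add (hN.mul hs₂)))

theorem exists_polyBounded_openTable (hC : C.Efficient) (heff : MPCEfficient π)
    (t : ℕ → ℕ) (htn : ∀ k, t k < (π k).n) :
    ∃ s : ℕ → ℕ, PolyBounded s ∧ ∀ k, HasProgram (s k)
      fun b : Bits ((Fin (π k).n × (Fin (π k).viewLen ⊕ Fin (C.rLen k (π k).viewLen))) ⊕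
        Fin (π k).n) => openTable (t k) (fun q => b (.inl q)) (fun i => b (.inr i)) := by
  refine ⟨_, ?_, fun k => hasProgram_openTable (t k)⟩
  have hN := polyBounded_parties heff
  have hZ := polyBounded_card_respIdx hC heff fun k => (htn k).pos
  refine (((polyBounded_const 4).add (hN.mul ((polyBounded_const 11).add
    ((polyBounded_const 5).mul hN)))).add (hZ.mul (polyBounded_const 2))).mono fun k => ?_
  have h : t k / 2 ≤ (π k).n := (Nat.div_le_self _ _).trans (htn k).le
  simp only [Fintype.card_prod, Fintype.card_fin]
  gcongr

end

/-! ### Prover inputs in the key hybrids and in the simulation -/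

/-- The reference string with given keys and commitment. -/
def mkCrs {k : ℕ} (pk : Bits (Fin (C.pkLen k))) (c : Bits (Fin (C.cLen k 1)))
    (pk' : Bits (Fin (C.pkLen k))) : Bits (CrsIdx C k) :=
  Sum.elim pk (Sum.elim c pk')

/-- The witness for the second alternative of the claim: coins that open the commitment in the
reference string to `1`. -/
def coinWitness {k : ℕ} (r : Bits (Fin (C.rLen k 1))) : Bits (WitIdx R C k) :=
  Sum.elim (fun _ => true) (Sum.elim (fun _ => false) r)

theorem gameProb_proverData {k : ℕ} (π : MPCProtocol (PubIdx C k) (WitIdx R C k)) (t : ℕ)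
    (V : QVerifier (Fin k ⊕ (CrsIdx C k ⊕ (Fin π.n × Fin (C.cLen k π.viewLen)))) (Fin π.n)
      (Fin π.n × (Fin π.viewLen ⊕ Fin (C.rLen k π.viewLen))))
    (x : Bits (Fin k)) (crs : Bits (CrsIdx C k)) (W : Bits (WitIdx R C k)) (ρ : Bits (CoinIdx π)) :
    gameProb V (fun i => proverData π (Sum.elim (Sum.elim x crs) (Sum.elim W ρ)) (.inl i))
      (fun e => openTable t
        (fun q => proverData π (Sum.elim (Sum.elim x crs) (Sum.elim W ρ)) (.inr q)) e) =
      claimGame π t V x crs W ρ := rfl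

/-- Data that are hard-wired into the distinguishers of public keys: the instance, the witness of
the claim, the message in the commitment of the reference string and its coins, the coins of the
prover, and the other public key. -/
abbrev Advice {k : ℕ} (π : MPCProtocol (PubIdx C k) (WitIdx R C k)) : Type :=
  (Bits (Fin k) × Bits (WitIdx R C k)) × (Bits (Fin 1) × Bits (Fin (C.rLen k 1))) ×
    (Bits (CoinIdx π) × Bits (Fin (C.pkLen k)))

section

variable {k s : ℕ} (π : MPCProtocol (PubIdx C k) (WitIdx R C k)) (a : Advice π)

/-- The commitment in the reference string is made under the tested key, so the program has to
compute it; everything else is hard-wired. -/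
theorem hasProgram_firstKey (h : HasProgram s fun b : Bits (Fin (C.pkLen k) ⊕ (Fin 1 ⊕
        Fin (C.rLen k 1))) =>
      C.commit k 1 (fun i => b (.inl i)) (fun i => b (.inr (.inl i))) (fun i => b (.inr (.inr i)))) :
    HasProgram (2 + s) fun pk : Bits (Fin (C.pkLen k)) =>
      (Sum.elim (Sum.elim a.1.1 (mkCrs pk (C.commit k 1 pk a.2.1.1 a.2.1.2) a.2.2.2))
        (Sum.elim a.1.2 a.2.2.1) : Bits (PubIdx C k ⊕ (WitIdx R C k ⊕ CoinIdx π))) := by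
  let ι := Fin (C.pkLen k)
  let c : Bits ((Fin k ⊕ Fin (C.pkLen k)) ⊕ ((WitIdx R C k ⊕ CoinIdx π) ⊕
      (Fin 1 ⊕ Fin (C.rLen k 1)))) :=
    Sum.elim (Sum.elim a.1.1 a.2.2.2) (Sum.elim (Sum.elim a.1.2 a.2.2.1) (Sum.elim a.2.1.1 a.2.1.2))
  have h1 : HasProgram 2 _ := HasProgram.const (ι := ι) c
  have h2 := h.comap (ι := ι ⊕ ((Fin k ⊕ Fin (C.pkLen k)) ⊕ ((WitIdx R C k ⊕ CoinIdx π) ⊕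
      (Fin 1 ⊕ Fin (C.rLen k 1))))) (Sum.elim (fun i => .inl i)
        (fun i => .inr (.inr (.inr i))))
  have h3 := ((HasProgram.proj (id : ι → ι)).pair (h1.bind h2)).reindex
    (μ := PubIdx C k ⊕ (WitIdx R C k ⊕ CoinIdx π))
    (Sum.elim (Sum.elim (fun i => .inr (.inl (.inl (.inl i)))) (Sum.elim (fun i => .inl i)
        (Sum.elim (fun i => .inr (.inr i)) (fun i => .inr (.inl (.inl (.inr i)))))))
      (fun i => .inr (.inl (.inr (.inl i)))))
  refine (h3.mono (by omega)).congr fun pk => ?_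
  funext q
  rcases q with ((q | q | q | q) | q | q) <;> rfl

/-- Here the commitment is made under the other key and is a constant. -/
theorem hasProgram_secondKey (c : Bits (Fin (C.cLen k 1))) :
    HasProgram 2 fun pk : Bits (Fin (C.pkLen k)) =>
      (Sum.elim (Sum.elim a.1.1 (mkCrs a.2.2.2 c pk))
        (Sum.elim a.1.2 a.2.2.1) : Bits (PubIdx C k ⊕ (WitIdx R C k ⊕ CoinIdx π))) := by
  let ι := Fin (C.pkLen k)
  -- The entry at the second key is a filler; the reindexing below reads this position from the
  -- input.
  let c' : Bits (PubIdx C k ⊕ (WitIdx R C k ⊕ CoinIdx π)) :=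
    Sum.elim (Sum.elim a.1.1 (mkCrs a.2.2.2 c a.2.2.2)) (Sum.elim a.1.2 a.2.2.1)
  have h1 : HasProgram 2 _ := HasProgram.const (ι := ι) c'
  have h3 := ((HasProgram.proj (id : ι → ι)).pair h1).reindex
    (μ := PubIdx C k ⊕ (WitIdx R C k ⊕ CoinIdx π))
    (Sum.elim (Sum.elim (fun i => .inr (.inl (.inl i))) (Sum.elim (fun i => .inr (.inl (.inr (.inl i))))
        (Sum.elim (fun i => .inr (.inl (.inr (.inr (.inl i))))) (fun i => .inl i))))
      (fun i => .inr (.inr i)))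
  refine (h3.mono (by omega)).congr fun pk => ?_
  funext q
  rcases q with ((q | q | q | q) | q | q) <;> rfl

/-- Bit positions of the coins of the simulator. -/
abbrev SimCoinIdx : Type :=
  Fin (C.coinB k) ⊕ (Fin (C.rLen k 1) ⊕ (Fin (C.coinB k) ⊕ CoinIdx π))

/-- The input of the prover in the simulation: the commitment in the reference string contains `1`,
and its coins are the witness. -/
def simInput (b : Bits (Fin k ⊕ SimCoinIdx π)) :
    Bits (PubIdx C k ⊕ (WitIdx R C k ⊕ CoinIdx π)) :=
  Sum.elim (Sum.elim (fun i => b (.inl i))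
    (mkCrs (C.genB k fun i => b (.inr (.inl i))).1
      (C.commit k 1 (C.genB k fun i => b (.inr (.inl i))).1 (fun _ => true)
        fun i => b (.inr (.inr (.inl i))))
      (C.genB k fun i => b (.inr (.inr (.inr (.inl i))))).1))
    (Sum.elim (coinWitness fun i => b (.inr (.inr (.inl i))))
      fun i => b (.inr (.inr (.inr (.inr i)))))

theorem hasProgram_simInput {s' : ℕ} (h : HasProgram s fun b : Bits (Fin (C.pkLen k) ⊕ (Fin 1 ⊕
        Fin (C.rLen k 1))) =>
      C.commit k 1 (fun i => b (.inl i)) (fun i => b (.inr (.inl i))) (fun i => b (.inr (.inr i))))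
    (h' : HasProgram s' fun c : Bits (Fin (C.coinB k)) =>
      (Sum.elim (C.genB k c).1 (C.genB k c).2 : Bits (Fin (C.pkLen k) ⊕ Fin (C.skLen k)))) :
    HasProgram (2 + 2 * s' + s) (simInput π) := by
  let ι := Fin k ⊕ SimCoinIdx π
  let κ := Fin (C.pkLen k) ⊕ Fin (C.skLen k)
  have h0 : HasProgram 2 _ := HasProgram.const (ι := ι) (κ := Bool) id
  have h1 := h'.comap (ι := ι) fun i => .inr (.inl i)
  have h2 := h'.comap (ι := ι) fun i => .inr (.inr (.inr (.inl i)))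
  have h3 := h.comap (ι := ι ⊕ (Bool ⊕ (κ ⊕ κ))) (Sum.elim (fun i => .inr (.inr (.inl (.inl i))))
    (Sum.elim (fun _ => .inr (.inl true)) (fun i => .inl (.inr (.inr (.inl i))))))
  have h4 := ((HasProgram.proj (id : ι → ι)).pair ((h0.pair (h1.pair h2)).bind h3)).reindex
    (μ := PubIdx C k ⊕ (WitIdx R C k ⊕ CoinIdx π))
    (Sum.elim (Sum.elim (fun i => .inl (.inl i)) (Sum.elim (fun i => .inr (.inl (.inr (.inl (.inl i)))))
        (Sum.elim (fun i => .inr (.inr i)) (fun i => .inr (.inl (.inr (.inr (.inl i))))))))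
      (Sum.elim (Sum.elim (fun _ => .inr (.inl (.inl true))) (Sum.elim
          (fun _ => .inr (.inl (.inl false))) (fun i => .inl (.inr (.inr (.inl i))))))
        (fun i => .inl (.inr (.inr (.inr (.inr i)))))))
  refine (h4.mono (by omega)).congr fun pk => ?_
  funext q
  rcases q with ((q | q | q | q) | (q | q | q) | q) <;> rfl

end

end SuperpositionProof

/-! ## Zero-knowledge -/

theorem abs_uavg_sub_le_const {α : Type} [Fintype α] [Nonempty α] {f g : α → ℝ} {c : ℝ}
    (h : ∀ a, |f a - g a| ≤ c) : |uavg f - uavg g| ≤ c :=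
  (abs_uavg_sub_le h).trans_eq (uavg_const c)

namespace CommitmentScheme

variable {C : CommitmentScheme}

/-- Key indistinguishability, uniformly for hard-wired advice. -/
theorem KeysIndistinguishable.exists_negligible (h : C.KeysIndistinguishable) {A : ℕ → Type}
    [∀ k, Finite (A k)] [∀ k, Nonempty (A k)] (F : ∀ k, A k → Bits (Fin (C.pkLen k)) → ℝ)
    {p : ℕ → ℕ} (hp : PolyBounded p) (hF : ∀ k a, ∃ D : QDistinguisher (Fin (C.pkLen k)),
      D.size ≤ p k ∧ ∀ pk, D.prob pk = F k a pk) :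
    ∃ ε : ℕ → ℝ, Negligible ε ∧ ∀ k a,
      |(uavg fun s : Bits (Fin (C.coinH k)) => F k a (C.genH k s)) -
        uavg fun s : Bits (Fin (C.coinB k)) => F k a (C.genB k s).1| ≤ ε k := by
  choose D hD hDF using hF
  -- Distinguishers are non-uniform, so the worst advice for each `k` can be hard-wired; its
  -- advantage bounds all others.
  choose a ha using fun k => Finite.exists_max fun a : A k =>
    |(uavg fun s : Bits (Fin (C.coinH k)) => F k a (C.genH k s)) -
        uavg fun s : Bits (Fin (C.coinB k)) => F k a (C.genB k s).1|
  refine ⟨_, (h (fun k => D k (a k)) (hp.mono fun k => hD k (a k))).abs, fun k b => ?_⟩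
  simp only [hDF]
  exact ha k b

/-- Hiding, uniformly in the message. -/
theorem Hiding.exists_bound (h : C.Hiding) {ℓ : ℕ → ℕ} (hℓ : PolyBounded ℓ) :
    ∃ δ : ∀ k, Bits (Fin (C.pkLen k)) → ℝ,
      (∀ k pk m, statDist (C.commitDist k (ℓ k) pk m)
        (C.commitDist k (ℓ k) pk fun _ => false) ≤ δ k pk) ∧
      Negligible fun k => uavg fun s : Bits (Fin (C.coinH k)) => δ k (C.genH k s) := by
  -- The worst message depends on the key, which `Hiding` permits.
  choose m hm using fun k pk => Finite.exists_max fun m : Bits (Fin (ℓ k)) =>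
    statDist (C.commitDist k (ℓ k) pk m) (C.commitDist k (ℓ k) pk fun _ => false)
  exact ⟨_, hm, h ℓ hℓ m fun _ _ _ => false⟩

end CommitmentScheme

namespace SuperpositionProof

variable {R : NPRelation} {C : CommitmentScheme}

/-! ### Hybrid games -/

section

variable {k : ℕ} (π : MPCProtocol (PubIdx C k) (WitIdx R C k)) (t : ℕ)
  (V : QVerifier (Fin k ⊕ (CrsIdx C k ⊕ (Fin π.n × Fin (C.cLen k π.viewLen)))) (Fin π.n)
    (Fin π.n × (Fin π.viewLen ⊕ Fin (C.rLen k π.viewLen))))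
  (x : Bits (Fin k))

/-- The probability that the verifier `V` outputs `1`, when the commitment in the reference string
is a commitment to `m` with random coins `r`, the keys are `pk` and `pk'`, and the prover
uses the witness `W r`. -/
noncomputable def hybridGame (W : Bits (Fin (C.rLen k 1)) → Bits (WitIdx R C k))
    (m : Bits (Fin 1)) (pk pk' : Bits (Fin (C.pkLen k))) : ℝ :=
  uavg fun r => uavg fun ρ =>
    claimGame π t V x (mkCrs pk (C.commit k 1 pk m r) pk') (W r) ρ

/-- The witness is constant in `r`, so the game sees the coins `r` only through the commitment. This
fails for `coinWitness`, and is why the bit is changed before the witness. -/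
theorem abs_hybridGame_sub_le_statDist (W : Bits (WitIdx R C k))
    (m m' : Bits (Fin 1)) (pk pk' : Bits (Fin (C.pkLen k))) :
    |hybridGame π t V x (fun _ => W) m pk pk' - hybridGame π t V x (fun _ => W) m' pk pk'| ≤
      2 * statDist (C.commitDist k 1 pk m) (C.commitDist k 1 pk m') := by
  refine abs_uavg_comp_sub_le (C.commit k 1 pk m) (C.commit k 1 pk m')
    (f := fun c => uavg fun ρ => claimGame π t V x (mkCrs pk c pk') W ρ) fun c => ?_
  exact (abs_uavg_le _).trans (uavg_le_of_forall_le fun ρ => abs_gameProb_le_one _ _ _)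

/-- With the coins `r` fixed, both witnesses prove the claim: `w` proves `x ∈ L`, and `r` opens the
commitment to `1`. -/
theorem abs_hybridGame_sub_le {t : ℕ}
    (hpriv : π.Private (functionality R C k π.n) t) (htn : t < π.n)
    {w : Bits (Fin (R.witLen.eval k))} (hw : R.holds x w = true) (pk pk' : Bits (Fin (C.pkLen k)))
    {δ : ℝ} (hδ : ∀ v, statDist (C.commitDist k π.viewLen pk' v)
      (C.commitDist k π.viewLen pk' fun _ => false) ≤ δ) :
    |hybridGame π t V x (fun _ => liftWitness w) (fun _ => true) pk pk' -
      hybridGame π t V x coinWitness (fun _ => true) pk pk'| ≤ 4 * π.n * δ := by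
  refine abs_uavg_sub_le_const fun r => ?_
  refine abs_uavg_claimGame_sub_le π hpriv htn V x _ ?_ ?_ _ hδ
  · exact hw
  · exact decide_eq_true rfl

end

section

variable {π : ∀ k, MPCProtocol (PubIdx C k) (WitIdx R C k)} {t : ℕ → ℕ}

theorem polyBounded_card_verifierInput (hC : C.Efficient) (heff : MPCEfficient π)
    (hn : ∀ k, 0 < (π k).n) : PolyBounded fun k => Fintype.card
      (Fin k ⊕ (CrsIdx C k ⊕ (Fin (π k).n × Fin (C.cLen k (π k).viewLen)))) := by
  have hk : PolyBounded fun k => k := ⟨Polynomial.X, fun k => by simp⟩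
  refine (hk.add ((polyBounded_card_crsIdx hC).add
    (polyBounded_card_msgIdx hC heff hn))).mono fun k => ?_
  rw [Fintype.card_sum, Fintype.card_sum, Fintype.card_fin]

variable (V : ∀ k, QVerifier (Fin k ⊕ (CrsIdx C k ⊕ (Fin (π k).n × Fin (C.cLen k (π k).viewLen))))
  (Fin (π k).n) (Fin (π k).n × (Fin (π k).viewLen ⊕ Fin (C.rLen k (π k).viewLen))))

/-- The distinguisher builds the prover's input from the tested key and the advice, computes first
message and openings, and plays the whole game with the verifier. -/
theorem exists_negligible_key (hC : C.SecureDualMode) (heff : MPCEfficient π)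
    (htn : ∀ k, t k < (π k).n) (hV : PolyBounded fun k => (V k).size)
    (inp : ∀ k, Advice (π k) → Bits (Fin (C.pkLen k)) →
      Bits (PubIdx C k ⊕ (WitIdx R C k ⊕ CoinIdx (π k)))) {s : ℕ → ℕ} (hs : PolyBounded s)
    (h : ∀ k a, HasProgram (s k) (inp k a)) (F : ∀ k, Advice (π k) → Bits (Fin (C.pkLen k)) → ℝ)
    (hF : ∀ k a pk, gameProb (V k) (fun i => proverData (π k) (inp k a pk) (.inl i))
      (fun e => openTable (t k) (fun q => proverData (π k) (inp k a pk) (.inr q)) e) = F k a pk) :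
    ∃ ε : ℕ → ℝ, Negligible ε ∧ ∀ k a,
      |(uavg fun s : Bits (Fin (C.coinH k)) => F k a (C.genH k s)) -
        uavg fun s : Bits (Fin (C.coinB k)) => F k a (C.genB k s).1| ≤ ε k := by
  have hn : ∀ k, 0 < (π k).n := fun k => (htn k).pos
  obtain ⟨s₁, hs₁, h₁⟩ := exists_polyBounded_proverData hC.isEfficient heff hn
  obtain ⟨s₂, hs₂, h₂⟩ := exists_polyBounded_openTable hC.isEfficient heff t htn
  have hZ := polyBounded_card_respIdx hC.isEfficient heff hn
  have hN : PolyBounded fun k => Fintype.card (Fin (π k).n) := by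
    simpa only [Fintype.card_fin] using polyBounded_parties heff
  refine hC.keysIndistinguishable.exists_negligible F
    ((((polyBounded_const 5).mul ((hs.add hs₁).add hs₂)).add ((polyBounded_const 3).mul
      ((((polyBounded_card_verifierInput hC.isEfficient heff hn).add hZ).add hN).add hZ))).add
        (hV.add (polyBounded_const 1))) fun k a => ?_
  obtain ⟨D, hD, hDF⟩ := exists_game_distinguisher ((h₁ k).comp (h k a)) (h₂ k) (V k)
  exact ⟨D, hD, fun pk => (hDF pk).trans (hF k a pk)⟩

/-- The coins `r` and `ρ` are part of the advice and are averaged only afterwards; hence a witness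
depending on `r` is allowed. -/
theorem exists_negligible_firstKey (hC : C.SecureDualMode) (heff : MPCEfficient π)
    (htn : ∀ k, t k < (π k).n) (hV : PolyBounded fun k => (V k).size) :
    ∃ ε : ℕ → ℝ, Negligible ε ∧ ∀ k x W m pk',
      |(uavg fun s : Bits (Fin (C.coinH k)) =>
          hybridGame (π k) (t k) (V k) x W m (C.genH k s) pk') -
        uavg fun s : Bits (Fin (C.coinB k)) =>
          hybridGame (π k) (t k) (V k) x W m (C.genB k s).1 pk'| ≤ ε k := by
  obtain ⟨s, hs, h⟩ :=
    (hC.isEfficient.commit (fun _ => 1) (polyBounded_const 1)).exists_hasProgram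
  obtain ⟨ε, hε, H⟩ := exists_negligible_key (t := t) V hC heff htn hV _
    ((polyBounded_const 2).add hs) (fun k a => hasProgram_firstKey (π k) a (h k))
    (fun k a pk => claimGame (π k) (t k) (V k) a.1.1
      (mkCrs pk (C.commit k 1 pk a.2.1.1 a.2.1.2) a.2.2.2) a.1.2 a.2.2.1)
    fun k a pk => gameProb_proverData _ _ _ _ _ _ _
  refine ⟨ε, hε, fun k x W m pk' => ?_⟩
  unfold hybridGame
  rw [uavg_comm, uavg_comm (α := Bits (Fin (C.coinB k)))]
  refine abs_uavg_sub_le_const fun r => ?_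
  rw [uavg_comm, uavg_comm (α := Bits (Fin (C.coinB k)))]
  exact abs_uavg_sub_le_const fun ρ => H k ((x, W r), (m, r), (ρ, pk'))

theorem exists_negligible_secondKey (hC : C.SecureDualMode) (heff : MPCEfficient π)
    (htn : ∀ k, t k < (π k).n) (hV : PolyBounded fun k => (V k).size) :
    ∃ ε : ℕ → ℝ, Negligible ε ∧ ∀ k x W m pk,
      |(uavg fun s : Bits (Fin (C.coinH k)) =>
          hybridGame (π k) (t k) (V k) x W m pk (C.genH k s)) -
        uavg fun s : Bits (Fin (C.coinB k)) =>
          hybridGame (π k) (t k) (V k) x W m pk (C.genB k s).1| ≤ ε k := by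
  obtain ⟨ε, hε, H⟩ := exists_negligible_key (t := t) V hC heff htn hV _ (polyBounded_const 2)
    (fun k a => hasProgram_secondKey (π k) a (C.commit k 1 a.2.2.2 a.2.1.1 a.2.1.2))
    (fun k a pk => claimGame (π k) (t k) (V k) a.1.1
      (mkCrs a.2.2.2 (C.commit k 1 a.2.2.2 a.2.1.1 a.2.1.2) pk) a.1.2 a.2.2.1)
    fun k a pk => gameProb_proverData _ _ _ _ _ _ _
  refine ⟨ε, hε, fun k x W m pk => ?_⟩
  unfold hybridGame
  rw [uavg_comm, uavg_comm (α := Bits (Fin (C.coinB k)))]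
  refine abs_uavg_sub_le_const fun r => ?_
  rw [uavg_comm, uavg_comm (α := Bits (Fin (C.coinB k)))]
  exact abs_uavg_sub_le_const fun ρ => H k ((x, W r), (m, r), (ρ, pk))

/-- Six moves: both keys become hiding, the bit changes, the witness changes, both keys become
extractable again. Changing one key costs `ε₁` or `ε₂` and is done twice for each. -/
theorem exists_negligible_hybridGame (hC : C.SecureDualMode) (heff : MPCEfficient π)
    (htn : ∀ k, t k < (π k).n)
    (hpriv : ∀ k, (π k).Private (functionality R C k (π k).n) (t k))
    (hV : PolyBounded fun k => (V k).size) :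
    ∃ ε : ℕ → ℝ, Negligible ε ∧ ∀ k (x : Bits (Fin k)) (w : Bits (Fin (R.witLen.eval k))),
      R.holds x w = true →
      |(uavg fun s : Bits (Fin (C.coinB k)) => uavg fun s' : Bits (Fin (C.coinB k)) =>
          hybridGame (π k) (t k) (V k) x (fun _ => liftWitness w) (fun _ => false)
            (C.genB k s).1 (C.genB k s').1) -
        uavg fun s : Bits (Fin (C.coinB k)) => uavg fun s' : Bits (Fin (C.coinB k)) =>
          hybridGame (π k) (t k) (V k) x coinWitness (fun _ => true)
            (C.genB k s).1 (C.genB k s').1| ≤ ε k := by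
  have hn : ∀ k, 0 < (π k).n := fun k => (htn k).pos
  obtain ⟨ε₁, hε₁, H₁⟩ := exists_negligible_firstKey (t := t) V hC heff htn hV
  obtain ⟨ε₂, hε₂, H₂⟩ := exists_negligible_secondKey (t := t) V hC heff htn hV
  obtain ⟨δ, hδ, hδneg⟩ := hC.isHiding.exists_bound (heff.polyBounded_viewLen hn)
  have hhide := hC.isHiding (fun _ => 1) (polyBounded_const 1) (fun _ _ _ => false)
    (fun _ _ _ => true)
  refine ⟨_, ((hε₁.const_mul 2).add (hε₂.const_mul 2)).add ((hhide.const_mul 2).add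
    ((hδneg.polyBounded_mul (polyBounded_parties heff)).const_mul 4)), fun k x w hw => ?_⟩
  let g₀ := hybridGame (π k) (t k) (V k) x (fun _ => liftWitness w) (fun _ => false)
  let g₁ := hybridGame (π k) (t k) (V k) x (fun _ => liftWitness w) (fun _ => true)
  let g₂ := hybridGame (π k) (t k) (V k) x coinWitness (fun _ => true)
  let B := fun s => (C.genB k s).1
  let H := C.genH k
  -- The keys are independent, so the first is exchanged while the second is averaged from `genB`;
  -- `swap₂` then exchanges the second with a hiding first key.
  have swap₁ : ∀ W m,
      |(uavg fun s => uavg fun s' => hybridGame (π k) (t k) (V k) x W m (H s) (B s')) -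
        uavg fun s => uavg fun s' => hybridGame (π k) (t k) (V k) x W m (B s) (B s')| ≤ ε₁ k := by
    intro W m
    rw [uavg_comm, uavg_comm (fun s s' => hybridGame (π k) (t k) (V k) x W m (B s) (B s'))]
    exact abs_uavg_sub_le_const fun s' => H₁ k x W m (B s')
  have swap₂ : ∀ W m,
      |(uavg fun s => uavg fun s' => hybridGame (π k) (t k) (V k) x W m (H s) (H s')) -
        uavg fun s => uavg fun s' => hybridGame (π k) (t k) (V k) x W m (H s) (B s')| ≤ ε₂ k :=
    fun W m => abs_uavg_sub_le_const fun s => H₂ k x W m (H s)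
  have hide : |(uavg fun s => uavg fun s' => g₀ (H s) (H s')) -
      uavg fun s => uavg fun s' => g₁ (H s) (H s')| ≤
        2 * uavg fun s => statDist (C.commitDist k 1 (H s) fun _ => false)
          (C.commitDist k 1 (H s) fun _ => true) := by
    rw [← uavg_const_mul]
    exact abs_uavg_sub_le fun s => abs_uavg_sub_le_const fun s' =>
      abs_hybridGame_sub_le_statDist _ _ _ _ _ _ _ _ _
  have wi : |(uavg fun s => uavg fun s' => g₁ (H s) (H s')) -
      uavg fun s => uavg fun s' => g₂ (H s) (H s')| ≤
        4 * ((π k).n * uavg fun s => δ k (H s)) := by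
    rw [← mul_assoc, ← uavg_const_mul]
    exact abs_uavg_sub_le_const fun s => abs_uavg_sub_le fun s' =>
      abs_hybridGame_sub_le _ _ _ (hpriv k) (htn k) hw _ _ (hδ k (H s'))
  have a₁ := abs_le.1 (swap₁ (fun _ => liftWitness w) fun _ => false)
  have a₂ := abs_le.1 (swap₂ (fun _ => liftWitness w) fun _ => false)
  have a₃ := abs_le.1 hide
  have a₄ := abs_le.1 wi
  have a₅ := abs_le.1 (swap₁ coinWitness fun _ => true)
  have a₆ := abs_le.1 (swap₂ coinWitness fun _ => true)
  simp only [g₀, g₁, g₂, H, B] at a₁ a₂ a₃ a₄ a₅ a₆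
  rw [abs_le]
  constructor <;> linarith [a₁.1, a₁.2, a₂.1, a₂.2, a₃.1, a₃.2, a₄.1, a₄.2, a₅.1, a₅.2, a₆.1, a₆.2]

end

end SuperpositionProof

theorem uavg_congr_inst {α : Type} (i j : Fintype α) {f g : α → ℝ} (h : ∀ a, f a = g a) :
    @uavg α i f = @uavg α j g := by
  rw [funext h, uavg_inst i j]

/-! ### The real and the simulated game as hybrid games -/

namespace SuperpositionProof

variable {R : NPRelation} {C : CommitmentScheme}
  {π : ∀ k, MPCProtocol (PubIdx C k) (WitIdx R C k)} {t : ℕ → ℕ}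

theorem realProb_eq (k : ℕ)
    (V : QVerifier ((proofSystem π t).VInput k) ((proofSystem π t).Chal k)
      ((proofSystem π t).Resp k))
    (x : Bits (Fin k)) (w : Bits (Fin (R.witLen.eval k))) :
    (proofSystem π t).realProb k V x w =
      uavg fun s : Bits (Fin (C.coinB k)) => uavg fun s' : Bits (Fin (C.coinB k)) =>
        hybridGame (π k) (t k) V x (fun _ => liftWitness w) (fun _ => false)
          (C.genB k s).1 (C.genB k s').1 := by
  classical
  have h : (proofSystem π t).realProb k V x w =
      uavg fun s : Bits (Fin (C.coinB k) ⊕ (Fin (C.rLen k 1) ⊕ Fin (C.coinB k))) =>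
        uavg fun ρ : Bits (CoinIdx (π k)) =>
          claimGame (π k) (t k) V x (genCrs k s) (liftWitness w) ρ := by
    unfold CRSProof.realProb
    exact uavg_congr_inst _ _ fun s => uavg_congr_inst _ _ fun ρ => rfl
  rw [h, uavg_bits_sum]
  refine uavg_congr fun s => ?_
  rw [uavg_bits_sum, uavg_comm]
  refine uavg_congr fun s' => uavg_congr fun r => uavg_inst _ _ _

/-- The simulation equals the last hybrid exactly: all coins are uniform, the reference string
contains a commitment to `1`, and the coins of this commitment serve as witness. -/
theorem exists_simulator (hC : C.Efficient) (heff : MPCEfficient π) (htn : ∀ k, t k < (π k).n) :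
    ∃ S : ∀ k, QSimulator (Fin k) (CrsIdx C k ⊕ (Fin (π k).n × Fin (C.cLen k (π k).viewLen)))
        (Fin (π k).n) (Fin (π k).n × (Fin (π k).viewLen ⊕ Fin (C.rLen k (π k).viewLen))),
      PolyBounded (fun k => (S k).size) ∧ ∀ k V x, (S k).prob V x =
        uavg fun s : Bits (Fin (C.coinB k)) => uavg fun s' : Bits (Fin (C.coinB k)) =>
          hybridGame (π k) (t k) V x coinWitness (fun _ => true)
            (C.genB k s).1 (C.genB k s').1 := by
  classical
  have hn : ∀ k, 0 < (π k).n := fun k => (htn k).pos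
  obtain ⟨s₁, hs₁, h₁⟩ := exists_polyBounded_proverData hC heff hn
  obtain ⟨s₂, hs₂, h₂⟩ := exists_polyBounded_openTable hC heff t htn
  obtain ⟨s₃, hs₃, h₃⟩ := (hC.commit (fun _ => 1) (polyBounded_const 1)).exists_hasProgram
  obtain ⟨s₄, hs₄, h₄⟩ := hC.genB.exists_hasProgram
  have hZ := polyBounded_card_respIdx hC heff hn
  choose S hS hSprob using fun k => exists_game_simulator
    (((h₁ k).comp (hasProgram_simInput (π k) (h₃ k) (h₄ k))).reindex
      (μ := (CrsIdx C k ⊕ (Fin (π k).n × Fin (C.cLen k (π k).viewLen))) ⊕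
        (Fin (π k).n × (Fin (π k).viewLen ⊕ Fin (C.rLen k (π k).viewLen))))
      -- The instance is dropped from the computed data, because the verifier receives it separately
      -- from the simulator's message.
      (Sum.map Sum.inr id)) (h₂ k)
  have hQ : PolyBounded fun k => Fintype.card (SimCoinIdx (π k)) := by
    have hN := polyBounded_parties heff
    have hB := hC.genB.polyBounded_card_in
    have hr := (hC.commit (fun _ => 1) (polyBounded_const 1)).polyBounded_card_in
    refine (hB.add (hr.add (hB.add ((PolySizeComputable.polyBounded_card_in heff).add hZ)))).mono
      fun k => ?_
    simp only [Fintype.card_sum, Fintype.card_prod, Fintype.card_fin, mul_add]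
    omega
  refine ⟨S, (((polyBounded_const 5).mul ((((polyBounded_const 2).add
    ((polyBounded_const 2).mul hs₄)).add hs₃ |>.add hs₁).add hs₂)).add
      ((polyBounded_const 3).mul (((hQ.add ((polyBounded_card_crsIdx hC).add
        (polyBounded_card_msgIdx hC heff hn))).add hZ).add hZ))).mono fun k => ?_, ?_⟩
  · refine (hS k).trans_eq ?_
    rw [Fintype.card_sum (α := CrsIdx C k)]
  · intro k V x
    rw [hSprob, uavg_bits_sum]
    refine uavg_congr fun s => ?_
    simp only [uavg_bits_sum (ι := Fin (C.rLen k 1)), uavg_bits_sum (ι := Fin (C.coinB k))]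
    rw [uavg_comm]
    refine uavg_congr fun s' => uavg_congr fun r => uavg_congr_inst _ _ fun ρ => ?_
    refine Eq.trans ?_ (gameProb_proverData (π k) (t k) V x _ _ ρ)
    congr 1

theorem proofSystem_superpositionZK (hC : C.SecureDualMode) (heff : MPCEfficient π)
    (htn : ∀ k, t k < (π k).n)
    (hpriv : ∀ k, (π k).Private (functionality R C k (π k).n) (t k)) :
    (proofSystem π t).SuperpositionZK fun _ x w => R.holds x w = true := by
  obtain ⟨S, hS, hSprob⟩ := exists_simulator (t := t) hC.isEfficient heff htn
  refine ⟨S, hS, fun V hV => ?_⟩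
  obtain ⟨ε, hε, H⟩ := exists_negligible_hybridGame V hC heff htn hpriv hV
  refine ⟨ε, hε, fun k x w hw => ?_⟩
  have h := H k x w hw
  rw [← hSprob k (V k) x, ← realProb_eq k (V k) x w] at h
  exact h

end SuperpositionProof

theorem mainTheorem2 (R : NPRelation) (C : CommitmentScheme) (hC : C.SecureDualMode)
    (π : ∀ k, MPCProtocol (SuperpositionProof.PubIdx C k) (SuperpositionProof.WitIdx R C k))
    (t : ℕ → ℕ)
    (hsec : ∀ k, (π k).Secure (SuperpositionProof.functionality R C k (π k).n) (t k))
    (heff : MPCEfficient π)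
    (htn : ∀ k, t k < (π k).n)
    (hlin : ∃ c₁ c₂ : ℝ, 0 < c₁ ∧ c₂ < 1 ∧
      ∀ᶠ k in Filter.atTop, c₁ * (π k).n ≤ t k ∧ (t k : ℝ) ≤ c₂ * (π k).n)
    (hn : (fun k : ℕ => Real.log k) =o[Filter.atTop] (fun k : ℕ => ((π k).n : ℝ))) :
    (SuperpositionProof.proofSystem π t).Complete (fun _ x w => R.holds x w = true) ∧
    (SuperpositionProof.proofSystem π t).Sound R.language ∧
    (SuperpositionProof.proofSystem π t).SuperpositionZK (fun _ x w => R.holds x w = true) :=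
  ⟨SuperpositionProof.proofSystem_complete π t (fun k => (hsec k).correct) htn,
    SuperpositionProof.proofSystem_sound hC.isExtractable π t (fun k => (hsec k).robust) heff htn
      hlin hn,
    SuperpositionProof.proofSystem_superpositionZK hC heff htn fun k => (hsec k).isPrivate⟩
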